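/- For a unital $\mathrm C^*$-algebra $A$ let $U^\infty(A)=\bigcup_n U(M_n(A))$ (embeddings $u\mapsto \operatorname{diag}(u,1)$, inductive limit topology), let $U^\infty_0(A)$ be the union of the identity components of the groups $U(M_n(A))$, let $DU^\infty(A)$ be the commutator subgroup of $U^\infty(A)$, and put $$\overline{\mathrm K}_1(A)=U^\infty(A)/\overline{DU^\infty(A)},\qquad \mathrm K_1(A)=U^\infty(A)/U_0^\infty(A),$$ with classes $\overline u$ and $[u]$. Let $T_1(A)$ be the space of tracial states of $A$, let $\operatorname{Aff}T_1(A)$ be the space of real continuous affine functions on it with the supremum norm, and write $\mathrm{ev}_h\colon\tau\mapsto\tau(h)$ for self-adjoint $h\in A$. Put $\mathrm H(A)=\operatorname{Aff}T_1(A)/\overline{\mathrm K_0(A)}$ with the quotient norm, where $\overline{\mathrm K_0(A)}$ is the closure of the subgroup generated by the functions $\mathrm{ev}_{\mathrm{tr}(p)}$, $p\in M_n(A)$ a projection, $n\in\mathbb N$, and $\mathrm{tr}(p)=\sum_i p_{ii}$. Let $\overline\Delta\colon U_0^\infty(A)\to \mathrm H(A)$ be the determinant $$\overline\Delta(u)=\Big[\mathrm{ev}_h\Big],\qquad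 h=\tfrac1{2\pi i}\int_0^1\mathrm{tr}\big(\xi'(t)\xi(t)^{-1}\big)\,dt,$$ for any smooth path $\xi\colon[0,1]\to U(M_n(A))$ with $\xi(0)=1$ and $\xi(1)=u$. A *Nielsen-Thomsen basis* of $A$ is a family $\mathcal C=\{c_k\}_{k\in \mathrm K_1(A)}$ in $U^\infty(A)$ with $c_0=1$ and $[c_k]=k$ for all $k$, such that $k\mapsto\overline{c_k}$ is a group homomorphism $\mathrm K_1(A)\to\overline{\mathrm K}_1(A)$. Let $A,B$ be unital $\mathrm C^*$-algebras. A *-homomorphism $\phi\colon A\to B$ (unital or not) acts on unitaries by $u\mapsto\phi(u)+1-\phi(1)$ (which is $\phi(u)$ if $\phi$ is unital; we denote it by $\phi(u)$ in all cases) and so induces $\overline{\mathrm K}_1(\phi)$ and $\mathrm K_1(\phi)$. For Nielsen-Thomsen bases $\mathcal C=\{c_k\}$ of $A$ and $\mathcal D=\{d_k\}$ of $B$, the rotation map of $\phi$ is $$R_{\mathcal C\mathcal D}(\phi)\colon \mathrm K_1(A)\to \mathrm H(B),\qquad k\mapsto\overline\Delta\begin{pmatrix}\phi(c_k)&0\\0&d_{\mathrm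 K_1(\phi)(k)}^*\end{pmatrix}.$$ For *-homomorphisms $\phi,\psi\colon A\to B$ define, with values in $[0,\infty]$, $$\mathfrak d_{\mathcal C\mathcal D}\big(\overline{\mathrm K}_1(\phi),\overline{\mathrm K}_1(\psi)\big)=\sup_{h=h^*\in A}\big\|[\mathrm{ev}_{\phi(h)}]-[\mathrm{ev}_{\psi(h)}]\big\|_{\mathrm H(B)}+\sup_{k\in \mathrm K_1(A)}\big\|R_{\mathcal C\mathcal D}(\phi)(k)-R_{\mathcal C\mathcal D}(\psi)(k)\big\|_{\mathrm H(B)}+d_{\mathrm{triv}}\big(\mathrm K_1(\phi),\mathrm K_1(\psi)\big),$$ where $d_{\mathrm{triv}}$ is $0$ if the two maps agree and $\infty$ otherwise. **Theorem.** Let $\mathcal C,\mathcal C'$ be Nielsen-Thomsen bases of $A$ and $\mathcal D,\mathcal D'$ Nielsen-Thomsen bases of $B$. Then for all *-homomorphisms $\phi,\psi\colon A\to B$, $$\mathfrak d_{\mathcal C\mathcal D}\big(\overline{\mathrm K}_1(\phi),\overline{\mathrm K}_1(\psi)\big)\le 2\,\mathfrak d_{\mathcal C'\mathcal D'}\big(\overline{\mathrm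 K}_1(\phi),\overline{\mathrm K}_1(\psi)\big).$$ In particular, $\mathfrak d_{\mathcal C\mathcal D}$ and $\mathfrak d_{\mathcal C'\mathcal D'}$ are equivalent metrics: both are well-defined $[0,\infty]$-valued metrics on the set $\{\overline{\mathrm K}_1(\phi) : \phi\colon A\to B \text{ a *-homomorphism}\}$, and they induce the same topology on it. -/

import Mathlib

open Set
open scoped ContDiff ENNReal ComplexOrder BoundedContinuousFunction

noncomputable section

set_option linter.unusedSectionVars false

namespace NielsenThomsen

universe u v

/-! ### Unitary groups of matrix algebras and their direct limit -/

section Unitization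

variable {R S Q : Type*} [Ring R] [StarRing R] [Module ℂ R] [Ring S] [StarRing S] [Module ℂ S]
  [Ring Q] [StarRing Q] [Module ℂ Q]

/-- The homomorphism of unitary groups `u ↦ f u + (1 - f 1)` induced by a (not necessarily unital)
*-homomorphism `f` of unital *-algebras. If `f` is unital, it is `u ↦ f u`. -/
def unitaryMap (f : R →⋆ₙₐ[ℂ] S) : unitary R →* unitary S where
  toFun w := ⟨f w + (1 - f 1), by
    have h1 : f (star (w : R)) * f w = f 1 := by
      rw [← map_mul, Unitary.coe_star_mul_self]
    have h2 : f (w : R) * f (star (w : R)) = f 1 := by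
      rw [← map_mul, ← Unitary.coe_star, Unitary.coe_mul_star_self]
    have e1 : ∀ x : R, f x * f 1 = f x := fun x => by rw [← map_mul, mul_one]
    have e2 : ∀ x : R, f 1 * f x = f x := fun x => by rw [← map_mul, one_mul]
    have hs : star (f (w : R) + (1 - f 1)) = f (star (w : R)) + (1 - f 1) := by
      simp [← map_star]
    rw [Unitary.mem_iff, hs]
    constructor <;> simp only [mul_add, add_mul, mul_sub, sub_mul, h1, h2, e1, e2, mul_one,
      one_mul] <;> abel⟩
  map_one' := by ext; simp
  map_mul' a b := by
    ext
    have e1 : ∀ x : R, f x * f 1 = f x := fun x => by rw [← map_mul, mul_one]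
    have e2 : ∀ x : R, f 1 * f x = f x := fun x => by rw [← map_mul, one_mul]
    simp only [Submonoid.coe_mul, map_mul, mul_add, add_mul, mul_sub, sub_mul, e1, e2, mul_one,
      one_mul]
    abel

lemma coe_unitaryMap (f : R →⋆ₙₐ[ℂ] S) (w : unitary R) :
    (unitaryMap f w : S) = f w + (1 - f 1) := rfl

lemma unitaryMap_comp (g : S →⋆ₙₐ[ℂ] Q) (f : R →⋆ₙₐ[ℂ] S) (w : unitary R) :
    unitaryMap g (unitaryMap f w) = unitaryMap (g.comp f) w := by
  ext
  simp only [coe_unitaryMap, NonUnitalStarAlgHom.comp_apply, map_add, map_sub]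
  abel

lemma continuous_unitaryMap [TopologicalSpace R] [TopologicalSpace S] [ContinuousAdd S]
    (f : R →⋆ₙₐ[ℂ] S) (hf : Continuous f) : Continuous (unitaryMap f) :=
  Continuous.subtype_mk ((hf.comp continuous_subtype_val).add continuous_const) _

end Unitization

/-- The C*-algebra `M_n(A)`. -/
abbrev Mat (A : Type u) (n : ℕ) : Type u := CStarMatrix (Fin n) (Fin n) A

section Groups

variable (A : Type u) [CStarAlgebra A] [PartialOrder A] [StarOrderedRing A]

/-- The unitary group `U(M_n(A))`, with the norm topology. -/
abbrev U (n : ℕ) : Type u := unitary (Mat A n)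

variable {A} in
/-- The matrix `diag(a, 0) ∈ M_m(A)` for `a ∈ M_n(A)`, `n ≤ m`. -/
def cornerFun {n : ℕ} (m : ℕ) (a : Mat A n) : Mat A m :=
  CStarMatrix.ofMatrix fun i j =>
    if hij : i.1 < n ∧ j.1 < n then a ⟨i, hij.1⟩ ⟨j, hij.2⟩ else 0

variable {A} in
lemma cornerFun_apply {n m : ℕ} (a : Mat A n) (i j : Fin m) :
    cornerFun m a i j = if hij : i.1 < n ∧ j.1 < n then a ⟨i, hij.1⟩ ⟨j, hij.2⟩ else 0 := rfl

variable {A} in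
/-- The upper left corner embedding `M_n(A) → M_m(A)`, `a ↦ diag(a, 0)`, for `n ≤ m`. -/
def corner {n m : ℕ} (h : n ≤ m) : Mat A n →⋆ₙₐ[ℂ] Mat A m where
  toFun a := cornerFun m a
  map_smul' c a := by
    ext i j
    by_cases hij : i.1 < n ∧ j.1 < n <;> simp [hij, cornerFun_apply]
  map_zero' := by
    ext i j
    simp [cornerFun_apply]
  map_add' a b := by
    ext i j
    by_cases hij : i.1 < n ∧ j.1 < n <;> simp [hij, cornerFun_apply]
  map_mul' a b := by
    obtain ⟨k, rfl⟩ := Nat.exists_eq_add_of_le h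
    ext i j
    rw [CStarMatrix.mul_apply, Fin.sum_univ_add]
    by_cases hi : i.1 < n <;> by_cases hj : j.1 < n <;>
      simp [hi, hj, CStarMatrix.mul_apply, cornerFun_apply]
  map_star' a := by
    ext i j
    by_cases hi : i.1 < n <;> by_cases hj : j.1 < n <;>
      simp [hi, hj, CStarMatrix.star_apply, cornerFun_apply]

variable {A} in
lemma corner_apply {n m : ℕ} (h : n ≤ m) (a : Mat A n) (i j : Fin m) :
    corner h a i j = if hij : i.1 < n ∧ j.1 < n then a ⟨i, hij.1⟩ ⟨j, hij.2⟩ else 0 := rfl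

/-- The connecting map `U(M_n(A)) → U(M_m(A))`, `w ↦ diag(w, 1)`. -/
def pad (n m : ℕ) (h : n ≤ m) : U A n →* U A m := unitaryMap (corner h)

instance directedSystem_pad : DirectedSystem (U A) (pad A · · ·) where
  map_self n x := by
    ext i j
    simp [pad, coe_unitaryMap, corner_apply, CStarMatrix.one_apply]
  map_map k j i hij hjk x := by
    have : (corner hjk).comp (corner hij) = (corner (hij.trans hjk) : Mat A _ →⋆ₙₐ[ℂ] _) := by
      ext a p q
      rw [NonUnitalStarAlgHom.comp_apply, corner_apply, corner_apply]
      simp only [corner_apply]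
      by_cases hp : p.1 < i <;> by_cases hq : q.1 < i
      · simp [hp, hq, hp.trans_le hij, hq.trans_le hij]
      all_goals simp [hp, hq]
    simp only [pad, unitaryMap_comp, this]

/-- `U^∞(A) = ⋃ₙ U(M_n(A))`. -/
def UInf : Type u := DirectLimit (U A) (pad A)

instance : Group (UInf A) := inferInstanceAs (Group (DirectLimit (U A) (pad A)))

/-- The inclusion `U(M_n(A)) → U^∞(A)`. -/
def UInf.of (n : ℕ) : U A n →* UInf A where
  toFun x := (⟦⟨n, x⟩⟧ : DirectLimit (U A) (pad A))
  map_one' := (DirectLimit.one_def n).symm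
  map_mul' x y := (DirectLimit.mul_def n x y).symm

variable {A} in
lemma UInf.exists_of (x : UInf A) : ∃ n y, UInf.of A n y = x := by
  obtain ⟨n, y, h⟩ := DirectLimit.exists_eq_mk (pad A) x
  exact ⟨n, y, h.symm⟩

lemma UInf.of_pad {n m : ℕ} (h : n ≤ m) (x : U A n) :
    UInf.of A m (pad A n m h x) = UInf.of A n x :=
  DirectLimit.mk_apply (f := pad A) n m x h

lemma continuous_pad {n m : ℕ} (h : n ≤ m) : Continuous (pad A n m h) :=
  continuous_unitaryMap _ (map_continuous (corner h))

/-- The inductive limit topology on `U^∞(A)`: a set is closed if and only if its preimage in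
every `U(M_n(A))` is closed. -/
instance : TopologicalSpace (UInf A) :=
  ⨆ n, TopologicalSpace.coinduced (UInf.of A n) inferInstance

lemma UInf.continuous_of (n : ℕ) : Continuous (UInf.of A n) :=
  continuous_iff_coinduced_le.2 (le_iSup (fun n =>
    TopologicalSpace.coinduced (UInf.of A n) inferInstance) n)

variable {A} in
lemma UInf.continuous_iff {X : Type*} [TopologicalSpace X] {f : UInf A → X} :
    Continuous f ↔ ∀ n, Continuous fun x => f (UInf.of A n x) :=
  continuous_iSup_dom.trans (forall_congr' fun _ => continuous_coinduced_dom)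

instance : SeparatelyContinuousMul (UInf A) where
  continuous_const_mul {x} := by
    obtain ⟨m, y, rfl⟩ := UInf.exists_of x
    refine UInf.continuous_iff.2 fun n => ?_
    have : (fun z => UInf.of A m y * UInf.of A n z) = fun z => UInf.of A (max m n)
        (pad A m _ (le_max_left m n) y * pad A n _ (le_max_right m n) z) := by
      funext z
      rw [map_mul, UInf.of_pad, UInf.of_pad]
    rw [this]
    exact (UInf.continuous_of A _).comp (continuous_const.mul (continuous_pad A _))
  continuous_mul_const {x} := by
    obtain ⟨m, y, rfl⟩ := UInf.exists_of x
    refine UInf.continuous_iff.2 fun n => ?_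
    have : (fun z => UInf.of A n z * UInf.of A m y) = fun z => UInf.of A (max m n)
        (pad A n _ (le_max_right m n) z * pad A m _ (le_max_left m n) y) := by
      funext z
      rw [map_mul, UInf.of_pad, UInf.of_pad]
    rw [this]
    exact (UInf.continuous_of A _).comp ((continuous_pad A _).mul continuous_const)

instance : ContinuousInv (UInf A) where
  continuous_inv := UInf.continuous_iff.2 fun n => by
    simp only [← map_inv]
    exact (UInf.continuous_of A n).comp continuous_inv

/-- The closure `\overline{DU^∞(A)}` of the commutator subgroup of `U^∞(A)`. -/
def DUbar : Subgroup (UInf A) where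
  carrier := closure (commutator (UInf A) : Set (UInf A))
  one_mem' := subset_closure (one_mem _)
  inv_mem' {x} hx := by
    have := map_mem_closure continuous_inv hx
      (t := (commutator (UInf A) : Set (UInf A))) fun y hy => inv_mem hy
    exact this
  mul_mem' {x y} hx hy := by
    have h1 : ∀ z ∈ commutator (UInf A),
        z * y ∈ closure (commutator (UInf A) : Set (UInf A)) := fun z hz =>
      map_mem_closure (continuous_const_mul z) hy fun w hw => mul_mem hz hw
    have h2 := map_mem_closure (continuous_mul_const y) hx h1
    rwa [closure_closure] at h2

instance : (DUbar A).Normal where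
  conj_mem _ hx g :=
    map_mem_closure (f := fun x => g * x * g⁻¹)
      ((continuous_mul_const g⁻¹).comp (continuous_const_mul g)) hx
      fun y hy => (inferInstance : (commutator (UInf A)).Normal).conj_mem y hy g

/-- The subgroup `U_0^∞(A)` of `U^∞(A)`: the union of the images of the connected components of
the identity of the groups `U(M_n(A))`. -/
def U0Inf : Subgroup (UInf A) :=
  ⨆ n, (Subgroup.connectedComponentOfOne (U A n)).map (UInf.of A n)

variable {A} in
lemma of_mem_U0Inf {n : ℕ} {x : U A n} (hx : x ∈ Subgroup.connectedComponentOfOne (U A n)) :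
    UInf.of A n x ∈ U0Inf A :=
  Subgroup.mem_iSup_of_mem n ⟨x, hx, rfl⟩

lemma mem_connectedComponentOfOne_of_continuous {G H : Type*} [Group G] [TopologicalSpace G]
    [IsTopologicalGroup G] [Group H] [TopologicalSpace H] [IsTopologicalGroup H] (f : G →* H)
    (hf : Continuous f) {x : G} (hx : x ∈ Subgroup.connectedComponentOfOne G) :
    f x ∈ Subgroup.connectedComponentOfOne H := by
  have := hf.image_connectedComponent_subset 1 ⟨x, hx, rfl⟩
  rwa [map_one] at this

instance : (U0Inf A).Normal where
  conj_mem _ hx g := by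
    suffices h : U0Inf A ≤ (U0Inf A).comap (MulAut.conj g).toMonoidHom from h hx
    refine iSup_le fun n => Subgroup.map_le_iff_le_comap.2 fun x hx => ?_
    obtain ⟨m, y, rfl⟩ := UInf.exists_of g
    have h1 := mem_connectedComponentOfOne_of_continuous
      ((MulAut.conj (pad A m _ (le_max_left m n) y)).toMonoidHom.comp
        (pad A n _ (le_max_right m n)))
      ((continuous_mul_const _).comp ((continuous_const_mul _).comp (continuous_pad A _))) hx
    have h2 := of_mem_U0Inf h1
    simpa [UInf.of_pad] using h2

/-- The Hausdorffized algebraic `K_1`-group `U^∞(A) / \overline{DU^∞(A)}`, written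
multiplicatively. -/
abbrev K1bar : Type u := UInf A ⧸ DUbar A

/-- The group `K_1(A) = U^∞(A) / U_0^∞(A)`, written multiplicatively. -/
abbrev K1 : Type u := UInf A ⧸ U0Inf A

variable {A} in
/-- The class of a unitary in `\overline{K}_1(A)`. -/
def toK1bar : UInf A →* K1bar A := QuotientGroup.mk' (DUbar A)

variable {A} in
/-- The class of a unitary in `K_1(A)`. -/
def toK1 : UInf A →* K1 A := QuotientGroup.mk' (U0Inf A)

/-! ### Block diagonal sums -/

variable {A} in
/-- The block diagonal matrix `diag(x, y) ∈ U(M_{n+m}(A))`. -/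
def blockDiag {n m : ℕ} (x : U A n) (y : U A m) : U A (n + m) :=
  ⟨CStarMatrix.ofMatrix (Matrix.reindex finSumFinEquiv finSumFinEquiv
      (Matrix.fromBlocks (CStarMatrix.ofMatrix.symm (x : Mat A n)) 0 0
        (CStarMatrix.ofMatrix.symm (y : Mat A m)))), by
    have key : ∀ z : Matrix (Fin n ⊕ Fin m) (Fin n ⊕ Fin m) A, z ∈ unitary _ →
        Matrix.reindex finSumFinEquiv finSumFinEquiv z ∈
          unitary (Matrix (Fin (n + m)) (Fin (n + m)) A) := fun z hz => by
      rw [Unitary.mem_iff] at hz ⊢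
      simp only [Matrix.star_eq_conjTranspose, Matrix.reindex_apply, Matrix.conjTranspose_submatrix,
        Matrix.submatrix_mul_equiv] at hz ⊢
      rw [hz.1, hz.2, Matrix.submatrix_one_equiv]
      exact ⟨rfl, rfl⟩
    refine key (Matrix.fromBlocks (CStarMatrix.ofMatrix.symm (x : Mat A n)) 0 0
      (CStarMatrix.ofMatrix.symm (y : Mat A m))) ?_
    have hx : (Matrix.conjTranspose (CStarMatrix.ofMatrix.symm (x : Mat A n))
          * CStarMatrix.ofMatrix.symm (x : Mat A n) = 1) ∧
        (CStarMatrix.ofMatrix.symm (x : Mat A n) *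
          Matrix.conjTranspose (CStarMatrix.ofMatrix.symm (x : Mat A n)) = 1) :=
      Unitary.mem_iff.1 x.2
    have hy : (Matrix.conjTranspose (CStarMatrix.ofMatrix.symm (y : Mat A m))
          * CStarMatrix.ofMatrix.symm (y : Mat A m) = 1) ∧
        (CStarMatrix.ofMatrix.symm (y : Mat A m) *
          Matrix.conjTranspose (CStarMatrix.ofMatrix.symm (y : Mat A m)) = 1) :=
      Unitary.mem_iff.1 y.2
    rw [Unitary.mem_iff]
    simp [Matrix.star_eq_conjTranspose, Matrix.fromBlocks_conjTranspose,
      Matrix.fromBlocks_multiply, hx, hy]⟩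

variable {A} in
/-- The block diagonal sum `diag(x, y)` of `x, y ∈ U^∞(A)`, formed from matrices representing `x`
and `y`. It depends on the chosen matrices only up to conjugation by a permutation matrix. -/
def UInf.diag (x y : UInf A) : UInf A :=
  let p : Σ n, U A n := Quotient.out (s := DirectLimit.setoid (pad A)) x
  let q : Σ n, U A n := Quotient.out (s := DirectLimit.setoid (pad A)) y
  UInf.of A (p.1 + q.1) (blockDiag p.2 q.2)

/-! ### Tracial states and the group `H(A)` -/

/-- The space `T_1(A)` of tracial states of `A`, with the weak-* topology. -/
def tracialStates : Set (WeakDual ℂ A) :=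
  {τ | (∀ a : A, 0 ≤ τ (star a * a)) ∧ τ 1 = 1 ∧ ∀ a b : A, τ (a * b) = τ (b * a)}

variable {A} in
lemma abs_re_tracialState_le (τ : tracialStates A) (a : A) : |(τ.1 a).re| ≤ ‖a‖ := by
  obtain ⟨τ, hpos, hone, -⟩ := τ
  have hpos' : ∀ b : A, 0 ≤ b → 0 ≤ τ b := fun b hb => by
    obtain ⟨c, rfl⟩ := CStarAlgebra.nonneg_iff_eq_star_mul_self.1 hb
    exact hpos c
  have key : ∀ h : A, IsSelfAdjoint h → (τ h).re ≤ ‖h‖ ∧ (τ h).im = 0 := fun h hh => by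
    have h1 := hpos' _ (sub_nonneg.2 (IsSelfAdjoint.le_algebraMap_norm_self hh))
    have h2 : τ (algebraMap ℝ A ‖h‖) = (‖h‖ : ℂ) := by
      rw [Algebra.algebraMap_eq_smul_one, ← Complex.coe_smul, map_smul, hone, smul_eq_mul, mul_one]
    rw [map_sub, h2, Complex.nonneg_iff] at h1
    simp only [Complex.sub_re, Complex.ofReal_re, Complex.sub_im, Complex.ofReal_im] at h1
    exact ⟨by linarith [h1.1], by linarith [h1.2]⟩
  have hre : (τ a).re = (τ (realPart a : A)).re := by
    conv_lhs => rw [← realPart_add_I_smul_imaginaryPart a]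
    rw [map_add, map_smul, Complex.add_re, smul_eq_mul, Complex.mul_re,
      (key _ (imaginaryPart a).2).2]
    simp
  have hn : ‖(realPart a : A)‖ ≤ ‖a‖ := realPart.norm_le a
  have hneg := (key _ (realPart a).2.neg).1
  rw [map_neg, norm_neg, Complex.neg_re] at hneg
  rw [hre, abs_le]
  exact ⟨by linarith, (key _ (realPart a).2).1.trans hn⟩

/-- The real subspace of the affine functions among the bounded continuous functions on `T_1(A)`.
(All continuous functions on `T_1(A)` are bounded, as `T_1(A)` is compact.) -/
def affineSubmodule : Submodule ℝ (tracialStates A →ᵇ ℝ) where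
  carrier := {f | ∀ τ σ ρ : tracialStates A, ∀ s : ℝ, 0 ≤ s → s ≤ 1 →
    (∀ a, ρ.1 a = (s : ℂ) * τ.1 a + ((1 - s : ℝ) : ℂ) * σ.1 a) →
      f ρ = s * f τ + (1 - s) * f σ}
  zero_mem' := by intro τ σ ρ s _ _ _; simp
  add_mem' {f g} hf hg := by
    intro τ σ ρ s h0 h1 h
    simp only [BoundedContinuousFunction.coe_add, Pi.add_apply, hf τ σ ρ s h0 h1 h,
      hg τ σ ρ s h0 h1 h]
    ring
  smul_mem' c f hf := by
    intro τ σ ρ s h0 h1 h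
    simp only [BoundedContinuousFunction.coe_smul, smul_eq_mul, hf τ σ ρ s h0 h1 h]
    ring

/-- The space `Aff T_1(A)` of real continuous affine functions on `T_1(A)`, with the supremum
norm. -/
def AffT : Type u := affineSubmodule A

instance : NormedAddCommGroup (AffT A) := inferInstanceAs (NormedAddCommGroup (affineSubmodule A))

instance : NormedSpace ℝ (AffT A) := inferInstanceAs (NormedSpace ℝ (affineSubmodule A))

variable {A} in
/-- The evaluation function `ev_a : τ ↦ Re τ(a)`; for self-adjoint `a` this is `τ ↦ τ(a)`. -/
def ev (a : A) : AffT A :=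
  ⟨BoundedContinuousFunction.ofNormedAddCommGroup (fun τ : tracialStates A => (τ.1 a).re)
    (Complex.continuous_re.comp ((WeakDual.eval_continuous a).comp continuous_subtype_val)) ‖a‖
    (fun τ => abs_re_tracialState_le τ a), by
    intro τ σ ρ s _ _ h
    simp [h]⟩

variable {A} in
/-- The (non-normalised) matrix trace `M_n(A) → A`. -/
def matTrace {n : ℕ} (a : Mat A n) : A := ∑ i, a i i

/-- The image of `K_0(A)` in `Aff T_1(A)` under `[p] ↦ ev_p`: the subgroup generated by the
functions `ev_p` for the projections `p ∈ M_n(A)`, `n ∈ ℕ`. -/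
def K0image : AddSubgroup (AffT A) :=
  AddSubgroup.closure {f | ∃ (n : ℕ) (p : Mat A n), IsStarProjection p ∧ f = ev (matTrace p)}

/-- `\overline{K_0(A)}`, the closure of the image of `K_0(A)` in `Aff T_1(A)`. -/
def K0bar : AddSubgroup (AffT A) := (K0image A).topologicalClosure

/-- The group `H(A) = Aff T_1(A) / \overline{K_0(A)}`, with the quotient norm
`‖[f]‖ = inf {‖f - p‖ : p ∈ \overline{K_0(A)}}`. -/
abbrev H : Type u := AffT A ⧸ K0bar A

instance : IsClosed (K0bar A : Set (AffT A)) := (K0image A).isClosed_topologicalClosure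

instance : NormedAddCommGroup (H A) := QuotientAddGroup.instNormedAddCommGroup (K0bar A)

variable {A} in
/-- The class of a function in `H(A)`. -/
def toH (f : AffT A) : H A := (f : AffT A ⧸ K0bar A)

/-! ### The de la Harpe-Skandalis determinant -/

/-- A smooth path `[0,1] → U(M_n(A))` starting at the identity. -/
structure SmoothPath (n : ℕ) where
  /-- the path, of which only the restriction to `[0,1]` matters -/
  toFun : ℝ → Mat A n
  contDiffOn : ContDiffOn ℝ ∞ toFun (Icc 0 1)
  mem_unitary : ∀ t ∈ Icc (0 : ℝ) 1, toFun t ∈ unitary (Mat A n)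
  map_zero : toFun 0 = 1

variable {A} in
/-- The endpoint `ξ(1) ∈ U^∞(A)`. -/
def SmoothPath.endpoint {n : ℕ} (ξ : SmoothPath A n) : UInf A :=
  UInf.of A n ⟨ξ.toFun 1, ξ.mem_unitary 1 (by simp)⟩

variable {A} in
/-- `\hat Δ(ξ) = (1 / 2πi) ∫₀¹ Tr(ξ'(t) ξ(t)⁻¹) dt`, as an element of `Aff T_1(A)`. -/
def SmoothPath.preDet {n : ℕ} (ξ : SmoothPath A n) : AffT A :=
  ev ((2 * (Real.pi : ℂ) * Complex.I)⁻¹ •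
    ∫ t in (0 : ℝ)..1, matTrace (derivWithin ξ.toFun (Icc 0 1) t * star (ξ.toFun t)))

open Classical in
variable {A} in
/-- The non-stable de la Harpe-Skandalis determinant `\overline{Δ} : U_0^∞(A) → H(A)`,
`x ↦ [\hat Δ(ξ)]` for any smooth path `ξ` from the identity to `x`, extended by `0` outside
`U_0^∞(A)`. -/
def detBar (x : UInf A) : H A :=
  if h : ∃ ξ : Σ n, SmoothPath A n, ξ.2.endpoint = x then toH h.choose.2.preDet else 0

/-! ### Nielsen-Thomsen bases -/

/-- A Nielsen-Thomsen basis `{c_k}` of `A`: a family of unitaries in `U^∞(A)` indexed by `K_1(A)`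
such that `k ↦ \overline{c_k}` is a group homomorphism `K_1(A) → \overline{K}_1(A)` which splits
the canonical map `\overline{K}_1(A) → K_1(A)`, and `c_0 = 1_A`. (The neutral element of `K_1(A)`
is written `1`.) -/
structure NTBasis where
  /-- the unitaries of the basis -/
  c : K1 A → UInf A
  toK1_c : ∀ k, toK1 (c k) = k
  toK1bar_mul : ∀ k l, toK1bar (c (k * l)) = toK1bar (c k) * toK1bar (c l)
  c_one : c 1 = 1

end Groups

/-! ### Maps induced by *-homomorphisms -/

section Functoriality

variable {A : Type u} [CStarAlgebra A] [PartialOrder A] [StarOrderedRing A]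
  {B : Type v} [CStarAlgebra B] [PartialOrder B] [StarOrderedRing B]

/-- The homomorphism `U(M_n(A)) → U(M_n(B))` induced by `φ`. -/
def Umap (φ : A →⋆ₙₐ[ℂ] B) (n : ℕ) : U A n →* U B n :=
  unitaryMap (CStarMatrix.mapₙₐ φ)

lemma continuous_Umap (φ : A →⋆ₙₐ[ℂ] B) (n : ℕ) : Continuous (Umap φ n) :=
  continuous_unitaryMap _ (map_continuous (CStarMatrix.mapₙₐ φ : Mat A n →⋆ₙₐ[ℂ] Mat B n))

lemma pad_Umap (φ : A →⋆ₙₐ[ℂ] B) (n m : ℕ) (h : n ≤ m) (x : U A n) :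
    pad B n m h (Umap φ n x) = Umap φ m (pad A n m h x) := by
  have : (corner h).comp (CStarMatrix.mapₙₐ φ : Mat A n →⋆ₙₐ[ℂ] Mat B n)
      = (CStarMatrix.mapₙₐ φ).comp (corner h) := by
    ext a i j
    rw [NonUnitalStarAlgHom.comp_apply, NonUnitalStarAlgHom.comp_apply, corner_apply]
    by_cases hij : i.1 < n ∧ j.1 < n <;> simp [hij, corner_apply]
  simp only [pad, Umap, unitaryMap_comp, this]

/-- The homomorphism `U^∞(A) → U^∞(B)` induced by `φ`, given by `x ↦ φ(x)` if `φ` is unital and by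
`x ↦ φ(x) + (1 - φ(1))` in general. -/
def UInfMap (φ : A →⋆ₙₐ[ℂ] B) : UInf A →* UInf B :=
  MonoidHom.mk' (DirectLimit.map (pad A) (pad B) (fun n => Umap φ n) (pad_Umap φ)) fun x y => by
    refine DirectLimit.induction₂ (pad A) (C := fun x y =>
      DirectLimit.map (pad A) (pad B) (fun n => Umap φ n) (pad_Umap φ) (x * y) =
        DirectLimit.map (pad A) (pad B) (fun n => Umap φ n) (pad_Umap φ) x *
        DirectLimit.map (pad A) (pad B) (fun n => Umap φ n) (pad_Umap φ) y) (fun n a b => ?_) x y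
    simp only [DirectLimit.mul_def, DirectLimit.map_def, map_mul]

lemma UInfMap_of (φ : A →⋆ₙₐ[ℂ] B) (n : ℕ) (x : U A n) :
    UInfMap φ (UInf.of A n x) = UInf.of B n (Umap φ n x) := rfl

lemma continuous_UInfMap (φ : A →⋆ₙₐ[ℂ] B) : Continuous (UInfMap φ) :=
  UInf.continuous_iff.2 fun n => (UInf.continuous_of B n).comp (continuous_Umap φ n)

/-- `\overline{K}_1(φ) : \overline{K}_1(A) → \overline{K}_1(B)`. -/
def K1barMap (φ : A →⋆ₙₐ[ℂ] B) : K1bar A →* K1bar B :=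
  QuotientGroup.map (DUbar A) (DUbar B) (UInfMap φ) fun x hx =>
    map_mem_closure (continuous_UInfMap φ) hx fun y hy => by
      have h1 : commutator (UInf A) ≤ (commutator (UInf B)).comap (UInfMap φ) := by
        rw [← Subgroup.map_le_iff_le_comap, commutator_def, Subgroup.map_commutator]
        exact Subgroup.commutator_mono le_top le_top
      exact h1 hy

/-- `K_1(φ) : K_1(A) → K_1(B)`. -/
def K1Map (φ : A →⋆ₙₐ[ℂ] B) : K1 A →* K1 B :=
  QuotientGroup.map (U0Inf A) (U0Inf B) (UInfMap φ) <|
    iSup_le fun n => Subgroup.map_le_iff_le_comap.2 fun _ hx =>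
      of_mem_U0Inf (mem_connectedComponentOfOne_of_continuous (Umap φ n) (continuous_Umap φ n) hx)

variable (A B) in
/-- The set of `\overline{K}_1`-morphisms, i.e. of the homomorphisms
`\overline{K}_1(φ) : \overline{K}_1(A) → \overline{K}_1(B)` induced by *-homomorphisms. -/
def K1barMor : Set (K1bar A →* K1bar B) := range K1barMap

/-- `\overline{K}_1(φ)`, as an element of the set of `\overline{K}_1`-morphisms. -/
def toMor (φ : A →⋆ₙₐ[ℂ] B) : K1barMor A B := ⟨K1barMap φ, mem_range_self φ⟩

/-! ### Rotation maps and the metrics -/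

/-- The rotation map `R_{CD}(φ) : K_1(A) → H(B)`,
`k ↦ \overline{Δ}(diag(φ(c_k), d_{K_1(φ)(k)}^*))`. -/
def rotation (C : NTBasis A) (D : NTBasis B) (φ : A →⋆ₙₐ[ℂ] B) (k : K1 A) : H B :=
  detBar (UInf.diag (UInfMap φ (C.c k)) (D.c (K1Map φ k))⁻¹)

/-- The relative rotation map `R_{CD}(φ, ψ) = R_{CD}(φ) - R_{CD}(ψ)`. -/
def relRotation (C : NTBasis A) (D : NTBasis B) (φ ψ : A →⋆ₙₐ[ℂ] B) (k : K1 A) : H B :=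
  rotation C D φ k - rotation C D ψ k

/-- `d_{R,CD}(φ, ψ) = sup_k ‖R_{CD}(φ, ψ)(k)‖`. -/
def distR (C : NTBasis A) (D : NTBasis B) (φ ψ : A →⋆ₙₐ[ℂ] B) : ℝ≥0∞ :=
  ⨆ k : K1 A, ‖relRotation C D φ ψ k‖ₑ

/-- `d(H(φ), H(ψ))`, the supremum over self-adjoint `h ∈ A` of the distance in `H(B)` between the
images `[ev_{φ(h)}]` and `[ev_{ψ(h)}]` of `[ev_h]` under `H(φ)` and `H(ψ)`. -/
def distH (φ ψ : A →⋆ₙₐ[ℂ] B) : ℝ≥0∞ :=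
  ⨆ h : selfAdjoint A, edist (toH (ev (φ (h : A)))) (toH (ev (ψ (h : A))))

open Classical in
/-- The trivial metric on `K_1`: `0` if `K_1(φ) = K_1(ψ)`, and `∞` otherwise. -/
def distTriv (φ ψ : A →⋆ₙₐ[ℂ] B) : ℝ≥0∞ := if K1Map φ = K1Map ψ then 0 else ⊤

/-- `𝔡_{CD}(\overline{K}_1(φ), \overline{K}_1(ψ))`. -/
def distNT (C : NTBasis A) (D : NTBasis B) (φ ψ : A →⋆ₙₐ[ℂ] B) : ℝ≥0∞ :=
  distH φ ψ + distR C D φ ψ + distTriv φ ψ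

end Functoriality

end NielsenThomsen

end

noncomputable section

set_option linter.unusedSectionVars false

namespace NielsenThomsen

universe u v

/-! ### Tracial functionals and sums of commutators -/

section CuntzPedersen

variable {A : Type*} [CStarAlgebra A]

/-! The inequality is short once the determinant is understood. If `φ` and `ψ` agree on K_1, the
unitaries d cancel from the difference of the two rotation maps, leaving the determinant of φ(c_k)
ψ(c_k)⁻¹ (`relRotation_eq`). Two bases of `A` differ at k by some w in U_0^∞(A). Replacing c by wc
changes this determinant by [ev_{φ(h)}] - [ev_{ψ(h)}], where h is self-adjoint and depends only on w
(`exists_detBar_mul_inv_eq`). The rotation term therefore grows by at most the H-term; as the H-term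
also occurs by itself, the constant is 2. If the K_1-maps differ, both sides are infinite.

Three facts about the determinant support this and the metric statement.

It is well defined (`detBar_endpoint`). A loop of unitaries must have its logarithmic integral in
the image of K_0, which is the surjectivity half of Bott periodicity seen by traces
(`exists_projection_winding`). The loop is approximated by a Laurent polynomial, a power of z clears
denominators, and a companion-matrix trick makes the polynomial loop linear. A linear loop has as
winding number the trace of its Riesz idempotent, which is replaced by a projection with the same
traces.

It vanishes on the closed commutator subgroup (`DUbar_le_detKer`), so the distance depends only on
the maps induced on \overline{K}_1. Commutators are handled with permutation matrices, the closure
with a local logarithm.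

Conversely, a unitary of U_0^∞ with zero determinant lies in that closure (`detKer_le_DUbar`), so
distance zero forces equality on \overline{K}_1. Modulo closed commutators the Lie-Trotter formula
makes exponentials additive, so every class from U_0^∞ is that of one exp(ih), and it depends only
on the matrix trace of h. If the determinant vanishes, this trace is, after division by 2π, close on
all tracial states to combinations of projections, for which exp(2πip) = 1. The rest is close to a
sum of commutators by the Cuntz-Pedersen type theorem `exists_mem_commutatorSpan_norm_sub_lt`, a
Hahn-Banach argument with a tracial Jordan decomposition. -/

lemma map_mul_comm_of_unitary_invariant (T : A →ₗ[ℂ] ℂ)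
    (h : ∀ w : unitary A, ∀ a, T (w * a * star (w : A)) = T a) (a b : A) :
    T (a * b) = T (b * a) := by
  -- The unitaries span the algebra. For `a` = x unitary, invariance applied to bx reads T(xb) =
  -- T(bx).
  have ha : a ∈ Submodule.span ℂ (unitary A : Set A) := by
    rw [CStarAlgebra.span_unitary]; trivial
  induction ha using Submodule.span_induction with
  | mem x hx =>
    have := h ⟨x, hx⟩ (b * x)
    rw [← this]
    simp only [mul_assoc, (Unitary.mem_iff.1 hx).2, mul_one]
  | zero => simp
  | add x y _ _ hx hy => simp [add_mul, mul_add, hx, hy]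
  | smul c x _ hx => simp [hx]

variable [PartialOrder A] [StarOrderedRing A]

lemma re_map_le_of_positive {T : A →L[ℂ] ℂ} (hpos : ∀ a : A, 0 ≤ a → 0 ≤ T a) {a : A}
    (ha : IsSelfAdjoint a) : |(T a).re| ≤ ‖a‖ * (T 1).re := by
  have h1 := hpos _ (sub_nonneg.2 (IsSelfAdjoint.le_algebraMap_norm_self ha))
  have h2 := hpos _ (sub_nonneg.2 (IsSelfAdjoint.neg_algebraMap_norm_le_self ha))
  have h3 : T (algebraMap ℝ A ‖a‖) = (‖a‖ : ℂ) * T 1 := by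
    rw [Algebra.algebraMap_eq_smul_one, ← Complex.coe_smul, map_smul, smul_eq_mul]
  simp only [map_sub, map_neg, h3, Complex.nonneg_iff, Complex.sub_re, Complex.neg_re,
    Complex.re_ofReal_mul] at h1 h2
  rw [abs_le]
  constructor <;> linarith [h1.1, h2.1]

/-- Either T 1 = 0 and T vanishes by positivity, or T / T 1 is a tracial state. -/
lemma re_map_le_of_tracialStates {T : A →L[ℂ] ℂ} (hpos : ∀ a : A, 0 ≤ a → 0 ≤ T a)
    (htr : ∀ a b, T (a * b) = T (b * a)) {h : A} (hh : IsSelfAdjoint h) {c : ℝ}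
    (hc : ∀ τ ∈ tracialStates A, |(τ h).re| ≤ c) : |(T h).re| ≤ c * (T 1).re := by
  have h1 := hpos 1 zero_le_one
  rw [Complex.nonneg_iff] at h1
  rcases h1.1.eq_or_lt with h0 | h0
  · have := re_map_le_of_positive hpos hh
    rw [← h0] at this ⊢
    simpa using this
  · have hT1 : T 1 = ((T 1).re : ℂ) := Complex.ext rfl h1.2.symm
    have hmem : StrongDual.toWeakDual (((T 1).re⁻¹ : ℂ) • T) ∈ tracialStates A := by
      refine ⟨fun a => ?_, ?_, fun a b => ?_⟩
      · have h2 := hpos _ (star_mul_self_nonneg a)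
        have h3 : (0 : ℂ) ≤ ((T 1).re⁻¹ : ℂ) := by
          rw [← Complex.ofReal_inv]
          exact_mod_cast inv_nonneg.2 h0.le
        exact mul_nonneg h3 h2
      · change ((T 1).re⁻¹ : ℂ) * T 1 = 1
        rw [hT1]
        simp only [Complex.ofReal_re]
        rw [inv_mul_cancel₀]
        exact_mod_cast h0.ne'
      · change ((T 1).re⁻¹ : ℂ) * T _ = ((T 1).re⁻¹ : ℂ) * T _
        rw [htr]
    have h4 := hc _ hmem
    change |(((T 1).re⁻¹ : ℂ) * T h).re| ≤ c at h4
    rw [← Complex.ofReal_inv, Complex.re_ofReal_mul, abs_mul, abs_inv, abs_of_pos h0,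
      inv_mul_le_iff₀ h0] at h4
    linarith

/-- An additive, positively homogeneous, unitarily invariant function on the positive cone of a
C*-algebra extends to a positive tracial functional. -/
lemma exists_tracial_extension (P : A → ℝ) (hP0 : ∀ a, 0 ≤ a → 0 ≤ P a)
    (hadd : ∀ a b, 0 ≤ a → 0 ≤ b → P (a + b) = P a + P b)
    (hsmul : ∀ (r : ℝ) a, 0 ≤ r → 0 ≤ a → P (r • a) = r * P a)
    (hinv : ∀ (w : unitary A) a, 0 ≤ a → P (w * a * star (w : A)) = P a) :
    ∃ T : A →L[ℂ] ℂ, (∀ a, 0 ≤ a → T a = (P a : ℂ)) ∧ ∀ a b, T (a * b) = T (b * a) := by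
  set F : A → ℝ := fun a => P ((realPart a : A)⁺) - P ((realPart a : A)⁻) with hF
  -- `F` does not depend on the way the real part is written as a difference of positive elements.
  -- This gives additivity, homogeneity and invariance, since sums, multiples and conjugates of such
  -- decompositions are again decompositions.
  have key : ∀ a b c : A, 0 ≤ b → 0 ≤ c → (realPart a : A) = b - c → F a = P b - P c := by
    intro a b c hb hc h
    have h1 := CFC.posPart_sub_negPart (realPart a : A) (realPart a).2
    rw [h] at h1
    have h2 : (b - c)⁺ + c = b + (b - c)⁻ := by
      have := sub_eq_iff_eq_add.1 h1
      rw [this]; abel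
    have h3 := congrArg P h2
    rw [hadd _ _ (CFC.posPart_nonneg _) hc, hadd _ _ hb (CFC.negPart_nonneg _)] at h3
    simp only [hF, h]
    linarith
  have hdec := fun a : A => (CFC.posPart_sub_negPart (realPart a : A) (realPart a).2).symm
  let FL : A →ₗ[ℝ] ℝ :=
    { toFun := F
      map_add' := fun a b => by
        rw [key (a + b) ((realPart a : A)⁺ + (realPart b : A)⁺)
          ((realPart a : A)⁻ + (realPart b : A)⁻)
          (add_nonneg (CFC.posPart_nonneg _) (CFC.posPart_nonneg _))
          (add_nonneg (CFC.negPart_nonneg _) (CFC.negPart_nonneg _)),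
          hadd _ _ (CFC.posPart_nonneg _) (CFC.posPart_nonneg _),
          hadd _ _ (CFC.negPart_nonneg _) (CFC.negPart_nonneg _)]
        · simp only [hF]; ring
        · rw [map_add, add_sub_add_comm, ← hdec a, ← hdec b]; rfl
      map_smul' := fun r a => by
        rw [RingHom.id_apply, smul_eq_mul]
        rcases le_total 0 r with hr | hr
        · rw [key (r • a) (r • (realPart a : A)⁺) (r • (realPart a : A)⁻)
            (smul_nonneg hr (CFC.posPart_nonneg _)) (smul_nonneg hr (CFC.negPart_nonneg _)),
            hsmul _ _ hr (CFC.posPart_nonneg _), hsmul _ _ hr (CFC.negPart_nonneg _)]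
          · simp only [hF]; ring
          · rw [map_smul, ← smul_sub, ← hdec a]; rfl
        · have hr' : 0 ≤ -r := by linarith
          rw [key (r • a) ((-r) • (realPart a : A)⁻) ((-r) • (realPart a : A)⁺)
            (smul_nonneg hr' (CFC.negPart_nonneg _)) (smul_nonneg hr' (CFC.posPart_nonneg _)),
            hsmul _ _ hr' (CFC.negPart_nonneg _), hsmul _ _ hr' (CFC.posPart_nonneg _)]
          · simp only [hF]; ring
          · rw [map_smul, ← smul_sub, neg_smul, ← smul_neg, neg_sub, ← hdec a]; rfl }
  have hFL : ∀ a, FL a = F a := fun _ => rfl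
  have hFpos : ∀ a, 0 ≤ a → F a = P a := fun a ha => by
    have h0 : P 0 = 0 := by simpa using hsmul 0 0 le_rfl le_rfl
    rw [key a a 0 ha le_rfl, h0, sub_zero]
    rw [(IsSelfAdjoint.of_nonneg ha).coe_realPart, sub_zero]
  have hFre : ∀ a, F a = F (realPart a : A) := fun a => by
    simp only [hF, (realPart a).2.coe_realPart]
  have hFsa : ∀ a : A, IsSelfAdjoint a → |F a| ≤ P 1 * ‖a‖ := fun a ha => by
    have h1 := sub_nonneg.2 (IsSelfAdjoint.le_algebraMap_norm_self ha)
    have h2 := sub_nonneg.2 (IsSelfAdjoint.neg_algebraMap_norm_le_self ha)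
    have h3 := hP0 _ h1
    have h4 := hP0 _ h2
    have h5 : FL (algebraMap ℝ A ‖a‖) = ‖a‖ * P 1 := by
      rw [Algebra.algebraMap_eq_smul_one, map_smul, hFL, hFpos 1 zero_le_one, smul_eq_mul]
    rw [← hFpos _ h1, ← hFL, map_sub, h5, hFL] at h3
    rw [← hFpos _ h2, ← hFL, map_sub, map_neg, h5, hFL] at h4
    rw [abs_le]
    constructor <;> linarith
  have hbound : ∀ a, ‖FL a‖ ≤ P 1 * ‖a‖ := fun a => by
    rw [hFL, hFre, Real.norm_eq_abs]
    exact (hFsa _ (realPart a).2).trans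
      (mul_le_mul_of_nonneg_left (realPart.norm_le a) (hP0 1 zero_le_one))
  let FC : StrongDual ℝ A := FL.mkContinuous (P 1) hbound
  -- `F` sees only the real part, so its complexification a ↦ F(a) - i F(ia) agrees with `P` on
  -- positive elements, where F(ia) = 0.
  have hT : ∀ a, (FC.extendRCLike : StrongDual ℂ A) a
      = (F a : ℂ) - Complex.I * (F (Complex.I • a) : ℂ) := fun a => rfl
  have hFinv : ∀ (w : unitary A) a, F (w * a * star (w : A)) = F a := fun w a => by
    have hconj : ∀ b : A, 0 ≤ b → 0 ≤ w * b * star (w : A) := fun b hb =>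
      star_right_conjugate_nonneg hb _
    rw [key (w * a * star (w : A)) (w * (realPart a : A)⁺ * star (w : A))
      (w * (realPart a : A)⁻ * star (w : A)) (hconj _ (CFC.posPart_nonneg _))
      (hconj _ (CFC.negPart_nonneg _)), hinv _ _ (CFC.posPart_nonneg _),
      hinv _ _ (CFC.negPart_nonneg _)]
    rw [← sub_mul, ← mul_sub, ← hdec a]
    simp only [realPart_apply_coe, star_mul, star_star, mul_smul_comm, smul_mul_assoc, mul_add,
      add_mul, mul_assoc]
  refine ⟨FC.extendRCLike, fun a ha => ?_, map_mul_comm_of_unitary_invariant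
    (FC.extendRCLike : StrongDual ℂ A).toLinearMap fun w a => ?_⟩
  · have h0 : F (Complex.I • a) = 0 := by
      rw [hFre, realPart_I_smul, (IsSelfAdjoint.of_nonneg ha).imaginaryPart]
      simp [hF]
    rw [hT, h0, hFpos a ha]
    simp
  · change (FC.extendRCLike : StrongDual ℂ A) _ = (FC.extendRCLike : StrongDual ℂ A) _
    rw [hT, hT, hFinv, ← smul_mul_assoc, ← mul_smul_comm, hFinv]

/-- The supremum of `Re T` over the order interval `[0, a]`. -/
def upperVariation (T : A →L[ℂ] ℂ) (a : A) : ℝ := sSup ((fun b => (T b).re) '' Icc 0 a)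

lemma bddAbove_re_image_Icc (T : A →L[ℂ] ℂ) (a : A) :
    BddAbove ((fun b => (T b).re) '' Icc 0 a) := by
  refine ⟨‖T‖ * ‖a‖, ?_⟩
  rintro _ ⟨b, hb, rfl⟩
  exact (Complex.re_le_norm _).trans ((T.le_opNorm b).trans
    (mul_le_mul_of_nonneg_left (CStarAlgebra.norm_le_norm_of_nonneg_of_le hb.1 hb.2)
      (norm_nonneg _)))

lemma re_le_upperVariation (T : A →L[ℂ] ℂ) {a b : A} (hb : 0 ≤ b) (hba : b ≤ a) :
    (T b).re ≤ upperVariation T a :=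
  le_csSup (bddAbove_re_image_Icc T a) ⟨b, ⟨hb, hba⟩, rfl⟩

lemma upperVariation_le (T : A →L[ℂ] ℂ) {a : A} (ha : 0 ≤ a) {c : ℝ}
    (h : ∀ b, 0 ≤ b → b ≤ a → (T b).re ≤ c) : upperVariation T a ≤ c := by
  refine csSup_le ⟨_, 0, ⟨le_rfl, ha⟩, rfl⟩ ?_
  rintro _ ⟨b, hb, rfl⟩
  exact h b hb.1 hb.2

/-- An approximate Riesz decomposition: if `0 ≤ b ≤ a₁ + a₂`, then up to commutators and up to
`ε` the element `b` is a sum `b₁ + b₂` with `0 ≤ bᵢ ≤ aᵢ`. -/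
lemma exists_riesz_decomposition {a₁ a₂ b : A} (h₁ : 0 ≤ a₁) (h₂ : 0 ≤ a₂) (hb : 0 ≤ b)
    (hle : b ≤ a₁ + a₂) {δ : ℝ} (hδ : 0 < δ) :
    ∃ x₁ x₂ : A, x₁ * star x₁ ≤ a₁ ∧ x₂ * star x₂ ≤ a₂ ∧
      ‖b - (star x₁ * x₁ + star x₂ * x₂)‖ ≤ δ := by
  -- The shift by `δ` makes `s` invertible. With t = s^(-1/2), r = b^(1/2) and xᵢ = aᵢ^(1/2) t r,
  -- the bound t b t ≤ t s t = 1 gives xᵢ xᵢ* ≤ aᵢ. The elements xᵢ* xᵢ add up to r t (s - δ) t r =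
  -- b - δ r t² r, and r t² r has the same norm as t b t.
  set s : A := a₁ + a₂ + algebraMap ℝ A δ with hs
  have hδA : IsStrictlyPositive (algebraMap ℝ A δ) := by
    rw [Algebra.algebraMap_eq_smul_one]
    exact IsStrictlyPositive.smul hδ isStrictlyPositive_one
  have hspos : IsStrictlyPositive s := IsStrictlyPositive.nonneg_add (add_nonneg h₁ h₂) hδA
  have hbs : b ≤ s := hle.trans (le_add_of_nonneg_right hδA.nonneg)
  set t : A := s ^ (-(1 / 2) : ℝ) with ht
  have ht0 : 0 ≤ t := CFC.rpow_nonneg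
  have htsa : star t = t := (IsSelfAdjoint.of_nonneg ht0).star_eq
  have htst : t * s * t = 1 := CFC.conjugate_rpow_neg_one_half s hspos
  have hst : s * t * t = 1 := by
    have hu : IsUnit t := hspos.isUnit.cfcRpow _ hspos.nonneg
    have h3 : t * (s * t * t) = t * 1 := by
      calc t * (s * t * t) = (t * s * t) * t := by simp only [mul_assoc]
        _ = t * 1 := by rw [htst]; simp
    exact hu.mul_left_cancel h3
  have hts : t * t * s = 1 := by
    have := congrArg star hst
    simpa [htsa, (IsSelfAdjoint.of_nonneg hspos.nonneg).star_eq, mul_assoc] using this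
  set r := CFC.sqrt b with hr
  have hrsa : star r = r := (IsSelfAdjoint.of_nonneg (CFC.sqrt_nonneg b)).star_eq
  have hrr : r * r = b := CFC.sqrt_mul_sqrt_self b hb
  have htbt : t * b * t ≤ 1 := by
    rw [← htst]
    have := star_left_conjugate_le_conjugate hbs t
    rwa [htsa] at this
  have hx : ∀ a : A, 0 ≤ a → (CFC.sqrt a * t * r) * star (CFC.sqrt a * t * r) ≤ a ∧
      star (CFC.sqrt a * t * r) * (CFC.sqrt a * t * r) = r * t * a * t * r := fun a ha => by
    have hasa : star (CFC.sqrt a) = CFC.sqrt a :=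
      (IsSelfAdjoint.of_nonneg (CFC.sqrt_nonneg a)).star_eq
    constructor
    · have := star_right_conjugate_le_conjugate htbt (CFC.sqrt a)
      rw [hasa, mul_one, CFC.sqrt_mul_sqrt_self a ha] at this
      refine le_of_eq_of_le ?_ this
      simp only [star_mul, hasa, htsa, hrsa, ← hrr, mul_assoc]
    · simp only [star_mul, hasa, htsa, hrsa]
      nth_rw 3 [← CFC.sqrt_mul_sqrt_self a ha]
      simp only [mul_assoc]
  refine ⟨CFC.sqrt a₁ * t * r, CFC.sqrt a₂ * t * r, (hx _ h₁).1, (hx _ h₂).1, ?_⟩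
  rw [(hx _ h₁).2, (hx _ h₂).2]
  have h4 : b - (r * t * a₁ * t * r + r * t * a₂ * t * r) = δ • (star (t * r) * (t * r)) := by
    have h5 : r * t * s * t * r = b := by
      rw [← hrr, mul_assoc r t s, mul_assoc r (t * s) t, htst, mul_one]
    nth_rw 1 [← h5]
    rw [hs]
    simp only [mul_add, add_mul, Algebra.algebraMap_eq_smul_one, mul_smul_comm, smul_mul_assoc,
      mul_one, star_mul, htsa, hrsa, mul_assoc]
    abel
  rw [h4, norm_smul, Real.norm_of_nonneg hδ.le, CStarRing.norm_star_mul_self,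
    ← CStarRing.norm_self_mul_star]
  have h6 : t * r * star (t * r) = t * b * t := by
    simp only [star_mul, htsa, hrsa, ← hrr, mul_assoc]
  rw [h6]
  have h7 : ‖t * b * t‖ ≤ 1 := by
    rw [CStarAlgebra.norm_le_one_iff_of_nonneg _ ?_]
    · exact htbt
    · have := star_left_conjugate_nonneg hb t
      rwa [htsa] at this
  nlinarith

/-- Superadditivity is immediate. For the other inequality, traciality replaces the xᵢ* xᵢ of the
Riesz decomposition by xᵢ xᵢ*, which lie below aᵢ. -/
lemma upperVariation_add {T : A →L[ℂ] ℂ} (htr : ∀ a b, T (a * b) = T (b * a)) {a₁ a₂ : A}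
    (h₁ : 0 ≤ a₁) (h₂ : 0 ≤ a₂) :
    upperVariation T (a₁ + a₂) = upperVariation T a₁ + upperVariation T a₂ := by
  apply le_antisymm
  · refine upperVariation_le T (add_nonneg h₁ h₂) fun b hb hle => ?_
    refine le_of_forall_pos_le_add fun ε hε => ?_
    obtain ⟨x₁, x₂, hx₁, hx₂, hn⟩ := exists_riesz_decomposition h₁ h₂ hb hle
      (δ := ε / (‖T‖ + 1)) (by positivity)
    have e1 : (T (star x₁ * x₁)).re ≤ upperVariation T a₁ := by
      rw [htr]; exact re_le_upperVariation T (mul_star_self_nonneg _) hx₁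
    have e2 : (T (star x₂ * x₂)).re ≤ upperVariation T a₂ := by
      rw [htr]; exact re_le_upperVariation T (mul_star_self_nonneg _) hx₂
    have e3 : (T (b - (star x₁ * x₁ + star x₂ * x₂))).re ≤ ε := by
      refine (Complex.re_le_norm _).trans ((T.le_opNorm _).trans ?_)
      calc ‖T‖ * ‖b - (star x₁ * x₁ + star x₂ * x₂)‖ ≤ (‖T‖ + 1) * (ε / (‖T‖ + 1)) := by
            gcongr; linarith
        _ = ε := by field_simp
    rw [map_sub, map_add, Complex.sub_re, Complex.add_re] at e3
    linarith
  · rw [← le_sub_iff_add_le]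
    refine upperVariation_le T h₁ fun b hb hle => ?_
    rw [le_sub_iff_add_le, add_comm, ← le_sub_iff_add_le]
    refine upperVariation_le T h₂ fun b' hb' hle' => ?_
    rw [le_sub_iff_add_le]
    have := re_le_upperVariation T (add_nonneg hb' hb)
      (show b' + b ≤ a₁ + a₂ by rw [add_comm b']; exact add_le_add hle hle')
    simpa using this

lemma norm_le_one_of_mem_Icc {a : A} (h₁ : -1 ≤ a) (h₂ : a ≤ 1) : ‖a‖ ≤ 1 := by
  nontriviality A
  have ha : IsSelfAdjoint a := by
    have := IsSelfAdjoint.of_nonneg (sub_nonneg.2 h₂)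
    simpa using (IsSelfAdjoint.one A).sub this
  rcases CStarAlgebra.norm_or_neg_norm_mem_spectrum ha with h | h
  · exact (le_algebraMap_iff_spectrum_le (r := (1 : ℝ)) ha).1 (by simpa using h₂) _ h
  · have := (algebraMap_le_iff_le_spectrum (r := (-1 : ℝ)) ha).1 (by simpa using h₁) _ h
    linarith

/-- The Jordan decomposition of a tracial functional. -/
lemma exists_tracial_jordan_decomposition {T : A →L[ℂ] ℂ} (htr : ∀ a b, T (a * b) = T (b * a))
    (hre : ∀ a, 0 ≤ a → T a = ((T a).re : ℂ)) :
    ∃ T₁ T₂ : A →L[ℂ] ℂ, (∀ a, 0 ≤ a → 0 ≤ T₁ a) ∧ (∀ a, 0 ≤ a → 0 ≤ T₂ a) ∧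
      (∀ a b, T₁ (a * b) = T₁ (b * a)) ∧ (∀ a b, T₂ (a * b) = T₂ (b * a)) ∧ T = T₁ - T₂ ∧
      (T₁ 1).re + (T₂ 1).re ≤ ‖T‖ := by
  have hsm : ∀ (r : ℝ) a, 0 < r → 0 ≤ a → upperVariation T (r • a) ≤ r * upperVariation T a :=
    fun r a hr ha => upperVariation_le T (smul_nonneg hr.le ha) fun b hb hle => by
      have h1 : r⁻¹ • b ≤ a := by
        have := smul_le_smul_of_nonneg_left hle (inv_nonneg.2 hr.le)
        rwa [smul_smul, inv_mul_cancel₀ hr.ne', one_smul] at this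
      have h2 := re_le_upperVariation T (smul_nonneg (inv_nonneg.2 hr.le) hb) h1
      rw [← Complex.coe_smul, map_smul, smul_eq_mul, Complex.re_ofReal_mul,
        inv_mul_le_iff₀ hr] at h2
      exact h2
  have hcj : ∀ (w : unitary A) a, 0 ≤ a →
      upperVariation T (w * a * star (w : A)) ≤ upperVariation T a := fun w a ha =>
    upperVariation_le T (star_right_conjugate_nonneg ha _) fun b hb hle => by
      have h1 := star_left_conjugate_le_conjugate hle (w : A)
      have e1 : star (w : A) * (w * a * star (w : A)) * w = a := by
        have := (Unitary.mem_iff.1 w.2).1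
        rw [mul_assoc, mul_assoc, mul_assoc, this, ← mul_assoc, ← mul_assoc, this]; simp
      rw [e1] at h1
      have h2 := re_le_upperVariation T (star_left_conjugate_nonneg hb (w : A)) h1
      rwa [htr, ← mul_assoc, (Unitary.mem_iff.1 w.2).2, one_mul] at h2
  -- `hsm` and `hcj` are one-sided; the reverse inequalities come from applying them to the inverse
  -- scalar and the adjoint unitary. The second functional will be T₁ - T, positive because b = a is
  -- allowed in the supremum.
  obtain ⟨T₁, hT₁, htr₁⟩ := exists_tracial_extension (upperVariation T)
    (fun a ha => by simpa using re_le_upperVariation T le_rfl ha)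
    (fun a b ha hb => upperVariation_add htr ha hb)
    (fun r a hr ha => by
      rcases hr.eq_or_lt with rfl | hr
      · rw [zero_smul, zero_mul]
        refine le_antisymm (upperVariation_le T le_rfl fun b hb hle => ?_)
          (by simpa using re_le_upperVariation T (le_refl (0 : A)) le_rfl)
        rw [le_antisymm hle hb]; simp
      · refine le_antisymm (hsm r a hr ha) ?_
        have := hsm r⁻¹ (r • a) (inv_pos.2 hr) (smul_nonneg hr.le ha)
        rw [smul_smul, inv_mul_cancel₀ hr.ne', one_smul] at this
        rwa [← le_inv_mul_iff₀ hr])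
    (fun w a ha => by
      refine le_antisymm (hcj w a ha) ?_
      have := hcj (star w) (w * a * star (w : A)) (star_right_conjugate_nonneg ha _)
      have e1 : (star w : unitary A) * (w * a * star (w : A)) * star ((star w : unitary A) : A)
          = a := by
        have := (Unitary.mem_iff.1 w.2).1
        rw [Unitary.coe_star, star_star, mul_assoc, mul_assoc, mul_assoc, this, ← mul_assoc,
          ← mul_assoc, this]; simp
      rwa [e1] at this)
  refine ⟨T₁, T₁ - T, fun a ha => ?_, fun a ha => ?_, htr₁, fun a b => ?_, by simp, ?_⟩
  · rw [hT₁ a ha]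
    have := re_le_upperVariation T (le_refl (0 : A)) ha
    exact_mod_cast (by simpa using this)
  · rw [_root_.sub_apply, hT₁ a ha, hre a ha, ← Complex.ofReal_sub]
    exact_mod_cast sub_nonneg.2 (re_le_upperVariation T ha le_rfl)
  · simp only [_root_.sub_apply, htr₁ a b, htr a b]
  · have h1 := hT₁ 1 zero_le_one
    rw [_root_.sub_apply, h1, Complex.sub_re, Complex.ofReal_re]
    -- Here T₁ 1 + T₂ 1 has real part 2 T₁(1) - Re T(1), the supremum of Re T(2b - 1) over 0 ≤ b ≤
    -- 1, and each 2b - 1 is a contraction.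
    have h2 : upperVariation T 1 ≤ (‖T‖ + (T 1).re) / 2 := by
      refine upperVariation_le T zero_le_one fun b hb hle => ?_
      have h3 : ‖2 • b - 1‖ ≤ 1 := by
        refine norm_le_one_of_mem_Icc ?_ ?_
        · rw [neg_le_sub_iff_le_add]
          exact le_add_of_nonneg_left (nsmul_nonneg hb 2)
        · rw [sub_le_iff_le_add, ← two_nsmul]
          exact nsmul_le_nsmul_right hle 2
      have h5 : (T (2 • b - 1)).re ≤ ‖T‖ :=
        (Complex.re_le_norm _).trans ((T.le_opNorm _).trans
          (mul_le_of_le_one_right (norm_nonneg _) h3))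
      rw [map_sub, map_nsmul, Complex.sub_re, nsmul_eq_mul] at h5
      simp at h5
      linarith
    linarith

/-- The span of the elements `a - w a w*` with `w` unitary. -/
def commutatorSpan (A : Type*) [CStarAlgebra A] : Submodule ℂ A :=
  Submodule.span ℂ {x | ∃ (a : A) (w : unitary A), x = a - w * a * star (w : A)}

/-- A self-adjoint element on which all tracial states are small is close to the span of
commutators. -/
theorem exists_mem_commutatorSpan_norm_sub_lt {h : A} (hh : IsSelfAdjoint h) {c : ℝ} (hc0 : 0 ≤ c)
    (hc : ∀ τ ∈ tracialStates A, |(τ h).re| ≤ c) {ε : ℝ} (hε : 0 < ε) :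
    ∃ b ∈ commutatorSpan A, ‖h - b‖ < c + ε := by
  let S := (commutatorSpan A).topologicalClosure
  have : IsClosed (S : Set A) := (commutatorSpan A).isClosed_topologicalClosure
  -- It is enough to bound the quotient norm of h modulo the closed span. A norming functional of
  -- this class is unitarily invariant, hence tracial.
  suffices hle : ‖(S.mkQ h : A ⧸ S)‖ ≤ c by
    obtain ⟨m, hm, hmlt⟩ := (QuotientAddGroup.norm_lt_iff (S := S.toAddSubgroup)
      (x := (S.mkQ h : A ⧸ S))).1 (hle.trans_lt (lt_add_of_pos_right c (half_pos hε)))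
    have h1 : h - m ∈ S := by
      have : S.mkQ m = S.mkQ h := hm
      rwa [← Submodule.ker_mkQ S, LinearMap.mem_ker, map_sub, sub_eq_zero, eq_comm]
    obtain ⟨b, hb, hbd⟩ := Metric.mem_closure_iff.1 h1 (ε / 2) (half_pos hε)
    refine ⟨b, hb, ?_⟩
    calc ‖h - b‖ = ‖m + (h - m - b)‖ := by congr 1; abel
      _ ≤ ‖m‖ + ‖h - m - b‖ := norm_add_le _ _
      _ < (c + ε / 2) + ε / 2 := by rw [dist_eq_norm] at hbd; gcongr
      _ = c + ε := by ring
  obtain ⟨g, hg1, hg2⟩ := exists_dual_vector'' ℂ (S.mkQ h : A ⧸ S)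
  let G : A →L[ℂ] ℂ := g.comp S.mkQL
  have hGn : ‖G‖ ≤ 1 := by
    refine G.opNorm_le_bound zero_le_one fun a => ?_
    refine (g.le_opNorm _).trans ?_
    exact mul_le_mul hg1 (Submodule.Quotient.norm_mk_le S a) (norm_nonneg _) zero_le_one
  have hGinv : ∀ (w : unitary A) a, G (w * a * star (w : A)) = G a := fun w a => by
    have h1 : S.mkQ (a - w * a * star (w : A)) = 0 := by
      rw [Submodule.mkQ_apply, Submodule.Quotient.mk_eq_zero]
      exact subset_closure (Submodule.subset_span ⟨a, w, rfl⟩)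
    rw [map_sub, sub_eq_zero] at h1
    exact congrArg g h1.symm
  -- The norming functional need not be real on self-adjoint elements. Its hermitian part keeps the
  -- norm bound, the invariance and the value at h, and has a Jordan decomposition.
  let f : StrongDual ℝ A := Complex.reCLM.comp ((G.restrictScalars ℝ).comp
    ((2 : ℝ)⁻¹ • (ContinuousLinearMap.id ℝ A + (starL' ℝ : A ≃L[ℝ] A).toContinuousLinearMap)))
  have hf : ∀ a, f a = (G ((2 : ℝ)⁻¹ • (a + star a))).re := fun a => rfl
  have hfn : ∀ a, ‖f a‖ ≤ 1 * ‖a‖ := fun a => by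
    rw [hf]
    refine (Complex.abs_re_le_norm _).trans ((G.le_opNorm _).trans ?_)
    refine mul_le_mul hGn ?_ (norm_nonneg _) zero_le_one
    rw [norm_smul]
    have := norm_add_le a (star a)
    rw [norm_star] at this
    norm_num
    linarith
  let T : A →L[ℂ] ℂ := (f.extendRCLike : StrongDual ℂ A)
  have hT : ∀ a, T a = (f a : ℂ) - Complex.I * (f (Complex.I • a) : ℂ) := fun a => rfl
  have hTn : ‖T‖ ≤ 1 := by
    rw [StrongDual.norm_extendRCLike]
    exact f.opNorm_le_bound zero_le_one hfn
  have hfinv : ∀ (w : unitary A) a, f (w * a * star (w : A)) = f a := fun w a => by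
    rw [hf, hf, ← hGinv w ((2 : ℝ)⁻¹ • (a + star a))]
    simp only [star_mul, star_star, mul_smul_comm, smul_mul_assoc, mul_add, add_mul, mul_assoc]
  have htr := map_mul_comm_of_unitary_invariant T.toLinearMap fun w a => by
    change T _ = T _
    rw [hT, hT, hfinv, ← smul_mul_assoc, ← mul_smul_comm, hfinv]
  have hfI : ∀ a, IsSelfAdjoint a → f (Complex.I • a) = 0 := fun a ha => by
    rw [hf, star_smul, ha.star_eq]
    simp
  have hTre : ∀ a, IsSelfAdjoint a → T a = (f a : ℂ) := fun a ha => by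
    rw [hT, hfI a ha]; simp
  obtain ⟨T₁, T₂, hp₁, hp₂, ht₁, ht₂, hsub, hle⟩ := exists_tracial_jordan_decomposition htr
    fun a ha => by rw [hTre a (IsSelfAdjoint.of_nonneg ha), Complex.ofReal_re]
  have hfh : f h = ‖(S.mkQ h : A ⧸ S)‖ := by
    rw [hf, hh.star_eq, ← two_smul ℝ h, smul_smul, inv_mul_cancel₀ two_ne_zero, one_smul]
    change (g (S.mkQ h)).re = _
    rw [hg2]
    simp
  have h1 := re_map_le_of_tracialStates hp₁ ht₁ hh hc
  have h2 := re_map_le_of_tracialStates hp₂ ht₂ hh hc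
  have h3 : f h = (T₁ h).re - (T₂ h).re := by
    rw [← Complex.ofReal_re (f h), ← hTre h hh, hsub]; rfl
  rw [← hfh, h3]
  have h4 := abs_le.1 h1
  have h5 := abs_le.1 h2
  nlinarith [h4.2, h5.1]

end CuntzPedersen

/-! ### Winding numbers with respect to a trace -/

section Winding

open MeasureTheory intervalIntegral

variable {R : Type*} [NormedRing R] [NormedAlgebra ℂ R] [CompleteSpace R]

/-- A `C¹` path of invertible elements, parametrised by `[0,1]`. -/
structure IsC1Path (γ : ℝ → R) : Prop where
  contDiffOn : ContDiffOn ℝ 1 γ (Icc 0 1)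
  isUnit : ∀ t ∈ Icc (0 : ℝ) 1, IsUnit (γ t)

/-- The integral of the logarithmic derivative of a path, evaluated at a functional. -/
def winding (T : R →L[ℂ] ℂ) (γ : ℝ → R) : ℂ :=
  ∫ t in (0 : ℝ)..1, T (derivWithin γ (Icc 0 1) t * Ring.inverse (γ t))

lemma uniqueDiffOn_unitInterval : UniqueDiffOn ℝ (Icc (0 : ℝ) 1) := uniqueDiffOn_Icc zero_lt_one

lemma IsC1Path.hasDerivWithinAt {γ : ℝ → R} (h : IsC1Path γ) {t : ℝ} (ht : t ∈ Icc (0 : ℝ) 1) :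
    HasDerivWithinAt γ (derivWithin γ (Icc 0 1) t) (Icc 0 1) t :=
  (h.contDiffOn.differentiableOn one_ne_zero t ht).hasDerivWithinAt

lemma IsC1Path.continuousOn_deriv {γ : ℝ → R} (h : IsC1Path γ) :
    ContinuousOn (derivWithin γ (Icc 0 1)) (Icc 0 1) :=
  h.contDiffOn.continuousOn_derivWithin uniqueDiffOn_unitInterval le_rfl

lemma IsC1Path.continuousOn_inverse {γ : ℝ → R} (h : IsC1Path γ) :
    ContinuousOn (fun t => Ring.inverse (γ t)) (Icc 0 1) := fun t ht => by
  obtain ⟨x, hx⟩ := h.isUnit t ht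
  have := NormedRing.inverse_continuousAt x
  rw [hx] at this
  exact this.comp_continuousWithinAt (h.contDiffOn.continuousOn t ht)

lemma IsC1Path.continuousOn_logDeriv {γ : ℝ → R} (h : IsC1Path γ) :
    ContinuousOn (fun t => derivWithin γ (Icc 0 1) t * Ring.inverse (γ t)) (Icc 0 1) :=
  h.continuousOn_deriv.mul h.continuousOn_inverse

lemma IsC1Path.intervalIntegrable {γ : ℝ → R} (h : IsC1Path γ) (T : R →L[ℂ] ℂ) :
    IntervalIntegrable (fun t => T (derivWithin γ (Icc 0 1) t * Ring.inverse (γ t)))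
      volume 0 1 := by
  apply ContinuousOn.intervalIntegrable
  rw [uIcc_of_le zero_le_one]
  exact T.continuous.comp_continuousOn h.continuousOn_logDeriv

lemma IsC1Path.const {x : R} (hx : IsUnit x) : IsC1Path fun _ => x :=
  ⟨contDiffOn_const, fun _ _ => hx⟩

lemma IsC1Path.mul {γ η : ℝ → R} (h : IsC1Path γ) (h' : IsC1Path η) :
    IsC1Path fun t => γ t * η t :=
  ⟨h.contDiffOn.mul h'.contDiffOn, fun t ht => (h.isUnit t ht).mul (h'.isUnit t ht)⟩

lemma winding_congr (T : R →L[ℂ] ℂ) {γ η : ℝ → R} (h : EqOn γ η (Icc 0 1)) :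
    winding T γ = winding T η := by
  apply integral_congr
  rw [uIcc_of_le zero_le_one]
  intro t ht
  simp only [h ht, derivWithin_congr h (h ht)]

lemma winding_eq_of_hasDerivWithinAt (T : R →L[ℂ] ℂ) {γ γ' : ℝ → R}
    (h : ∀ t ∈ Icc (0 : ℝ) 1, HasDerivWithinAt γ (γ' t) (Icc 0 1) t) :
    winding T γ = ∫ t in (0 : ℝ)..1, T (γ' t * Ring.inverse (γ t)) := by
  apply integral_congr
  rw [uIcc_of_le zero_le_one]
  intro t ht
  simp only [(h t ht).derivWithin (uniqueDiffOn_unitInterval t ht)]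

lemma IsC1Path.hasDerivWithinAt_clm_comp {γ : ℝ → R} (h : IsC1Path γ) {S : Type*}
    [NormedAddCommGroup S] [NormedSpace ℂ S] (f : R →L[ℂ] S) {t : ℝ} (ht : t ∈ Icc (0 : ℝ) 1) :
    HasDerivWithinAt (fun t => f (γ t)) (f (derivWithin γ (Icc 0 1) t)) (Icc 0 1) t :=
  (f.restrictScalars ℝ).hasFDerivAt.comp_hasDerivWithinAt t (h.hasDerivWithinAt ht)

lemma winding_const (T : R →L[ℂ] ℂ) (x : R) : winding T (fun _ => x) = 0 := by
  simp [winding]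

/-- The logarithmic derivative of γη is γ'γ⁻¹ + γ(η'η⁻¹)γ⁻¹, and the trace does not see the
conjugation by γ. -/
lemma winding_mul {T : R →L[ℂ] ℂ} (hT : ∀ a b, T (a * b) = T (b * a)) {γ η : ℝ → R}
    (h : IsC1Path γ) (h' : IsC1Path η) :
    winding T (fun t => γ t * η t) = winding T γ + winding T η := by
  rw [winding, winding, winding, ← integral_add (h.intervalIntegrable T) (h'.intervalIntegrable T)]
  apply integral_congr
  rw [uIcc_of_le zero_le_one]
  intro t ht
  have hd := ((h.hasDerivWithinAt ht).mul (h'.hasDerivWithinAt ht)).derivWithin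
    (uniqueDiffOn_unitInterval t ht)
  have hd' : derivWithin (fun t => γ t * η t) (Icc 0 1) t = _ := hd
  obtain ⟨x, hx⟩ := h.isUnit t ht
  obtain ⟨y, hy⟩ := h'.isUnit t ht
  simp only [hd', ← hx, ← hy, ← Units.val_mul, Ring.inverse_unit, mul_inv_rev]
  rw [add_mul, map_add]
  congr 1
  · rw [Units.val_mul, mul_assoc]
    congr 2
    rw [← mul_assoc, Units.mul_inv, one_mul]
  · rw [Units.val_mul, hT]
    simp only [mul_assoc]
    rw [Units.inv_mul_cancel_left, hT]

/-- A loop close to `1` has winding number zero. -/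
lemma winding_eq_zero_of_norm_lt {T : R →L[ℂ] ℂ} (hT : ∀ a b, T (a * b) = T (b * a)) {γ : ℝ → R}
    (h : IsC1Path γ) (hlt : ∀ t ∈ Icc (0 : ℝ) 1, ‖1 - γ t‖ < 1) (h01 : γ 0 = γ 1) :
    winding T γ = 0 := by
  obtain ⟨t₀, ht₀, hmax⟩ := isCompact_Icc.exists_isMaxOn (nonempty_Icc.2 zero_le_one)
    (continuousOn_const.sub h.contDiffOn.continuousOn).norm
  set r := ‖1 - γ t₀‖ with hr
  have hr1 : r < 1 := hlt t₀ ht₀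
  have hr0 : 0 ≤ r := norm_nonneg _
  have hle : ∀ t ∈ Icc (0 : ℝ) 1, ‖1 - γ t‖ ≤ r := fun t ht => hmax ht
  obtain ⟨C, hC⟩ := isCompact_Icc.exists_bound_of_continuousOn h.continuousOn_deriv
  set x : ℝ → R := fun t => 1 - γ t with hx
  set D := derivWithin γ (Icc 0 1)
  have hxd : ∀ t ∈ Icc (0 : ℝ) 1, HasDerivWithinAt x (-D t) (Icc 0 1) t := fun t ht =>
    (h.hasDerivWithinAt ht).const_sub 1
  have hxc : ContinuousOn x (Icc 0 1) := continuousOn_const.sub h.contDiffOn.continuousOn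
  -- By traciality the power rule holds under T as in a commutative algebra. Hence T(γ' xⁿ) is a
  -- multiple of the derivative of T(xⁿ⁺¹) and integrates to zero over the loop. The factors x^k in
  -- `aux` make the induction close; for n = 0 the truncated exponent n - 1 is harmless because the
  -- coefficient is 0.
  have hpow : ∀ n : ℕ, ∀ t ∈ Icc (0 : ℝ) 1,
      HasDerivWithinAt (fun t => T (x t ^ n)) (n * T (-D t * x t ^ (n - 1))) (Icc 0 1) t := by
    have aux : ∀ n : ℕ, ∀ t ∈ Icc (0 : ℝ) 1, ∃ d, HasDerivWithinAt (fun t => x t ^ n) d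
        (Icc 0 1) t ∧ ∀ k, T (d * x t ^ k) = n * T (-D t * x t ^ (n - 1 + k)) := by
      intro n t ht
      induction n with
      | zero => exact ⟨0, by simpa using! hasDerivWithinAt_const t (Icc (0 : ℝ) 1) (1 : R),
          by simp⟩
      | succ n ih =>
        obtain ⟨d, hd, hdk⟩ := ih
        refine ⟨d * x t + x t ^ n * -D t, ?_, fun k => ?_⟩
        · simp_rw [pow_succ]
          exact hd.mul (hxd t ht)
        · rw [add_mul, map_add, mul_assoc, ← pow_succ', hdk, mul_assoc, hT (x t ^ n), mul_assoc,
            ← pow_add]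
          rcases n with _ | n
          · simp
          · simp only [Nat.add_sub_cancel]
            rw [show n + (k + 1) = n + 1 + k by ring, show k + (n + 1) = n + 1 + k by ring]
            push_cast
            ring
    intro n t ht
    obtain ⟨d, hd, hdk⟩ := aux n t ht
    have := hdk 0
    rw [pow_zero, mul_one, add_zero] at this
    rw [← this]
    exact (T.restrictScalars ℝ).hasFDerivAt.comp_hasDerivWithinAt t hd
  have hzero : ∀ n : ℕ, ∫ t in (0 : ℝ)..1, T (D t * x t ^ n) = 0 := fun n => by
    have hcont : ContinuousOn (fun t => T (D t * x t ^ n)) (Icc 0 1) :=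
      T.continuous.comp_continuousOn (h.continuousOn_deriv.mul (hxc.pow n))
    have h1 := integral_eq_sub_of_hasDeriv_right (a := 0) (b := 1)
      (f := fun t => T (x t ^ (n + 1))) (f' := fun t => ((n + 1 : ℕ) : ℂ) * T (-D t * x t ^ n))
      (by
        rw [uIcc_of_le zero_le_one]
        exact T.continuous.comp_continuousOn (hxc.pow _))
      (fun t ht => by
        rw [min_eq_left zero_le_one, max_eq_right zero_le_one] at ht
        exact ((hpow (n + 1) t (Ioo_subset_Icc_self ht)).hasDerivAt
          (Icc_mem_nhds ht.1 ht.2)).hasDerivWithinAt)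
      (by
        apply ContinuousOn.intervalIntegrable
        rw [uIcc_of_le zero_le_one]
        simp only [neg_mul, map_neg]
        exact continuousOn_const.mul hcont.neg)
    have h2 : x 1 = x 0 := by simp only [hx, h01]
    simp only [h2, sub_self, neg_mul, map_neg, intervalIntegral.integral_const_mul,
      intervalIntegral.integral_neg] at h1
    have h3 : (n : ℂ) + 1 ≠ 0 := by exact_mod_cast n.succ_ne_zero
    simpa [h3] using h1
  obtain ⟨C', hC'⟩ := isCompact_Icc.exists_bound_of_continuousOn h.continuousOn_inverse
  have hC0 : 0 ≤ C := (norm_nonneg _).trans (hC t₀ ht₀)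
  have hC0' : 0 ≤ C' := (norm_nonneg _).trans (hC' t₀ ht₀)
  -- In the Neumann series γ⁻¹ = ∑ xⁱ, cut off after n + 1 terms, each term contributes zero. Only
  -- the remainder xⁿ⁺¹ γ⁻¹ is left, and it decays geometrically.
  have hbound : ∀ n : ℕ, ‖winding T γ‖ ≤ ‖T‖ * (C * (r ^ (n + 1) * C')) := fun n => by
    have h1 : winding T γ = ∫ t in (0 : ℝ)..1, T (D t * (x t ^ (n + 1) * Ring.inverse (γ t))) := by
      have h2 : winding T γ = ∫ t in (0 : ℝ)..1, (∑ i ∈ Finset.range (n + 1), T (D t * x t ^ i)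
          + T (D t * (x t ^ (n + 1) * Ring.inverse (γ t)))) := by
        apply integral_congr
        rw [uIcc_of_le zero_le_one]
        intro t ht
        have := NormedRing.inverse_one_sub_nth_order' (n + 1) (t := x t) (hlt t ht)
        simp only [hx, sub_sub_cancel] at this ⊢
        rw [← map_sum, ← Finset.mul_sum, ← map_add, ← mul_add, ← this]
      rw [h2, intervalIntegral.integral_add, intervalIntegral.integral_finsetSum]
      · simp [hzero]
      · intro i _
        apply ContinuousOn.intervalIntegrable
        rw [uIcc_of_le zero_le_one]
        exact T.continuous.comp_continuousOn (h.continuousOn_deriv.mul (hxc.pow i))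
      · apply ContinuousOn.intervalIntegrable
        rw [uIcc_of_le zero_le_one]
        exact continuousOn_finsetSum _ fun i _ =>
          T.continuous.comp_continuousOn (h.continuousOn_deriv.mul (hxc.pow i))
      · apply ContinuousOn.intervalIntegrable
        rw [uIcc_of_le zero_le_one]
        exact T.continuous.comp_continuousOn
          (h.continuousOn_deriv.mul ((hxc.pow _).mul h.continuousOn_inverse))
    rw [h1]
    have h3 := intervalIntegral.norm_integral_le_of_norm_le_const (a := 0) (b := 1)
      (C := ‖T‖ * (C * (r ^ (n + 1) * C')))
      (f := fun t => T (D t * (x t ^ (n + 1) * Ring.inverse (γ t)))) (fun t ht => by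
        rw [uIoc_of_le zero_le_one] at ht
        have ht' := Ioc_subset_Icc_self ht
        refine (T.le_opNorm _).trans (mul_le_mul_of_nonneg_left ?_ (norm_nonneg _))
        refine (norm_mul_le _ _).trans (mul_le_mul (hC t ht') ?_ (norm_nonneg _) hC0)
        refine (norm_mul_le _ _).trans (mul_le_mul ?_ (hC' t ht') (norm_nonneg _) (by positivity))
        exact (norm_pow_le' _ n.succ_pos).trans (pow_le_pow_left₀ (norm_nonneg _) (hle t ht') _))
    simpa using h3
  have hlim : Filter.Tendsto (fun n : ℕ => ‖T‖ * (C * (r ^ (n + 1) * C'))) Filter.atTop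
      (nhds (‖T‖ * (C * (0 * C')))) :=
    ((((tendsto_pow_atTop_nhds_zero_of_lt_one hr0 hr1).comp
      (Filter.tendsto_add_atTop_nat 1)).mul_const C').const_mul C).const_mul ‖T‖
  have := ge_of_tendsto' hlim hbound
  simpa using this

/-! ### Linear loops -/

/-- The standard parametrisation of the unit circle. -/
def circ (t : ℝ) : ℂ := Complex.exp (2 * Real.pi * Complex.I * t)

lemma contDiff_circ : ContDiff ℝ ∞ circ := by
  exact (contDiff_const.mul Complex.ofRealCLM.contDiff).cexp

lemma hasDerivAt_circ (t : ℝ) : HasDerivAt circ (2 * Real.pi * Complex.I * circ t) t := by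
  have h1 : HasDerivAt (fun t : ℝ => 2 * Real.pi * Complex.I * (t : ℂ))
      (2 * Real.pi * Complex.I) t := by
    simpa using (Complex.ofRealCLM.hasDerivAt (x := t)).const_mul (2 * Real.pi * Complex.I)
  have := h1.cexp
  rw [mul_comm (Complex.exp _)] at this
  exact this

lemma circ_ne_zero (t : ℝ) : circ t ≠ 0 := Complex.exp_ne_zero _

@[simp] lemma circ_zero : circ 0 = 1 := by simp [circ]

@[simp] lemma circ_one : circ 1 = 1 := by
  simp [circ, Complex.exp_two_pi_mul_I]

lemma circ_zpow (t : ℝ) (n : ℤ) :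
    circ t ^ n = Complex.exp (2 * Real.pi * Complex.I * n * t) := by
  rw [circ, ← Complex.exp_int_mul]
  congr 1
  ring

lemma norm_circ (t : ℝ) : ‖circ t‖ = 1 := by
  rw [circ, Complex.norm_exp]
  simp

lemma integral_circ_zpow {n : ℤ} (hn : n ≠ 0) : ∫ t in (0 : ℝ)..1, circ t ^ n = 0 := by
  have hc : (2 * Real.pi * Complex.I * n : ℂ) ≠ 0 := by
    simp [Real.pi_ne_zero, Complex.I_ne_zero, hn]
  simp_rw [circ_zpow]
  rw [integral_exp_mul_complex hc]
  have : Complex.exp (2 * Real.pi * Complex.I * n * (1 : ℝ)) = 1 := by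
    rw [← circ_zpow, circ_one, one_zpow]
  rw [this]
  simp

/-- Fourier coefficients on the unit circle. -/
def fourierCoef (f : ℝ → R) (k : ℤ) : R := ∫ t in (0 : ℝ)..1, circ t ^ (-k) • f t

/-- The Riemann-Lebesgue lemma on the line, applied to f cut off to (0, 1]. -/
lemma tendsto_fourierCoef (f : ℝ → R) :
    Filter.Tendsto (fun j : ℕ => fourierCoef f j) Filter.atTop (nhds 0) := by
  have h1 := (Real.tendsto_integral_exp_smul_cocompact ((Ioc (0 : ℝ) 1).indicator f)).comp
    ((tendsto_natCast_atTop_atTop (R := ℝ)).mono_right atTop_le_cocompact)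
  refine h1.congr fun j => ?_
  rw [fourierCoef, integral_of_le zero_le_one, ← MeasureTheory.integral_indicator measurableSet_Ioc]
  simp only [Function.comp_apply]
  congr 1
  ext t
  by_cases ht : t ∈ Ioc (0 : ℝ) 1
  · simp only [indicator_of_mem ht]
    rw [Circle.smul_def, Real.fourierChar_apply, circ_zpow]
    congr 2
    push_cast
    ring
  · simp only [indicator_of_notMem ht, smul_zero]

lemma circ_smul_intervalIntegrable {f : ℝ → R} (hf : ContinuousOn f (Icc 0 1)) (k : ℤ) :
    IntervalIntegrable (fun t => circ t ^ k • f t) volume 0 1 := by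
  apply ContinuousOn.intervalIntegrable
  rw [uIcc_of_le zero_le_one]
  exact ContinuousOn.smul (contDiff_circ.continuous.continuousOn.zpow₀ _
    fun t _ => Or.inl (circ_ne_zero t)) hf

lemma mul_fourierCoef {f : ℝ → R} (hf : ContinuousOn f (Icc 0 1)) (k : ℤ) (B : R) :
    B * fourierCoef f k = ∫ t in (0 : ℝ)..1, circ t ^ (-k) • (B * f t) := by
  have := (ContinuousLinearMap.mul ℂ R B).intervalIntegral_comp_comm
    (circ_smul_intervalIntegrable hf (-k))
  simp only [map_smul, ContinuousLinearMap.mul_apply'] at this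
  exact this.symm

lemma fourierCoef_mul {f : ℝ → R} (hf : ContinuousOn f (Icc 0 1)) (k : ℤ) (B : R) :
    fourierCoef f k * B = ∫ t in (0 : ℝ)..1, circ t ^ (-k) • (f t * B) := by
  have := ((ContinuousLinearMap.mul ℂ R).flip B).intervalIntegral_comp_comm
    (circ_smul_intervalIntegrable hf (-k))
  simp only [map_smul, ContinuousLinearMap.flip_apply, ContinuousLinearMap.mul_apply'] at this
  exact this.symm

/-- The winding number of a linear loop `1 + (z - 1) B` is given by an idempotent (the Riesz
projection). -/
lemma exists_idempotent_winding_eq {B : R}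
    (hB : ∀ t ∈ Icc (0 : ℝ) 1, IsUnit (1 + (circ t - 1) • B)) :
    IsC1Path (fun t => 1 + (circ t - 1) • B) ∧
    ∃ e : R, e * e = e ∧ ∀ T : R →L[ℂ] ℂ,
      winding T (fun t => 1 + (circ t - 1) • B) = 2 * Real.pi * Complex.I * T e := by
  set L : ℝ → R := fun t => 1 + (circ t - 1) • B with hL
  have hpath : IsC1Path L :=
    ⟨(contDiff_const.add (((contDiff_circ.of_le (by simp)).sub contDiff_const).smul
      contDiff_const)).contDiffOn, hB⟩
  refine ⟨hpath, ?_⟩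
  set f : ℝ → R := fun t => Ring.inverse (L t)
  have hf : ContinuousOn f (Icc 0 1) := hpath.continuousOn_inverse
  have hLf : ∀ t ∈ Icc (0 : ℝ) 1, L t * f t = 1 := fun t ht => Ring.mul_inverse_cancel _ (hB t ht)
  have hcomm : ∀ t ∈ Icc (0 : ℝ) 1, f t * B = B * f t := fun t ht => by
    have h1 : L t * B = B * L t := by
      simp only [hL, add_mul, mul_add, one_mul, mul_one, smul_mul_assoc, mul_smul_comm]
    have h2 := Ring.inverse_mul_cancel _ (hB t ht)
    calc f t * B = f t * (B * L t) * f t := by rw [mul_assoc, mul_assoc, hLf t ht, mul_one]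
      _ = f t * L t * B * f t := by rw [← h1]; simp only [mul_assoc]
      _ = B * f t := by rw [h2, one_mul]
  set c : ℤ → R := fourierCoef f
  have hc : ∀ k, c k * B = B * c k := fun k => by
    rw [mul_fourierCoef hf, fourierCoef_mul hf]
    apply integral_congr
    rw [uIcc_of_le zero_le_one]
    intro t ht
    simp only [hcomm t ht]
  -- Comparison of Fourier coefficients in L f = 1, where L = (1 - B) + zB.
  have hrec : ∀ k : ℤ, (1 - B) * c k + B * c (k - 1) = if k = 0 then 1 else 0 := fun k => by
    rw [mul_fourierCoef hf, mul_fourierCoef hf, ← integral_add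
      (circ_smul_intervalIntegrable (f := fun t => (1 - B) * f t) (continuousOn_const.mul hf) _)
      (circ_smul_intervalIntegrable (f := fun t => B * f t) (continuousOn_const.mul hf) _)]
    have h1 : ∫ t in (0 : ℝ)..1, (circ t ^ (-k) • ((1 - B) * f t)
        + circ t ^ (-(k - 1)) • (B * f t)) = ∫ t in (0 : ℝ)..1, circ t ^ (-k) • (1 : R) := by
      apply integral_congr
      rw [uIcc_of_le zero_le_one]
      intro t ht
      simp only
      have h2 : circ t ^ (-(k - 1)) = circ t ^ (-k) * circ t := by
        rw [neg_sub, sub_eq_neg_add, zpow_add₀ (circ_ne_zero t), zpow_one]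
      rw [h2, mul_smul, ← smul_add, ← smul_mul_assoc, ← add_mul]
      refine (?_ : _ = circ t ^ (-k) • (L t * f t)).trans (by rw [hLf t ht])
      congr 2
      simp only [hL, sub_smul, one_smul]
      abel
    rw [h1, intervalIntegral.integral_smul_const]
    split_ifs with hk
    · simp [hk]
    · rw [integral_circ_zpow (neg_ne_zero.2 hk), zero_smul]
  -- The idempotent is the contour integral of L'L⁻¹ divided by 2πi: as L' = 2πi z B, it equals B ∫
  -- z f = B c₋₁.
  refine ⟨B * c (-1), ?_, fun T => ?_⟩
  · have h0 : 1 - B * c (-1) = (1 - B) * c 0 := by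
      have := hrec 0
      rw [if_pos rfl, zero_sub] at this
      exact sub_eq_of_eq_add this.symm
    have hstep : ∀ k : ℤ, k ≠ 0 → (1 - B) * c k = -(B * c (k - 1)) := fun k hk => by
      have := hrec k
      rw [if_neg hk] at this
      exact eq_neg_of_add_eq_zero_left this
    -- Two uses of the recurrence move one index outwards on each side, so e(1 - e) = B(1 - B) c₋₁₋ⱼ
    -- cⱼ for every j. As the coefficients are bounded and cⱼ tends to 0, the product e(1 - e)
    -- vanishes.
    have hinv : ∀ j : ℕ, B * c (-1) * ((1 - B) * c 0)
        = B * ((1 - B) * c (-1 - j)) * c j := by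
      intro j
      have hcY : ∀ k, c k * (1 - B) = (1 - B) * c k := fun k => by
        rw [mul_sub, sub_mul, hc k]; simp
      induction j with
      | zero => simp only [Nat.cast_zero, sub_zero, ← mul_assoc, mul_assoc B (c (-1)), hcY]
      | succ j ih =>
        have e1 := hstep (-1 - j) (by omega)
        have e2 := hstep (j + 1) (by omega)
        rw [ih, e1]
        rw [show (-1 : ℤ) - j - 1 = -1 - (j + 1 : ℕ) by push_cast; ring] 
        rw [show ((j : ℤ) + 1 - 1) = j by ring] at e2
        have e3 : B * c (-1 - ((j + 1 : ℕ) : ℤ)) = c (-1 - ((j + 1 : ℕ) : ℤ)) * B := (hc _).symm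
        push_cast at e3 ⊢
        rw [e3, mul_neg, neg_mul, mul_assoc, mul_assoc, ← mul_neg, ← mul_neg, ← e2, ← hcY (j + 1)]
        rw [← hcY]
        simp only [mul_assoc, hcY (j + 1)]
    have hbd : ∃ K, ∀ k : ℤ, ‖c k‖ ≤ K := by
      obtain ⟨K, hK⟩ := isCompact_Icc.exists_bound_of_continuousOn hf
      refine ⟨K * |1 - 0|, fun k => ?_⟩
      refine intervalIntegral.norm_integral_le_of_norm_le_const fun t ht => ?_
      rw [uIoc_of_le zero_le_one] at ht
      rw [norm_smul, norm_zpow, norm_circ, one_zpow, one_mul]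
      exact hK t (Ioc_subset_Icc_self ht)
    obtain ⟨K, hK⟩ := hbd
    have hzero : B * c (-1) * ((1 - B) * c 0) = 0 := by
      rw [← norm_le_zero_iff]
      have hlim : Filter.Tendsto (fun j : ℕ => ‖B‖ * (‖1 - B‖ * K) * ‖c j‖) Filter.atTop
          (nhds (‖B‖ * (‖1 - B‖ * K) * 0)) := by
        have := (tendsto_fourierCoef f).norm
        rw [norm_zero] at this
        exact this.const_mul _
      rw [mul_zero] at hlim
      refine ge_of_tendsto' hlim fun j => ?_
      rw [hinv j]
      refine (norm_mul_le _ _).trans (mul_le_mul_of_nonneg_right ?_ (norm_nonneg _))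
      refine (norm_mul_le _ _).trans (mul_le_mul_of_nonneg_left ?_ (norm_nonneg _))
      exact (norm_mul_le _ _).trans (mul_le_mul_of_nonneg_left (hK _) (norm_nonneg _))
    rw [← h0, mul_sub, mul_one, sub_eq_zero] at hzero
    exact hzero.symm
  · have hd : ∀ t ∈ Icc (0 : ℝ) 1,
        derivWithin L (Icc 0 1) t = (2 * Real.pi * Complex.I * circ t) • B := fun t ht =>
      ((((hasDerivAt_circ t).sub_const 1).smul_const B).const_add 1).hasDerivWithinAt.derivWithin
        (uniqueDiffOn_unitInterval t ht)
    have h1 : T (B * c (-1)) = ∫ t in (0 : ℝ)..1, T (circ t ^ (1 : ℤ) • (B * f t)) := by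
      rw [mul_fourierCoef hf, ← T.intervalIntegral_comp_comm]
      · simp
      · simpa using circ_smul_intervalIntegrable (continuousOn_const.mul hf) 1
    rw [h1, winding, ← intervalIntegral.integral_const_mul]
    apply integral_congr
    rw [uIcc_of_le zero_le_one]
    intro t ht
    simp only [hd t ht, zpow_one, map_smul, smul_mul_assoc, smul_eq_mul, mul_assoc]
    rfl

end Winding

/-! ### Traces on matrix algebras -/

section MatTrace

variable {A : Type*} [CStarAlgebra A] [PartialOrder A] [StarOrderedRing A]

/-- The entry `a i j` of a matrix, as a continuous linear map. -/
def entryL {n : ℕ} (i j : Fin n) : Mat A n →L[ℂ] A :=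
  LinearMap.mkContinuous
    { toFun := fun a : Mat A n => a i j
      map_add' := fun _ _ => rfl
      map_smul' := fun _ _ => rfl } 1
    fun a => by
      rw [one_mul]
      exact CStarMatrix.norm_entry_le_norm (M := a)

lemma entryL_apply {n : ℕ} (i j : Fin n) (a : Mat A n) : entryL i j a = a i j := rfl

/-- The matrix with a single nonzero entry, as a continuous linear map. -/
def singleL {n : ℕ} (i j : Fin n) : A →L[ℂ] Mat A n :=
  (CStarMatrix.ofMatrixL (A := A) (m := Fin n) (n := Fin n)).toContinuousLinearMap.comp
    ⟨Matrix.singleLinearMap ℂ i j, continuous_matrix fun k l => by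
      change Continuous fun a : A => if i = k ∧ j = l then a else 0
      split_ifs
      exacts [continuous_id, continuous_const]⟩

lemma singleL_apply {n : ℕ} (i j : Fin n) (a : A) (k l : Fin n) :
    singleL i j a k l = if i = k ∧ j = l then a else 0 := rfl

lemma sum_singleL {n : ℕ} (a : Mat A n) : ∑ i, ∑ j, singleL i j (a i j) = a :=
  (Matrix.matrix_eq_sum_single (CStarMatrix.ofMatrix.symm a)).symm

lemma contDiffOn_of_entries {n : ℕ} {f : ℝ → Mat A n} {s : Set ℝ} {k : WithTop ℕ∞}
    (h : ∀ i j, ContDiffOn ℝ k (fun t => f t i j) s) : ContDiffOn ℝ k f s := by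
  have h1 : f = fun t => ∑ i, ∑ j, singleL i j (f t i j) := funext fun t => (sum_singleL _).symm
  rw [h1]
  exact ContDiffOn.sum fun i _ => ContDiffOn.sum fun j _ =>
    ((singleL i j : A →L[ℂ] Mat A n).restrictScalars ℝ).contDiff.comp_contDiffOn (h i j)

/-- The matrix trace, as a continuous linear map. -/
def matTraceL (A : Type*) [CStarAlgebra A] [PartialOrder A] [StarOrderedRing A] (n : ℕ) :
    Mat A n →L[ℂ] A := ∑ i, entryL i i

lemma matTraceL_apply {n : ℕ} (a : Mat A n) : matTraceL A n a = matTrace a := by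
  simp [matTraceL, matTrace, entryL_apply]

lemma matTrace_mul_comm {T : A →L[ℂ] ℂ} (hT : ∀ a b, T (a * b) = T (b * a)) {n : ℕ}
    (a b : Mat A n) : T (matTrace (a * b)) = T (matTrace (b * a)) := by
  simp only [matTrace, CStarMatrix.mul_apply, map_sum]
  rw [Finset.sum_comm]
  exact Finset.sum_congr rfl fun i _ => Finset.sum_congr rfl fun j _ => hT _ _

lemma tracial_comp_matTraceL {T : A →L[ℂ] ℂ} (hT : ∀ a b, T (a * b) = T (b * a)) {n : ℕ}
    (a b : Mat A n) : T.comp (matTraceL A n) (a * b) = T.comp (matTraceL A n) (b * a) := by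
  simp only [ContinuousLinearMap.comp_apply, matTraceL_apply, matTrace_mul_comm hT]

end MatTrace

/-! ### Idempotents and projections -/

section Idempotents

variable {A : Type*} [CStarAlgebra A] [PartialOrder A] [StarOrderedRing A]

/-- The range projection of an idempotent. -/
lemma exists_isStarProjection_of_idempotent {e : A} (he : e * e = e) :
    ∃ p : A, IsStarProjection p ∧ e * p = p ∧ p * e = e := by
  -- Kaplansky's formula: z ≥ 1 is invertible, commutes with e and e*, and satisfies ez = e e* e.
  -- Thus e e* z⁻¹ is a projection with the same range as e.
  set z : A := 1 + (e - star e) * star (e - star e) with hz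
  have hes : star e * star e = star e := by rw [← star_mul, he]
  have hzu : IsUnit z := CStarAlgebra.isUnit_of_le (1 : A)
    (le_add_of_nonneg_right (mul_star_self_nonneg _)) isStrictlyPositive_one
  have hzz : z = 1 + e * star e - e - star e + star e * e := by
    rw [hz, star_sub, star_star, sub_mul, mul_sub, mul_sub, he, hes]
    abel
  have h1 : e * z = e * star e * e := by
    rw [hzz]
    simp only [mul_add, mul_sub, mul_one, ← mul_assoc, he]
    abel
  have h2 : z * e = e * star e * e := by
    rw [hzz]
    simp only [add_mul, sub_mul, one_mul, mul_assoc, he]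
    abel
  have hzs : star z = z := by
    rw [hz]; simp
  have h1s : star e * z = z * star e := by
    have := congrArg star (h1.trans h2.symm)
    simpa [hzs] using this.symm
  obtain ⟨w, hw⟩ := hzu
  have hwe : e * (↑w⁻¹ : A) = (↑w⁻¹ : A) * e := by
    rw [Units.eq_inv_mul_iff_mul_eq, ← mul_assoc, Units.mul_inv_eq_iff_eq_mul, hw, h1, h2]
  have hwes : star e * (↑w⁻¹ : A) = (↑w⁻¹ : A) * star e := by
    rw [Units.eq_inv_mul_iff_mul_eq, ← mul_assoc, Units.mul_inv_eq_iff_eq_mul, hw, h1s]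
  have hws : star (↑w⁻¹ : A) = (↑w⁻¹ : A) := by
    have h3 : star (↑w⁻¹ : A) * w = 1 := by
      have := congrArg star (Units.mul_inv w)
      rwa [star_mul, hw, hzs, star_one, ← hw] at this
    exact (Units.mul_eq_one_iff_eq_inv).1 h3
  have hpe : e * star e * (↑w⁻¹ : A) * e = e := by
    rw [mul_assoc _ _ e, ← hwe, ← mul_assoc, ← h1, ← hw, mul_assoc, Units.mul_inv, mul_one]
  refine ⟨e * star e * ↑w⁻¹, ⟨?_, ?_⟩, ?_, hpe⟩
  · change e * star e * (↑w⁻¹ : A) * (e * star e * ↑w⁻¹) = _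
    rw [← mul_assoc, ← mul_assoc, hpe]
  · change star _ = _
    rw [star_mul, star_mul, star_star, hws, ← mul_assoc, ← hwe, mul_assoc, ← hwes, mul_assoc]
  · rw [← mul_assoc, ← mul_assoc, he]

end Idempotents

/-! ### Linearisation of polynomial loops -/

section Linearization

variable {M : Type*} [CStarAlgebra M] [PartialOrder M] [StarOrderedRing M]

/-- The lower shift matrix. -/
def shiftMat (M : Type*) [CStarAlgebra M] (n : ℕ) : Mat M n :=
  CStarMatrix.ofMatrix fun i j => if i.1 = j.1 + 1 then 1 else 0

lemma shiftMat_apply {n : ℕ} (i j : Fin n) :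
    shiftMat M n i j = if i.1 = j.1 + 1 then 1 else 0 := rfl

lemma mul_shiftMat_apply {n : ℕ} (a : Mat M n) (i j : Fin n) :
    (a * shiftMat M n) i j = if h : j.1 + 1 < n then a i ⟨j.1 + 1, h⟩ else 0 := by
  rw [CStarMatrix.mul_apply]
  simp only [shiftMat_apply, mul_ite, mul_one, mul_zero]
  split_ifs with h
  · rw [Finset.sum_eq_single ⟨j.1 + 1, h⟩]
    · simp
    · intro k _ hk
      rw [if_neg]
      exact fun h' => hk (Fin.ext h')
    · simp
  · exact Finset.sum_eq_zero fun k _ => if_neg (by omega)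

lemma shiftMat_pow_apply {n : ℕ} (k : ℕ) (i j : Fin n) :
    (shiftMat M n ^ k) i j = if i.1 = j.1 + k then 1 else 0 := by
  induction k generalizing j with
  | zero => simp [CStarMatrix.one_apply, Fin.ext_iff]
  | succ k ih =>
    rw [pow_succ, mul_shiftMat_apply]
    split_ifs with h1 h2 h2
    · rw [ih, if_pos]; simp only; omega
    · rw [ih, if_neg]; simp only; omega
    · omega
    · rfl

lemma shiftMat_pow_eq_zero (n : ℕ) : shiftMat M n ^ n = 0 := by
  ext i j
  rw [shiftMat_pow_apply, if_neg (by omega)]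
  rfl

lemma one_sub_smul_shiftMat_mul (n : ℕ) (z : ℂ) :
    (1 - z • shiftMat M n) * (∑ k ∈ Finset.range n, (z • shiftMat M n) ^ k) = 1 ∧
      (∑ k ∈ Finset.range n, (z • shiftMat M n) ^ k) * (1 - z • shiftMat M n) = 1 := by
  have h : (z • shiftMat M n) ^ n = 0 := by rw [smul_pow, shiftMat_pow_eq_zero, smul_zero]
  constructor
  · rw [mul_neg_geom_sum, h, sub_zero]
  · rw [geom_sum_mul_neg, h, sub_zero]

lemma isC1Path_one_sub_shift (n : ℕ) : IsC1Path fun t => 1 - circ t • shiftMat M n := by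
  refine ⟨(contDiff_const.sub ((contDiff_circ.of_le (by simp)).smul contDiff_const)).contDiffOn,
    fun t _ => ?_⟩
  have h := one_sub_smul_shiftMat_mul (M := M) n (circ t)
  exact ⟨⟨_, _, h.1, h.2⟩, rfl⟩

/-- The logarithmic derivative is a combination of positive powers of the shift, all of which have
zero diagonal. -/
lemma winding_one_sub_shift (T : M →L[ℂ] ℂ) (n : ℕ) :
    winding (T.comp (matTraceL M n)) (fun t => 1 - circ t • shiftMat M n) = 0 := by
  rw [winding_eq_of_hasDerivWithinAt _
    (γ' := fun t => -((2 * Real.pi * Complex.I * circ t) • shiftMat M n)) fun t _ =>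
    (((hasDerivAt_circ t).smul_const (shiftMat M n)).const_sub 1).hasDerivWithinAt,
    intervalIntegral.integral_congr (g := fun _ => (0 : ℂ))]
  · simp
  rw [uIcc_of_le zero_le_one]
  intro t ht
  have h := one_sub_smul_shiftMat_mul (M := M) n (circ t)
  have hi : Ring.inverse (1 - circ t • shiftMat M n)
      = ∑ k ∈ Finset.range n, (circ t • shiftMat M n) ^ k :=
    Ring.inverse_unit (⟨_, _, h.1, h.2⟩ : (Mat M n)ˣ)
  simp only [hi, ContinuousLinearMap.comp_apply, matTraceL_apply]
  suffices h0 : matTrace (-((2 * Real.pi * Complex.I * circ t) • shiftMat M n) *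
      ∑ k ∈ Finset.range n, (circ t • shiftMat M n) ^ k) = 0 by rw [h0, map_zero]
  rw [matTrace]
  refine Finset.sum_eq_zero fun i _ => ?_
  simp only [← entryL_apply, neg_mul, map_neg, smul_mul_assoc, map_smul, Finset.mul_sum, map_sum,
    smul_pow, mul_smul_comm]
  refine Finset.sum_eq_zero fun k _ => ?_
  rw [← pow_succ', entryL_apply, shiftMat_pow_apply, if_neg (by omega), smul_zero,
    neg_zero, smul_zero]

/-- The tails `∑ k, z ^ k a (j + k)` of a polynomial of degree at most `d`. -/
def polyTail (a : ℕ → M) (d j : ℕ) (z : ℂ) : M := ∑ k ∈ Finset.range (d + 1), z ^ k • a (j + k)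

/-- Horner's recursion. The tail starting at j + 1 has one term too many, which vanishes because the
coefficients beyond d do. -/
lemma polyTail_sub {a : ℕ → M} {d : ℕ} (ha : ∀ k, d < k → a k = 0) (j : ℕ) (z : ℂ) :
    polyTail a d j z - z • polyTail a d (j + 1) z = a j := by
  rw [polyTail, polyTail, Finset.sum_range_succ', Finset.sum_range_succ, ha (j + 1 + d) (by omega),
    smul_zero, add_zero (∑ _ ∈ _, _), Finset.smul_sum]
  simp only [smul_smul, ← pow_succ', pow_zero, one_smul, add_zero]
  rw [add_comm, add_sub_assoc, sub_eq_zero.2, add_zero]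
  exact Finset.sum_congr rfl fun k _ => by rw [show j + (k + 1) = j + 1 + k by ring]

lemma polyTail_eq_zero {a : ℕ → M} {d : ℕ} (ha : ∀ k, d < k → a k = 0) {j : ℕ} (hj : d < j)
    (z : ℂ) : polyTail a d j z = 0 :=
  Finset.sum_eq_zero fun k _ => by rw [ha _ (by omega), smul_zero]

lemma contDiff_polyTail (a : ℕ → M) (d j : ℕ)  :
    ContDiff ℝ 1 fun t => polyTail a d j (circ t) := by
  unfold polyTail
  exact ContDiff.sum fun k _ => ((contDiff_circ.of_le (by simp)).pow k).smul contDiff_const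

/-- The matrix with first row `b` which agrees with the identity in the other rows. -/
def rowMat {d : ℕ} (b : ℕ → M) : Mat M (d + 1) :=
  CStarMatrix.ofMatrix fun i j => if i = 0 then b j else if i = j then 1 else 0

lemma rowMat_apply {d : ℕ} (b : ℕ → M) (i j : Fin (d + 1)) :
    rowMat b i j = if i = 0 then b j else if i = j then 1 else 0 := rfl

lemma rowMat_mul {d : ℕ} (b c : ℕ → M) (b' : ℕ → M) (h0 : b' 0 = b 0 * c 0)
    (h : ∀ j, 0 < j → b' j = b 0 * c j + b j) :
    (rowMat b * rowMat c : Mat M (d + 1)) = rowMat b' := by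
  ext i j
  rw [CStarMatrix.mul_apply, Fin.sum_univ_succ]
  refine Fin.cases ?_ (fun i => ?_) i
  · refine Fin.cases ?_ (fun j => ?_) j
    · simp [rowMat_apply, Fin.succ_ne_zero, h0]
    · simp [rowMat_apply, Fin.succ_ne_zero, h]
  · simp only [rowMat_apply, Fin.succ_ne_zero, if_false]
    rw [Finset.sum_eq_single i] <;> simp +contextual [Fin.succ_inj, eq_comm]

lemma rowMat_one {d : ℕ} : (rowMat (fun j => if j = 0 then 1 else 0) : Mat M (d + 1)) = 1 := by
  ext i j
  rw [rowMat_apply, CStarMatrix.one_apply]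
  by_cases hi : i = 0
  · subst hi
    by_cases hj : j = 0
    · simp [hj]
    · simp [hj, Ne.symm hj, Fin.val_eq_zero_iff]
  · simp [hi]

/-- The linearisation trick: by Horner's recursion, the unipotent factor 1 - zS turns the row of
tails into the row of coefficients, so that the product is affine in z. -/
lemma rowMat_polyTail_mul {a : ℕ → M} {d : ℕ} (ha : ∀ k, d < k → a k = 0) (z : ℂ) :
    (rowMat fun j => polyTail a d j z) * (1 - z • shiftMat M (d + 1))
      = rowMat a - z • shiftMat M (d + 1) := by
  rw [mul_sub, mul_one, mul_smul_comm]
  ext i j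
  simp only [CStarMatrix.sub_apply, CStarMatrix.smul_apply, mul_shiftMat_apply, rowMat_apply,
    shiftMat_apply]
  by_cases hi : i = 0
  · subst hi
    simp only [if_true]
    rw [← polyTail_sub ha j.1 z]
    simp only [Fin.val_zero, (Nat.succ_ne_zero _).symm, if_false, smul_zero, sub_zero]
    split_ifs with h
    · rfl
    · rw [polyTail_eq_zero ha (j := j.1 + 1) (by omega)]
  · simp only [if_neg hi]
    congr 2
    by_cases h : j.1 + 1 < d + 1
    · simp only [dif_pos h, Fin.ext_iff]
    · rw [dif_neg h, if_neg (by omega)]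

/-- The winding number of a polynomial loop of invertibles is given by an idempotent matrix. -/
lemma exists_idempotent_winding_poly {a : ℕ → M} {d : ℕ} (ha : ∀ k, d < k → a k = 0)
    (hu : ∀ t ∈ Icc (0 : ℝ) 1, IsUnit (polyTail a d 0 (circ t))) :
    IsC1Path (fun t => polyTail a d 0 (circ t)) ∧
    ∃ e : Mat M (d + 1), e * e = e ∧ ∀ T : M →L[ℂ] ℂ, (∀ a b, T (a * b) = T (b * a)) →
      winding T (fun t => polyTail a d 0 (circ t)) = 2 * Real.pi * Complex.I * T (matTrace e) := by
  have hP : IsC1Path (fun t => polyTail a d 0 (circ t)) :=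
    ⟨(contDiff_polyTail a d 0).contDiffOn, hu⟩
  refine ⟨hP, ?_⟩
  set G : ℝ → Mat M (d + 1) := fun t => rowMat fun j => polyTail a d j (circ t) with hG
  -- The inverse of G. Both matrices differ from the identity only in the first row, and their (0,0)
  -- entries are the polynomial and its inverse.
  set H : ℝ → Mat M (d + 1) := fun t => rowMat fun j =>
    if j = 0 then Ring.inverse (polyTail a d 0 (circ t)) else
      -(Ring.inverse (polyTail a d 0 (circ t)) * polyTail a d j (circ t)) with hH
  have hGH : ∀ t ∈ Icc (0 : ℝ) 1, G t * H t = 1 ∧ H t * G t = 1 := fun t ht => by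
    have h1 := Ring.mul_inverse_cancel _ (hu t ht)
    have h2 := Ring.inverse_mul_cancel _ (hu t ht)
    constructor
    · rw [← rowMat_one]
      refine rowMat_mul _ _ _ (by simp [h1]) fun j hj => ?_
      simp only [hj.ne', if_false, mul_neg, ← mul_assoc, h1]
      simp
    · rw [← rowMat_one]
      refine rowMat_mul _ _ _ (by simp [h2]) fun j hj => ?_
      simp [hj.ne']
  have hGpath : IsC1Path G := by
    refine ⟨?_, fun t ht => ⟨⟨_, _, (hGH t ht).1, (hGH t ht).2⟩, rfl⟩⟩
    refine contDiffOn_of_entries fun i j => ?_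
    by_cases hi : i = 0
    · simp only [hG, rowMat_apply, if_pos hi]
      exact (contDiff_polyTail a d j).contDiffOn
    · simp only [hG, rowMat_apply, if_neg hi]
      exact contDiffOn_const
  have hwG : ∀ T : M →L[ℂ] ℂ, winding (T.comp (matTraceL M (d + 1))) G
      = winding T (fun t => polyTail a d 0 (circ t)) := fun T => by
    apply intervalIntegral.integral_congr
    rw [uIcc_of_le zero_le_one]
    intro t ht
    have hi : Ring.inverse (G t) = H t :=
      Ring.inverse_unit (⟨_, _, (hGH t ht).1, (hGH t ht).2⟩ : (Mat M (d + 1))ˣ)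
    -- Only the first row of G varies, and the first column of H is zero below the diagonal. The
    -- trace of G'H is therefore the product of the (0,0) entries.
    have key : ∀ D : Mat M (d + 1),
        (∀ i j, HasDerivWithinAt (fun t => G t i j) (D i j) (Icc 0 1) t) →
        matTrace (D * H t) = derivWithin (fun t => polyTail a d 0 (circ t)) (Icc 0 1) t *
          Ring.inverse (polyTail a d 0 (circ t)) := fun D hD => by
      have hD' := fun i j => (hD i j).derivWithin (uniqueDiffOn_unitInterval t ht)
      rw [matTrace, Fin.sum_univ_succ, Finset.sum_eq_zero, add_zero]
      · rw [CStarMatrix.mul_apply, Fin.sum_univ_succ, Finset.sum_eq_zero, add_zero, ← hD']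
        · simp [hG, hH, rowMat_apply]
        · intro k _
          simp [hH, rowMat_apply, Fin.succ_ne_zero]
      · intro i _
        rw [CStarMatrix.mul_apply]
        refine Finset.sum_eq_zero fun k _ => ?_
        rw [← hD']
        simp [hG, rowMat_apply, Fin.succ_ne_zero]
    simp only [ContinuousLinearMap.comp_apply, matTraceL_apply, hi]
    exact congrArg T (key _ fun i j => hGpath.hasDerivWithinAt_clm_comp (entryL i j) ht)
  set N := shiftMat M (d + 1)
  set L : ℝ → Mat M (d + 1) := fun t => G t * (1 - circ t • N) with hL
  have hLeq : ∀ t, L t = rowMat a - circ t • N := fun t => rowMat_polyTail_mul ha (circ t)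
  have hLpath : IsC1Path L := hGpath.mul (isC1Path_one_sub_shift _)
  -- Normalisation at z = 1: with K = L(0), the loop K - (z - 1)N equals K(1 + (z - 1)B) for B =
  -- -K⁻¹N, and the constant factor K does not wind.
  obtain ⟨K, hK⟩ := hLpath.isUnit 0 (by simp)
  rw [hLeq, circ_zero, one_smul] at hK
  set B : Mat M (d + 1) := -(↑K⁻¹ * N) with hB
  have hfac : ∀ t, L t = K * (1 + (circ t - 1) • B) := fun t => by
    rw [hLeq, hB, mul_add, mul_one, mul_smul_comm, mul_neg, Units.mul_inv_cancel_left, hK,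
      sub_smul, one_smul]
    simp only [smul_neg]
    abel
  obtain ⟨hBpath, e, he, hew⟩ := exists_idempotent_winding_eq (B := B) fun t ht => by
    have := hLpath.isUnit t ht
    rw [hfac] at this
    exact (Units.isUnit_units_mul K _).1 this
  refine ⟨e, he, fun T hT => ?_⟩
  have hT' := fun x y => tracial_comp_matTraceL hT (n := d + 1) x y
  rw [← hwG T]
  have h1 : winding (T.comp (matTraceL M (d + 1))) L = winding (T.comp (matTraceL M (d + 1))) G := by
    rw [hL, winding_mul hT' hGpath (isC1Path_one_sub_shift _), winding_one_sub_shift, add_zero]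
  have h2 : L = fun t => (fun _ => (K : Mat M (d + 1))) t * (fun t => 1 + (circ t - 1) • B) t :=
    funext hfac
  rw [← h1, h2, winding_mul hT' (IsC1Path.const K.isUnit) hBpath, winding_const, zero_add, hew]
  simp [matTraceL_apply]

end Linearization

/-! ### Approximation by Laurent polynomials -/

section Laurent

variable {E : Type*} [NormedAddCommGroup E] [NormedSpace ℂ E]

/-- A partition of unity subordinate to the sets where f is within ε of one of finitely many values
reduces vector-valued approximation to scalar functions. -/
lemma exists_partition_approx {X : Type*} [TopologicalSpace X] [CompactSpace X] [T2Space X]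
    (f : C(X, E)) {ε : ℝ} (hε : 0 < ε) :
    ∃ (s : Finset X) (ρ : s → C(X, ℝ)), ∀ x, ‖f x - ∑ i : s, (ρ i x : ℂ) • f i‖ ≤ ε := by
  obtain ⟨s, -, hs⟩ := isCompact_univ.elim_nhds_subcover (fun x => {y | dist (f y) (f x) < ε})
    fun x _ => f.continuous.continuousAt (Metric.ball_mem_nhds _ hε)
  obtain ⟨ρ, hρ⟩ := PartitionOfUnity.exists_isSubordinate (s := univ) isClosed_univ
    (fun i : s => {y | dist (f y) (f i) < ε})
    (fun i => isOpen_lt (f.continuous.dist continuous_const) continuous_const)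
    (fun x hx => by simpa using hs hx)
  refine ⟨s, fun i => ρ i, fun x => ?_⟩
  have h1 : ∑ i : s, (ρ i x : ℝ) = 1 := by
    have := ρ.sum_eq_one (mem_univ x)
    rwa [finsum_eq_sum_of_fintype] at this
  have h2 : f x = ∑ i : s, (ρ i x : ℂ) • f x := by
    rw [← Finset.sum_smul, ← Complex.ofReal_sum, h1]
    simp
  nth_rw 1 [h2]
  rw [← Finset.sum_sub_distrib]
  calc ‖∑ i : s, ((ρ i x : ℂ) • f x - (ρ i x : ℂ) • f i)‖ ≤ ∑ i : s, ρ i x * ε := by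
        refine norm_sum_le_of_le _ fun i _ => ?_
        rw [← smul_sub, norm_smul, Complex.norm_real, Real.norm_of_nonneg (ρ.nonneg i x)]
        by_cases h0 : ρ i x = 0
        · simp [h0]
        · have : x ∈ {y | dist (f y) (f i) < ε} := hρ i (subset_closure h0)
          refine mul_le_mul_of_nonneg_left ?_ (ρ.nonneg i x)
          rw [← dist_eq_norm]
          exact le_of_lt this
    _ = ε := by rw [← Finset.sum_mul, h1, one_mul]

lemma exists_laurent_of_mem_span {q : C(UnitAddCircle, ℂ)}
    (hq : q ∈ Submodule.span ℂ (range (@fourier 1))) (v : E) :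
    ∃ a : ℤ →₀ E, ∀ x, q x • v = a.sum fun n w => fourier n x • w := by
  induction hq using Submodule.span_induction with
  | mem q hq =>
    obtain ⟨n, rfl⟩ := hq
    exact ⟨Finsupp.single n v, fun x => by simp⟩
  | zero => exact ⟨0, fun x => by simp⟩
  | add p q _ _ hp hq =>
    obtain ⟨a, ha⟩ := hp
    obtain ⟨b, hb⟩ := hq
    refine ⟨a + b, fun x => ?_⟩
    rw [Finsupp.sum_add_index' (by simp) (by simp), ← ha, ← hb, ContinuousMap.add_apply, add_smul]
  | smul c q _ hq =>
    obtain ⟨a, ha⟩ := hq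
    refine ⟨c • a, fun x => ?_⟩
    rw [Finsupp.sum_smul_index' (by simp), ContinuousMap.smul_apply, smul_assoc, ha,
      Finsupp.smul_sum]
    simp only [smul_comm c]

/-- Laurent polynomials with coefficients in `E` are dense in the continuous functions from the
circle to `E`. -/
lemma exists_laurent_approx (f : C(UnitAddCircle, E)) {ε : ℝ} (hε : 0 < ε) :
    ∃ a : ℤ →₀ E, ∀ x, ‖f x - a.sum fun n w => fourier n x • w‖ < ε := by
  obtain ⟨s, ρ, hρ⟩ := exists_partition_approx f (show 0 < ε / 2 by positivity)
  set C : ℝ := ∑ i : s, ‖f i‖ with hC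
  have hC0 : 0 ≤ C := Finset.sum_nonneg fun _ _ => norm_nonneg _
  -- The scalar errors are weighted by norms with sum C; the extra 1 avoids division by zero and
  -- keeps the total strictly below ε / 2.
  have hδ : 0 < ε / (2 * (C + 1)) := by positivity
  have h1 : ∀ i : s, ∃ q ∈ Submodule.span ℂ (range (@fourier 1)),
      ∀ x, ‖(ρ i x : ℂ) - q x‖ ≤ ε / (2 * (C + 1)) := fun i => by
    have hd : (⟨fun x => (ρ i x : ℂ), Complex.continuous_ofReal.comp (ρ i).continuous⟩ :
        C(UnitAddCircle, ℂ)) ∈ (Submodule.span ℂ (range (@fourier 1))).topologicalClosure := by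
      rw [span_fourier_closure_eq_top]; trivial
    obtain ⟨q, hq, hqd⟩ := Metric.mem_closure_iff.1 hd _ hδ
    refine ⟨q, hq, fun x => ?_⟩
    rw [dist_eq_norm] at hqd
    exact (ContinuousMap.norm_coe_le_norm _ x).trans hqd.le
  choose q hq hqx using h1
  choose a ha using fun i => exists_laurent_of_mem_span (hq i) (f i)
  refine ⟨∑ i, a i, fun x => ?_⟩
  have h2 : ((∑ i, a i).sum fun n w => fourier n x • w) = ∑ i, q i x • f i := by
    rw [← Finsupp.sum_finsetSum_index (by simp) (by simp)]
    exact Finset.sum_congr rfl fun i _ => (ha i x).symm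
  rw [h2]
  have h3 : ‖∑ i : s, (ρ i x : ℂ) • f i - ∑ i, q i x • f i‖ ≤ ε / (2 * (C + 1)) * C := by
    rw [← Finset.sum_sub_distrib, hC, Finset.mul_sum]
    refine norm_sum_le_of_le _ fun i _ => ?_
    rw [← sub_smul, norm_smul]
    exact mul_le_mul_of_nonneg_right (hqx i x) (norm_nonneg _)
  have h4 : ε / (2 * (C + 1)) * C < ε / 2 := by
    rw [div_mul_eq_mul_div, div_lt_div_iff₀ (by positivity) two_pos]
    nlinarith
  calc ‖f x - ∑ i, q i x • f i‖
      ≤ ‖f x - ∑ i : s, (ρ i x : ℂ) • f i‖ + ‖∑ i : s, (ρ i x : ℂ) • f i - ∑ i, q i x • f i‖ := by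
        rw [← sub_add_sub_cancel]; exact norm_add_le _ _
    _ < ε := by linarith [hρ x]

/-- A Laurent approximation multiplied by a large power of z becomes a polynomial. Since |z| = 1,
the error does not change. -/
lemma exists_polyTail_approx {M : Type*} [CStarAlgebra M] [PartialOrder M] [StarOrderedRing M]
    {ξ : ℝ → M} (hξ : ContinuousOn ξ (Icc 0 1)) (h01 : ξ 0 = ξ 1) {ε : ℝ} (hε : 0 < ε) :
    ∃ (N d : ℕ) (a : ℕ → M), (∀ k, d < k → a k = 0) ∧
      ∀ t ∈ Icc (0 : ℝ) 1, ‖circ t ^ N • ξ t - polyTail a d 0 (circ t)‖ < ε := by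
  have hcont := AddCircle.liftIco_zero_continuous (p := (1 : ℝ)) h01 hξ
  obtain ⟨a, ha⟩ := exists_laurent_approx (⟨_, hcont⟩ : C(UnitAddCircle, M)) hε
  have hf : ∀ t ∈ Icc (0 : ℝ) 1, ‖ξ t - a.sum fun n w => circ t ^ n • w‖ < ε := by
    have key : ∀ t ∈ Ico (0 : ℝ) 1, ‖ξ t - a.sum fun n w => circ t ^ n • w‖ < ε := fun t ht => by
      have := ha (t : UnitAddCircle)
      rw [ContinuousMap.coe_mk, AddCircle.liftIco_zero_coe_apply ht] at this
      simp only [fourier_coe_apply] at this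
      simpa [circ_zpow] using this
    intro t ht
    rcases ht.2.eq_or_lt with rfl | h1
    · have := key 0 (by simp)
      rwa [circ_zero, ← circ_one, h01] at this
    · exact key t ⟨ht.1, h1⟩
  obtain ⟨N, hN⟩ : ∃ N : ℕ, ∀ n ∈ a.support, -(N : ℤ) ≤ n ∧ n ≤ N := by
    refine ⟨a.support.sup fun n => n.natAbs, fun n hn => ?_⟩
    have : n.natAbs ≤ a.support.sup fun n => n.natAbs :=
      Finset.le_sup (f := fun n : ℤ => n.natAbs) hn
    omega
  refine ⟨N, 2 * N, fun k => a ((k : ℤ) - N), fun k hk => ?_, fun t ht => ?_⟩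
  · by_contra h
    have := hN _ (Finsupp.mem_support_iff.2 h)
    omega
  · have h1 : polyTail (fun k => a ((k : ℤ) - N)) (2 * N) 0 (circ t)
        = circ t ^ N • a.sum fun n w => circ t ^ n • w := by
      rw [Finsupp.sum, Finset.smul_sum, polyTail]
      refine (Finset.sum_bij_ne_zero (fun (n : ℤ) _ _ => (n + N).toNat) ?_ ?_ ?_ ?_).symm
      · intro n hn _
        have := hN n hn
        rw [Finset.mem_range]; omega
      · intro n hn _ m hm _ h
        have := hN n hn
        have := hN m hm
        omega
      · intro k _ hk0
        refine ⟨(k : ℤ) - N, ?_, ?_, by omega⟩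
        · rw [Finsupp.mem_support_iff]
          intro h
          simp [h] at hk0
        · intro h
          apply hk0
          rw [smul_eq_zero_iff_right (pow_ne_zero _ (circ_ne_zero t)),
            smul_eq_zero_iff_right (zpow_ne_zero _ (circ_ne_zero t))] at h
          simp [h]
      · intro n hn _
        have := hN n hn
        have h2 : ((0 + (n + N).toNat : ℕ) : ℤ) - N = n := by omega
        rw [h2, smul_smul, ← zpow_natCast, ← zpow_natCast, ← zpow_add₀ (circ_ne_zero t)]
        congr 2
        omega
    rw [h1, ← smul_sub, norm_smul, norm_pow, norm_circ, one_pow, one_mul]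
    exact hf t ht

/-- Every loop of unitaries has the same winding numbers as the difference of two loops
`t ↦ exp(2πitp)` with `p` a projection in a matrix algebra. -/
theorem exists_projection_winding {M : Type*} [CStarAlgebra M] [PartialOrder M]
    [StarOrderedRing M] {ξ : ℝ → M} (hξ : ContDiffOn ℝ 1 ξ (Icc 0 1))
    (hu : ∀ t ∈ Icc (0 : ℝ) 1, ξ t ∈ unitary M) (h01 : ξ 0 = ξ 1) :
    ∃ (N d : ℕ) (p : Mat M d), IsStarProjection p ∧
      ∀ T : M →L[ℂ] ℂ, (∀ a b, T (a * b) = T (b * a)) →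
        winding T ξ = 2 * Real.pi * Complex.I * (T (matTrace p) - N * T 1) := by
  obtain ⟨N, d, a, ha, hclose⟩ := exists_polyTail_approx hξ.continuousOn h01 one_pos
  have hpath : IsC1Path ξ :=
    ⟨hξ, fun t ht => ⟨⟨ξ t, star (ξ t), (hu t ht).2, (hu t ht).1⟩, rfl⟩⟩
  set Z : ℝ → M := fun t => circ t ^ N • (1 : M) with hZ
  have hZu : ∀ t, Z t * star (Z t) = 1 ∧ star (Z t) * Z t = 1 := fun t => by
    have h1 : circ t ^ N * star (circ t ^ N) = 1 := by
      rw [RCLike.star_def, RCLike.mul_conj, norm_pow, norm_circ]; simp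
    simp only [hZ, star_smul, star_one, smul_mul_smul_comm, mul_one, h1, mul_comm (star _), one_smul,
      and_self]
  have hZpath : IsC1Path Z :=
    ⟨(((contDiff_circ.of_le (by simp)).pow N).smul contDiff_const).contDiffOn,
      fun t _ => ⟨⟨Z t, star (Z t), (hZu t).1, (hZu t).2⟩, rfl⟩⟩
  have hZw : ∀ T : M →L[ℂ] ℂ, winding T Z = 2 * Real.pi * Complex.I * (N * T 1) := fun T => by
    have hd : ∀ t ∈ Icc (0 : ℝ) 1,
        HasDerivWithinAt Z ((2 * Real.pi * Complex.I * N) • Z t) (Icc 0 1) t := fun t _ => by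
      have h1 := (((hasDerivAt_circ t).fun_pow N).smul_const (1 : M)).hasDerivWithinAt
        (s := Icc 0 1)
      convert! h1 using 1
      rw [hZ, smul_smul]
      congr 1
      rcases N with _ | N
      · simp
      · simp only [Nat.add_sub_cancel]; ring
    rw [winding_eq_of_hasDerivWithinAt T hd, intervalIntegral.integral_congr
      (g := fun _ => 2 * Real.pi * Complex.I * (N * T 1))]
    · simp
    · intro t _
      have hi : Ring.inverse (Z t) = star (Z t) :=
        Ring.inverse_unit (⟨_, _, (hZu t).1, (hZu t).2⟩ : Mˣ)
      simp only [hi, smul_mul_assoc, (hZu t).1, map_smul, smul_eq_mul]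
      ring
  have hη : IsC1Path fun t => Z t * ξ t := hZpath.mul hpath
  have hηu : ∀ t ∈ Icc (0 : ℝ) 1, Z t * ξ t ∈ unitary M := fun t ht =>
    mul_mem (Unitary.mem_iff.2 ⟨(hZu t).2, (hZu t).1⟩) (hu t ht)
  -- The polynomial loop factors as Z·ξ·γ with γ a loop within distance 1 of the identity. Its
  -- winding number is thus that of ξ plus 2πi·N·T(1).
  set γ : ℝ → M := fun t => star (Z t * ξ t) * polyTail a d 0 (circ t) with hγ
  have hPγ : EqOn (fun t => (Z t * ξ t) * γ t) (fun t => polyTail a d 0 (circ t)) (Icc 0 1) :=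
    fun t ht => by
      simp only [hγ]
      rw [← mul_assoc, (hηu t ht).2, one_mul]
  have hγ1 : ∀ t ∈ Icc (0 : ℝ) 1, ‖1 - γ t‖ < 1 := fun t ht => by
    have h1 : 1 - γ t = star (Z t * ξ t) * (circ t ^ N • ξ t - polyTail a d 0 (circ t)) := by
      have h2 : circ t ^ N • ξ t = Z t * ξ t := by simp [hZ]
      rw [mul_sub, h2, (hηu t ht).1]
    have h3 : star (Z t * ξ t) ∈ unitary M := Unitary.star_mem (hηu t ht)
    rw [h1, CStarRing.norm_mem_unitary_mul _ h3]
    exact hclose t ht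
  have hγpath : IsC1Path γ := by
    refine ⟨ContDiffOn.mul ?_ (contDiff_polyTail a d 0).contDiffOn, fun t ht => ?_⟩
    · exact (starL' ℝ : M ≃L[ℝ] M).toContinuousLinearMap.contDiff.comp_contDiffOn hη.contDiffOn
    · have := isUnit_one_sub_of_norm_lt_one (hγ1 t ht)
      rwa [sub_sub_cancel] at this
  have hγ01 : γ 0 = γ 1 := by simp only [hγ, hZ, circ_zero, circ_one, h01]
  obtain ⟨-, e, he, hew⟩ := exists_idempotent_winding_poly ha fun t ht => by
    have := (hη.mul hγpath).isUnit t ht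
    rwa [show Z t * ξ t * γ t = _ from hPγ ht] at this
  obtain ⟨p, hp, hep, hpe⟩ := exists_isStarProjection_of_idempotent he
  refine ⟨N, d + 1, p, hp, fun T hT => ?_⟩
  have h1 := hew T hT
  rw [← winding_congr T hPγ, winding_mul hT hη hγpath, winding_mul hT hZpath hpath, hZw,
    winding_eq_zero_of_norm_lt hT hγpath hγ1 hγ01] at h1
  -- From ep = p and pe = e, traciality gives T(tr p) = T(tr ep) = T(tr pe) = T(tr e).
  have h2 : T (matTrace p) = T (matTrace e) := by
    rw [← hep, matTrace_mul_comm hT, hpe]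
  rw [h2]
  linear_combination h1

end Laurent

/-! ### Smooth paths of unitaries -/

section Paths

variable {A : Type u} [CStarAlgebra A] [PartialOrder A] [StarOrderedRing A]
  {B : Type v} [CStarAlgebra B] [PartialOrder B] [StarOrderedRing B]

/-- A *-homomorphism of C*-algebras as a continuous linear map. -/
def homL {R S : Type*} [CStarAlgebra R] [CStarAlgebra S] (f : R →⋆ₙₐ[ℂ] S) : R →L[ℂ] S where
  toFun := f
  map_add' := map_add f
  map_smul' := map_smul f
  cont := AddMonoidHomClass.continuous_of_bound f 1 fun x => by
    simpa using NonUnitalStarAlgHom.norm_apply_le f x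

lemma homL_apply {R S : Type*} [CStarAlgebra R] [CStarAlgebra S] (f : R →⋆ₙₐ[ℂ] S) (x : R) :
    homL f x = f x := rfl

/-- The image of a path of unitaries under a *-homomorphism. -/
def SmoothPath.map {n m : ℕ} (f : Mat A n →⋆ₙₐ[ℂ] Mat B m) (ξ : SmoothPath A n) :
    SmoothPath B m where
  toFun t := f (ξ.toFun t) + (1 - f 1)
  contDiffOn := (((homL f).restrictScalars ℝ).contDiff.comp_contDiffOn ξ.contDiffOn).add
    contDiffOn_const
  mem_unitary t ht := (unitaryMap f ⟨ξ.toFun t, ξ.mem_unitary t ht⟩).2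
  map_zero := by rw [ξ.map_zero]; abel

/-- The pointwise product of two paths. -/
def SmoothPath.mul {n : ℕ} (ξ η : SmoothPath A n) : SmoothPath A n where
  toFun t := ξ.toFun t * η.toFun t
  contDiffOn := ξ.contDiffOn.mul η.contDiffOn
  mem_unitary t ht := mul_mem (ξ.mem_unitary t ht) (η.mem_unitary t ht)
  map_zero := by rw [ξ.map_zero, η.map_zero, one_mul]

/-- The pointwise inverse of a path. -/
def SmoothPath.inv {n : ℕ} (ξ : SmoothPath A n) : SmoothPath A n where
  toFun t := star (ξ.toFun t)
  contDiffOn := (starL' ℝ : Mat A n ≃L[ℝ] Mat A n).toContinuousLinearMap.contDiff.comp_contDiffOn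
    ξ.contDiffOn
  mem_unitary t ht := Unitary.star_mem (ξ.mem_unitary t ht)
  map_zero := by rw [ξ.map_zero, star_one]

/-- The constant path. -/
def SmoothPath.one (A : Type u) [CStarAlgebra A] [PartialOrder A] [StarOrderedRing A] (n : ℕ) :
    SmoothPath A n where
  toFun _ := 1
  contDiffOn := contDiffOn_const
  mem_unitary _ _ := one_mem _
  map_zero := rfl

lemma SmoothPath.endpoint_mul {n : ℕ} (ξ η : SmoothPath A n) :
    (ξ.mul η).endpoint = ξ.endpoint * η.endpoint := by
  rw [endpoint, endpoint, endpoint, ← map_mul]; rfl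

lemma SmoothPath.endpoint_one (n : ℕ) : (SmoothPath.one A n).endpoint = 1 :=
  map_one (UInf.of A n)

lemma SmoothPath.endpoint_map {n m : ℕ} (f : Mat A n →⋆ₙₐ[ℂ] Mat B m) (ξ : SmoothPath A n) :
    (ξ.map f).endpoint
      = UInf.of B m (unitaryMap f ⟨ξ.toFun 1, ξ.mem_unitary 1 (by simp)⟩) := rfl

lemma SmoothPath.endpoint_map_mapₙₐ {n : ℕ} (φ : A →⋆ₙₐ[ℂ] B) (ξ : SmoothPath A n) :
    (ξ.map (CStarMatrix.mapₙₐ φ)).endpoint = UInfMap φ ξ.endpoint := rfl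

lemma SmoothPath.endpoint_map_corner {n m : ℕ} (h : n ≤ m) (ξ : SmoothPath A n) :
    (ξ.map (corner h)).endpoint = ξ.endpoint :=
  UInf.of_pad A h ⟨ξ.toFun 1, ξ.mem_unitary 1 (by simp)⟩

lemma SmoothPath.isC1Path {n : ℕ} (ξ : SmoothPath A n) : IsC1Path ξ.toFun :=
  ⟨ξ.contDiffOn.of_le (by simp), fun t ht => ⟨⟨ξ.toFun t, star (ξ.toFun t),
    (ξ.mem_unitary t ht).2, (ξ.mem_unitary t ht).1⟩, rfl⟩⟩

lemma SmoothPath.inverse {n : ℕ} (ξ : SmoothPath A n) {t : ℝ} (ht : t ∈ Icc (0 : ℝ) 1) :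
    Ring.inverse (ξ.toFun t) = star (ξ.toFun t) :=
  Ring.inverse_unit (⟨ξ.toFun t, star (ξ.toFun t), (ξ.mem_unitary t ht).2,
    (ξ.mem_unitary t ht).1⟩ : (Mat A n)ˣ)

/-- The element `(1 / 2πi) ∫₀¹ Tr(ξ'(t) ξ(t)⁻¹) dt` of `A`. -/
def SmoothPath.logDet {n : ℕ} (ξ : SmoothPath A n) : A :=
  (2 * (Real.pi : ℂ) * Complex.I)⁻¹ •
    ∫ t in (0 : ℝ)..1, matTrace (derivWithin ξ.toFun (Icc 0 1) t * star (ξ.toFun t))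

lemma SmoothPath.preDet_eq {n : ℕ} (ξ : SmoothPath A n) : ξ.preDet = ev ξ.logDet := rfl

lemma two_pi_I_ne_zero : (2 * (Real.pi : ℂ) * Complex.I) ≠ 0 := Complex.two_pi_I_ne_zero

lemma SmoothPath.winding_eq {n : ℕ} (ξ : SmoothPath A n) (T : A →L[ℂ] ℂ) :
    winding (T.comp (matTraceL A n)) ξ.toFun = 2 * Real.pi * Complex.I * T ξ.logDet := by
  have hc : ContinuousOn (fun t =>
      matTraceL A n (derivWithin ξ.toFun (Icc 0 1) t * Ring.inverse (ξ.toFun t))) (Icc 0 1) :=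
    (matTraceL A n).continuous.comp_continuousOn ξ.isC1Path.continuousOn_logDeriv
  have h1 : ∫ t in (0 : ℝ)..1, matTrace (derivWithin ξ.toFun (Icc 0 1) t * star (ξ.toFun t))
      = ∫ t in (0 : ℝ)..1,
        matTraceL A n (derivWithin ξ.toFun (Icc 0 1) t * Ring.inverse (ξ.toFun t)) := by
    apply intervalIntegral.integral_congr
    rw [uIcc_of_le zero_le_one]
    intro t ht
    simp only [ξ.inverse ht, matTraceL_apply]
  rw [logDet, map_smul, smul_eq_mul, mul_inv_cancel_left₀ two_pi_I_ne_zero, h1,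
    ← T.intervalIntegral_comp_comm]
  · rfl
  · apply ContinuousOn.intervalIntegrable
    rw [uIcc_of_le zero_le_one]
    exact hc

lemma SmoothPath.apply_logDet_mul {T : A →L[ℂ] ℂ} (hT : ∀ a b, T (a * b) = T (b * a)) {n : ℕ}
    (ξ η : SmoothPath A n) : T (ξ.mul η).logDet = T ξ.logDet + T η.logDet := by
  apply mul_left_cancel₀ two_pi_I_ne_zero
  rw [mul_add, ← winding_eq, ← winding_eq, ← winding_eq,
    ← winding_mul (tracial_comp_matTraceL hT) ξ.isC1Path η.isC1Path]
  rfl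

lemma SmoothPath.apply_logDet_of_eq_one {n : ℕ} {ξ : SmoothPath A n}
    (h : ∀ t ∈ Icc (0 : ℝ) 1, ξ.toFun t = 1) (T : A →L[ℂ] ℂ) : T ξ.logDet = 0 := by
  apply mul_left_cancel₀ two_pi_I_ne_zero
  rw [← winding_eq, mul_zero, winding_congr _ (η := fun _ => 1), winding_const]
  exact h

lemma SmoothPath.apply_logDet_inv {T : A →L[ℂ] ℂ} (hT : ∀ a b, T (a * b) = T (b * a)) {n : ℕ}
    (ξ : SmoothPath A n) : T ξ.inv.logDet = -T ξ.logDet := by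
  have h1 : T (ξ.mul ξ.inv).logDet = 0 :=
    apply_logDet_of_eq_one (fun t ht => (ξ.mem_unitary t ht).2) T
  rw [apply_logDet_mul hT] at h1
  exact eq_neg_of_add_eq_zero_right h1

/-- The added corner 1 - f(1) is constant and annihilated by the range of f, so it does not enter
the logarithmic derivative. -/
lemma SmoothPath.winding_map {n m : ℕ} (f : Mat A n →⋆ₙₐ[ℂ] Mat B m) (ξ : SmoothPath A n)
    (T : Mat B m →L[ℂ] ℂ) : winding T (ξ.map f).toFun = winding (T.comp (homL f)) ξ.toFun := by
  rw [winding_eq_of_hasDerivWithinAt T (γ := (ξ.map f).toFun) fun t ht =>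
    (ξ.isC1Path.hasDerivWithinAt_clm_comp (homL f) ht).add_const (1 - f 1)]
  apply intervalIntegral.integral_congr
  rw [uIcc_of_le zero_le_one]
  intro t ht
  have e1 : ∀ x : Mat A n, f x * f 1 = f x := fun x => by rw [← map_mul, mul_one]
  have hi : Ring.inverse (f (ξ.toFun t) + (1 - f 1)) = star (f (ξ.toFun t) + (1 - f 1)) :=
    (ξ.map f).inverse ht
  have hs : star (f (ξ.toFun t) + (1 - f 1)) = f (star (ξ.toFun t)) + (1 - f 1) := by
    simp [← map_star]
  have hm : (ξ.map f).toFun t = f (ξ.toFun t) + (1 - f 1) := rfl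
  simp only [hm, hi, hs, ξ.inverse ht, ContinuousLinearMap.comp_apply, homL_apply]
  rw [mul_add, mul_sub, mul_one, e1, sub_self, add_zero, map_mul f]

lemma matTrace_corner {n m : ℕ} (h : n ≤ m) (a : Mat A n) : matTrace (corner h a) = matTrace a := by
  obtain ⟨k, rfl⟩ := Nat.exists_eq_add_of_le h
  simp [matTrace, corner_apply, Fin.sum_univ_add]

lemma SmoothPath.apply_logDet_map_corner {n m : ℕ} (h : n ≤ m) (ξ : SmoothPath A n)
    (T : A →L[ℂ] ℂ) : T (ξ.map (corner h)).logDet = T ξ.logDet := by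
  apply mul_left_cancel₀ two_pi_I_ne_zero
  rw [← winding_eq, ← winding_eq, winding_map]
  congr 1
  ext a
  simp [matTraceL_apply, homL_apply, matTrace_corner]

lemma SmoothPath.apply_logDet_map {n : ℕ} (φ : A →⋆ₙₐ[ℂ] B) (ξ : SmoothPath A n)
    (T : B →L[ℂ] ℂ) : T (ξ.map (CStarMatrix.mapₙₐ φ)).logDet = T (φ ξ.logDet) := by
  apply mul_left_cancel₀ two_pi_I_ne_zero
  rw [← winding_eq, winding_map]
  have := ξ.winding_eq (T.comp (homL φ))
  rw [ContinuousLinearMap.comp_apply, homL_apply] at this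
  rw [← this]
  congr 1
  ext a
  simp [matTraceL_apply, homL_apply, matTrace]

/-- Conjugation by a unitary, as a *-homomorphism. -/
def conjHom {M : Type*} [CStarAlgebra M] (w : unitary M) : M →⋆ₙₐ[ℂ] M where
  toFun a := w * a * star (w : M)
  map_smul' c a := by simp
  map_zero' := by simp
  map_add' a b := by simp [mul_add, add_mul]
  map_mul' a b := by
    have := (Unitary.mem_iff.1 w.2).1
    simp only [mul_assoc]
    rw [← mul_assoc (star (w : M)) (w : M), this, one_mul]
  map_star' a := by simp [mul_assoc]

lemma conjHom_apply {M : Type*} [CStarAlgebra M] (w : unitary M) (a : M) :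
    conjHom w a = w * a * star (w : M) := rfl

lemma conjHom_one {M : Type*} [CStarAlgebra M] (w : unitary M) : conjHom w 1 = 1 := by
  rw [conjHom_apply, mul_one, (Unitary.mem_iff.1 w.2).2]

lemma unitaryMap_conjHom {M : Type*} [CStarAlgebra M] (w x : unitary M) : unitaryMap (conjHom w) x = w * x * w⁻¹ := by
  ext1
  rw [coe_unitaryMap, conjHom_one, sub_self, add_zero]
  rfl

lemma SmoothPath.endpoint_map_conjHom {n : ℕ} (w : U A n) (ξ : SmoothPath A n) :
    (ξ.map (conjHom w)).endpoint = UInf.of A n w * ξ.endpoint * (UInf.of A n w)⁻¹ := by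
  rw [endpoint_map, unitaryMap_conjHom, map_mul, map_mul, map_inv]; rfl

lemma SmoothPath.apply_logDet_map_conjHom {T : A →L[ℂ] ℂ} (hT : ∀ a b, T (a * b) = T (b * a))
    {n : ℕ} (w : U A n) (ξ : SmoothPath A n) : T (ξ.map (conjHom w)).logDet = T ξ.logDet := by
  apply mul_left_cancel₀ two_pi_I_ne_zero
  rw [← winding_eq, ← winding_eq, winding_map]
  congr 1
  ext a
  rw [ContinuousLinearMap.comp_apply, homL_apply, conjHom_apply, tracial_comp_matTraceL hT,
    ← mul_assoc, (Unitary.mem_iff.1 w.2).1, one_mul]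

end Paths

/-! ### Exponentials -/

section Exponentials

lemma map_pow_of_ne_zero {R S : Type*} [CStarAlgebra R] [CStarAlgebra S] (f : R →⋆ₙₐ[ℂ] S)
    (x : R) {n : ℕ} (hn : n ≠ 0) : f (x ^ n) = f x ^ n := by
  induction n with
  | zero => exact absurd rfl hn
  | succ n ih =>
    rcases eq_or_ne n 0 with rfl | h
    · simp
    · rw [pow_succ, pow_succ, map_mul, ih h]

/-- *-homomorphisms commute with exponentials. -/
lemma map_exp_add {R S : Type*} [CStarAlgebra R] [CStarAlgebra S] (f : R →⋆ₙₐ[ℂ] S) (x : R) :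
    f (NormedSpace.exp x) + (1 - f 1) = NormedSpace.exp (f x) := by
  have h1 := (NormedSpace.exp_series_hasSum_exp' (𝕂 := ℂ) x).mapL (homL f)
  have h2 := NormedSpace.exp_series_hasSum_exp' (𝕂 := ℂ) (f x)
  -- The two exponential series differ only at n = 0, where one has f(1) and the other 1.
  have h3 : HasSum (fun n : ℕ => if n = 0 then 1 - f 1 else 0) (1 - f 1) :=
    hasSum_ite_eq 0 (1 - f 1)
  refine (h1.add h3).unique ?_
  convert! h2 using 2 with n
  rcases eq_or_ne n 0 with rfl | hn
  · simp [homL_apply]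
  · rw [if_neg hn, add_zero, map_smul, homL_apply, map_pow_of_ne_zero f x hn]

end Exponentials

/-! ### The determinant is well defined -/

section Determinant

variable {A : Type u} [CStarAlgebra A] [PartialOrder A] [StarOrderedRing A]
  {B : Type v} [CStarAlgebra B] [PartialOrder B] [StarOrderedRing B]

lemma AffT.ext {f g : AffT A} (h : ∀ τ, f.1 τ = g.1 τ) : f = g :=
  Subtype.ext (BoundedContinuousFunction.ext h)

/-- A tracial state as a continuous linear functional. -/
def traceL (τ : tracialStates A) : A →L[ℂ] ℂ := WeakDual.toStrongDual τ.1

lemma traceL_mul_comm (τ : tracialStates A) (a b : A) : traceL τ (a * b) = traceL τ (b * a) :=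
  τ.2.2.2 a b

lemma ev_apply (a : A) (τ : tracialStates A) : (ev a).1 τ = (traceL τ a).re := rfl

lemma AffT.add_apply (f g : AffT A) (τ : tracialStates A) : (f + g).1 τ = f.1 τ + g.1 τ := rfl

/-- `ev` as an additive homomorphism. -/
def evHom (A : Type u) [CStarAlgebra A] [PartialOrder A] [StarOrderedRing A] : A →+ AffT A :=
  AddMonoidHom.mk' ev fun a b => AffT.ext fun τ => by
    rw [AffT.add_apply, ev_apply, ev_apply, ev_apply, map_add, Complex.add_re]

lemma evHom_apply (a : A) : evHom A a = ev a := rfl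

lemma ev_congr {a b : A} (h : ∀ τ : tracialStates A, traceL τ a = traceL τ b) : ev a = ev b :=
  AffT.ext fun τ => by rw [ev_apply, ev_apply, h]

/-- The quotient map `Aff T_1(A) → H(A)`. -/
def toHHom (A : Type u) [CStarAlgebra A] [PartialOrder A] [StarOrderedRing A] : AffT A →+ H A :=
  QuotientAddGroup.mk' (K0bar A)

lemma toHHom_apply (f : AffT A) : toHHom A f = toH f := rfl

lemma toHHom_eq_zero {f : AffT A} : toHHom A f = 0 ↔ f ∈ K0bar A :=
  QuotientAddGroup.eq_zero_iff f

/-- The matrix over `A` obtained from a matrix of matrices over `A`. -/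
def flatten {k d : ℕ} (p : Mat (Mat A k) d) : Mat A (d * k) :=
  CStarMatrix.ofMatrix fun i j =>
    p (finProdFinEquiv.symm i).1 (finProdFinEquiv.symm j).1
      (finProdFinEquiv.symm i).2 (finProdFinEquiv.symm j).2

lemma flatten_apply {k d : ℕ} (p : Mat (Mat A k) d) (i j : Fin (d * k)) :
    flatten p i j = p (finProdFinEquiv.symm i).1 (finProdFinEquiv.symm j).1
      (finProdFinEquiv.symm i).2 (finProdFinEquiv.symm j).2 := rfl

lemma sum_mat_apply {k : ℕ} {ι : Type*} (s : Finset ι) (f : ι → Mat A k) (i j : Fin k) :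
    (∑ x ∈ s, f x) i j = ∑ x ∈ s, f x i j := by
  change Matrix.of.symm (CStarMatrix.ofMatrix.symm (∑ x ∈ s, f x)) i j = _
  exact map_sum (entryL (A := A) i j) f s

lemma flatten_mul {k d : ℕ} (p q : Mat (Mat A k) d) : flatten (p * q) = flatten p * flatten q := by
  ext i j
  rw [CStarMatrix.mul_apply, flatten_apply, CStarMatrix.mul_apply, sum_mat_apply,
    ← finProdFinEquiv.sum_comp, Fintype.sum_prod_type]
  simp [flatten_apply, CStarMatrix.mul_apply]

lemma flatten_star {k d : ℕ} (p : Mat (Mat A k) d) : flatten (star p) = star (flatten p) := by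
  ext i j
  simp [flatten_apply, CStarMatrix.star_apply]

lemma matTrace_flatten {k d : ℕ} (p : Mat (Mat A k) d) :
    matTrace (flatten p) = matTrace (matTrace p) := by
  rw [matTrace, ← finProdFinEquiv.sum_comp, Fintype.sum_prod_type, Finset.sum_comm]
  simp [flatten_apply, matTrace, sum_mat_apply]

lemma isStarProjection_flatten {k d : ℕ} {p : Mat (Mat A k) d} (hp : IsStarProjection p) :
    IsStarProjection (flatten p) :=
  ⟨by rw [IsIdempotentElem, ← flatten_mul, hp.1.eq],
    by rw [IsSelfAdjoint, ← flatten_star, hp.2.star_eq]⟩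

lemma ev_matTrace_mem_K0image {n : ℕ} {p : Mat A n} (hp : IsStarProjection p) :
    ev (matTrace p) ∈ K0image A :=
  AddSubgroup.subset_closure ⟨n, p, hp, rfl⟩

/-- The projection given by `exists_projection_winding` is a matrix over M_n(A); it is flattened to
a matrix over A with the same total trace. -/
lemma SmoothPath.preDet_mem_of_loop {n : ℕ} (ξ : SmoothPath A n) (h : ξ.toFun 1 = 1) :
    ξ.preDet ∈ K0image A := by
  obtain ⟨N, d, p, hp, hT⟩ := exists_projection_winding (ξ.contDiffOn.of_le (by simp))
    ξ.mem_unitary (ξ.map_zero.trans h.symm)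
  have h1 : ξ.preDet = ev (matTrace (flatten p)) - N • ev (matTrace (1 : Mat A n)) := by
    rw [preDet_eq, ← evHom_apply, ← evHom_apply, ← evHom_apply, ← map_nsmul, ← map_sub]
    refine ev_congr fun τ => ?_
    apply mul_left_cancel₀ two_pi_I_ne_zero
    rw [← winding_eq, hT _ (tracial_comp_matTraceL (traceL_mul_comm τ)), matTrace_flatten,
      map_sub, map_nsmul, nsmul_eq_mul]
    simp only [ContinuousLinearMap.comp_apply, matTraceL_apply]
  rw [h1]
  exact sub_mem (ev_matTrace_mem_K0image (isStarProjection_flatten hp))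
    (nsmul_mem (ev_matTrace_mem_K0image (.one _)) N)

lemma SmoothPath.preDet_map_corner {n m : ℕ} (h : n ≤ m) (ξ : SmoothPath A n) :
    (ξ.map (corner h)).preDet = ξ.preDet :=
  ev_congr fun τ => ξ.apply_logDet_map_corner h (traceL τ)

lemma SmoothPath.preDet_mul {n : ℕ} (ξ η : SmoothPath A n) :
    (ξ.mul η).preDet = ξ.preDet + η.preDet := by
  rw [preDet_eq, preDet_eq, preDet_eq, ← evHom_apply ξ.logDet, ← evHom_apply η.logDet, ← map_add]
  exact ev_congr fun τ => by rw [apply_logDet_mul (traceL_mul_comm τ), map_add]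

lemma SmoothPath.preDet_inv {n : ℕ} (ξ : SmoothPath A n) : ξ.inv.preDet = -ξ.preDet := by
  rw [preDet_eq, preDet_eq, ← evHom_apply ξ.logDet, ← map_neg]
  exact ev_congr fun τ => by rw [apply_logDet_inv (traceL_mul_comm τ), map_neg]

lemma UInf.of_eq_of {n m : ℕ} {x : U A n} {y : U A m} (h : UInf.of A n x = UInf.of A m y) :
    ∃ (k : ℕ) (hn : n ≤ k) (hm : m ≤ k), pad A n k hn x = pad A m k hm y :=
  Quotient.exact (s := DirectLimit.setoid (pad A)) h

/-- In a common matrix size, the quotient of the two paths is a loop. -/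
lemma SmoothPath.preDet_sub_mem {n m : ℕ} (ξ : SmoothPath A n) (η : SmoothPath A m)
    (h : ξ.endpoint = η.endpoint) : ξ.preDet - η.preDet ∈ K0image A := by
  obtain ⟨k, hn, hm, hk⟩ := UInf.of_eq_of h
  have hk' : (ξ.map (corner hn)).toFun 1 = (η.map (corner hm)).toFun 1 := congrArg Subtype.val hk
  rw [← ξ.preDet_map_corner hn, ← η.preDet_map_corner hm, sub_eq_add_neg, ← preDet_inv,
    ← preDet_mul]
  apply preDet_mem_of_loop
  change (ξ.map (corner hn)).toFun 1 * star ((η.map (corner hm)).toFun 1) = 1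
  rw [hk']
  exact ((η.map (corner hm)).mem_unitary 1 (by simp)).2

/-- Independence of the chosen path: any two choices differ by an element of the image of K_0, which
dies in H(A). -/
lemma detBar_endpoint {n : ℕ} (ξ : SmoothPath A n) : detBar ξ.endpoint = toH ξ.preDet := by
  have h : ∃ η : Σ n, SmoothPath A n, η.2.endpoint = ξ.endpoint := ⟨⟨n, ξ⟩, rfl⟩
  rw [detBar, dif_pos h, ← toHHom_apply, ← toHHom_apply, ← sub_eq_zero, ← map_sub, toHHom_eq_zero]
  exact (K0image A).le_topologicalClosure (SmoothPath.preDet_sub_mem _ _ h.choose_spec)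

/-! ### Exponentials and the identity component -/

open selfAdjoint

lemma unitaryMap_expUnitary {R S : Type*} [CStarAlgebra R] [CStarAlgebra S] (f : R →⋆ₙₐ[ℂ] S)
    (h : selfAdjoint R) :
    unitaryMap f (expUnitary h) = expUnitary ⟨f h, h.2.map f⟩ := by
  ext1
  rw [coe_unitaryMap, expUnitary_coe, expUnitary_coe, map_exp_add, map_smul]

lemma contDiff_exp_smul {M : Type*} [CStarAlgebra M] (x : M) :
    ContDiff ℝ ∞ fun t : ℝ => NormedSpace.exp ((t : ℂ) • x) := by
  have h1 : ContDiff ℂ ∞ (NormedSpace.exp : M → M) :=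
    contDiffOn_univ.1 (AnalyticOnNhd.contDiffOn (s := univ)
      (fun x _ => NormedSpace.exp_analytic (𝕂 := ℂ) x) uniqueDiffOn_univ)
  have h2 : ContDiff ℂ ∞ fun z : ℂ => NormedSpace.exp (z • x) :=
    h1.comp (contDiff_id.smul contDiff_const)
  exact h2.restrict_scalars ℝ |>.comp Complex.ofRealCLM.contDiff

lemma hasDerivAt_exp_smul {M : Type*} [CStarAlgebra M] (x : M) (t : ℝ) :
    HasDerivAt (fun t : ℝ => NormedSpace.exp ((t : ℂ) • x))
      (x * NormedSpace.exp ((t : ℂ) • x)) t := by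
  simpa [Function.comp_def] using
    (hasDerivAt_exp_smul_const' (𝕂 := ℂ) x (t : ℂ)).scomp t Complex.ofRealCLM.hasDerivAt

lemma exp_smul_mem_unitary {M : Type*} [CStarAlgebra M] (h : selfAdjoint M) (t : ℝ) :
    NormedSpace.exp ((t : ℂ) • Complex.I • (h : M)) ∈ unitary M := by
  have := (expUnitary (t • h)).2
  rwa [expUnitary_coe, selfAdjoint.val_smul, smul_comm, ← Complex.coe_smul] at this

/-- The path `t ↦ exp(i t h)`. -/
def expPath {n : ℕ} (h : selfAdjoint (Mat A n)) : SmoothPath A n where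
  toFun t := NormedSpace.exp ((t : ℂ) • (Complex.I • (h : Mat A n)))
  contDiffOn := (contDiff_exp_smul _).contDiffOn
  mem_unitary t _ := exp_smul_mem_unitary h t
  map_zero := by simp

lemma endpoint_expPath {n : ℕ} (h : selfAdjoint (Mat A n)) :
    (expPath h).endpoint = UInf.of A n (expUnitary h) := by
  rw [SmoothPath.endpoint]
  congr 1
  ext1
  change NormedSpace.exp (((1 : ℝ) : ℂ) • (Complex.I • (h : Mat A n))) = _
  rw [expUnitary_coe]
  congr 1
  exact (congrArg (· • (Complex.I • (h : Mat A n))) Complex.ofReal_one).trans (one_smul ℂ _)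

lemma apply_logDet_expPath {n : ℕ} (h : selfAdjoint (Mat A n)) (T : A →L[ℂ] ℂ) :
    T (expPath h).logDet = (2 * Real.pi : ℂ)⁻¹ * T (matTrace (h : Mat A n)) := by
  apply mul_left_cancel₀ two_pi_I_ne_zero
  rw [← SmoothPath.winding_eq, winding_eq_of_hasDerivWithinAt (γ := (expPath h).toFun) _ fun t _ =>
    (hasDerivAt_exp_smul (Complex.I • (h : Mat A n)) t).hasDerivWithinAt]
  have : ∀ t ∈ uIcc (0 : ℝ) 1, (T.comp (matTraceL A n)) (Complex.I • (h : Mat A n) *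
      NormedSpace.exp ((t : ℂ) • Complex.I • (h : Mat A n)) * Ring.inverse ((expPath h).toFun t))
      = Complex.I * T (matTrace (h : Mat A n)) := by
    rw [uIcc_of_le zero_le_one]
    intro t ht
    rw [(expPath h).inverse ht, mul_assoc]
    have h1 := ((expPath h).mem_unitary t ht).2
    rw [show NormedSpace.exp ((t : ℂ) • Complex.I • (h : Mat A n)) * star ((expPath h).toFun t) = 1
      from h1, mul_one, ContinuousLinearMap.comp_apply, map_smul, map_smul, matTraceL_apply,
      smul_eq_mul]
  refine (intervalIntegral.integral_congr this).trans ?_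
  have hpi : (Real.pi : ℂ) ≠ 0 := by exact_mod_cast Real.pi_ne_zero
  simp
  field_simp

lemma detBar_expUnitary {n : ℕ} (h : selfAdjoint (Mat A n)) :
    detBar (UInf.of A n (expUnitary h))
      = toH (ev ((2 * Real.pi : ℝ)⁻¹ • matTrace (h : Mat A n))) := by
  rw [← endpoint_expPath, detBar_endpoint, SmoothPath.preDet_eq]
  congr 1
  refine ev_congr fun τ => ?_
  rw [apply_logDet_expPath, ← Complex.coe_smul, map_smul, smul_eq_mul]
  push_cast
  rfl

lemma SmoothPath.endpoint_mem {n : ℕ} (ξ : SmoothPath A n) : ξ.endpoint ∈ U0Inf A := by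
  apply of_mem_U0Inf
  let g : Icc (0 : ℝ) 1 → U A n := fun t => ⟨ξ.toFun t, ξ.mem_unitary t t.2⟩
  have hg : Continuous g :=
    Continuous.subtype_mk (continuousOn_iff_continuous_domRestrict.1 ξ.contDiffOn.continuousOn) _
  have h0 : g ⟨0, by simp⟩ = 1 := Subtype.ext ξ.map_zero
  have h1 : IsPreconnected (range g) := isPreconnected_range hg
  exact h1.subset_connectedComponent ⟨⟨0, by simp⟩, h0⟩ ⟨⟨1, by simp⟩, rfl⟩

lemma exists_list_of_mem_U0Inf {x : UInf A} (hx : x ∈ U0Inf A) :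
    ∃ (n : ℕ) (l : List (selfAdjoint (Mat A n))),
      UInf.of A n (l.map expUnitary).prod = x := by
  have hdir : Directed (· ≤ ·)
      fun n => (Subgroup.connectedComponentOfOne (U A n)).map (UInf.of A n) := by
    refine Monotone.directed_le fun n m h => Subgroup.map_le_iff_le_comap.2 fun y hy => ?_
    refine ⟨pad A n m h y, ?_, UInf.of_pad A h y⟩
    exact mem_connectedComponentOfOne_of_continuous _ (continuous_pad A h) hy
  obtain ⟨n, y, hy, rfl⟩ := (Subgroup.mem_iSup_of_directed hdir).1 hx
  have hy' : y ∈ pathComponent (1 : U A n) := by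
    rw [pathComponent_eq_connectedComponent]; exact hy
  obtain ⟨l, rfl⟩ := Unitary.mem_pathComponentOne_iff.1 hy'
  exact ⟨n, l, rfl⟩

/-- The identity component of each unitary group consists of products of exponentials, which are
endpoints of smooth paths. So on U_0^∞ the default value 0 of `detBar` is never used. -/
lemma mem_U0Inf_iff {x : UInf A} :
    x ∈ U0Inf A ↔ ∃ (n : ℕ) (ξ : SmoothPath A n), ξ.endpoint = x := by
  constructor
  · intro hx
    obtain ⟨n, l, rfl⟩ := exists_list_of_mem_U0Inf hx
    refine ⟨n, ?_⟩
    clear hx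
    induction l with
    | nil => exact ⟨SmoothPath.one A n, by simp [SmoothPath.endpoint_one]⟩
    | cons h l ih =>
      obtain ⟨ξ, hξ⟩ := ih
      refine ⟨(expPath h).mul ξ, ?_⟩
      rw [SmoothPath.endpoint_mul, hξ, endpoint_expPath, List.map_cons, List.prod_cons, map_mul]
  · rintro ⟨n, ξ, rfl⟩
    exact ξ.endpoint_mem

lemma exists_paths {x y : UInf A} (hx : x ∈ U0Inf A) (hy : y ∈ U0Inf A) :
    ∃ (n : ℕ) (ξ η : SmoothPath A n), ξ.endpoint = x ∧ η.endpoint = y := by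
  obtain ⟨n, ξ, rfl⟩ := mem_U0Inf_iff.1 hx
  obtain ⟨m, η, rfl⟩ := mem_U0Inf_iff.1 hy
  exact ⟨max n m, ξ.map (corner (le_max_left n m)), η.map (corner (le_max_right n m)),
    ξ.endpoint_map_corner _, η.endpoint_map_corner _⟩

lemma detBar_mul {x y : UInf A} (hx : x ∈ U0Inf A) (hy : y ∈ U0Inf A) :
    detBar (x * y) = detBar x + detBar y := by
  obtain ⟨n, ξ, η, rfl, rfl⟩ := exists_paths hx hy
  rw [← SmoothPath.endpoint_mul, detBar_endpoint, detBar_endpoint, detBar_endpoint,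
    SmoothPath.preDet_mul]
  exact map_add (toHHom A) _ _

lemma detBar_one : detBar (1 : UInf A) = 0 := by
  have := detBar_mul (one_mem (U0Inf A)) (one_mem (U0Inf A))
  simpa using this

lemma detBar_inv {x : UInf A} (hx : x ∈ U0Inf A) : detBar x⁻¹ = -detBar x := by
  have := detBar_mul (inv_mem hx) hx
  rw [inv_mul_cancel, detBar_one] at this
  exact eq_neg_of_add_eq_zero_left this.symm

lemma detBar_conj {x : UInf A} (hx : x ∈ U0Inf A) (z : UInf A) :
    detBar (z * x * z⁻¹) = detBar x := by
  obtain ⟨n, ξ, rfl⟩ := mem_U0Inf_iff.1 hx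
  obtain ⟨m, w, rfl⟩ := UInf.exists_of z
  rw [← ξ.endpoint_map_corner (le_max_left n m), ← UInf.of_pad A (le_max_right n m) w,
    ← SmoothPath.endpoint_map_conjHom, detBar_endpoint, detBar_endpoint]
  congr 1
  exact ev_congr fun τ => SmoothPath.apply_logDet_map_conjHom (traceL_mul_comm τ) _ _

/-- Tracial states are real on self-adjoint elements. This permits replacing the logarithmic
integral, which is not shown to be self-adjoint, by its real part. -/
lemma ev_realPart (a : A) : ev (realPart a : A) = ev a := by
  refine AffT.ext fun τ => ?_
  have him : (traceL τ (imaginaryPart a : A)).im = 0 := by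
    obtain ⟨c, hc⟩ := CStarAlgebra.nonneg_iff_eq_star_mul_self.1
      (sub_nonneg.2 (IsSelfAdjoint.le_algebraMap_norm_self (imaginaryPart a).2))
    have h1 : 0 ≤ traceL τ (star c * c) := τ.2.1 c
    have h2 : traceL τ 1 = 1 := τ.2.2.1
    rw [← hc, map_sub, Algebra.algebraMap_eq_smul_one, ← Complex.coe_smul, map_smul, h2,
      Complex.nonneg_iff] at h1
    simpa using h1.2
  conv_rhs => rw [← realPart_add_I_smul_imaginaryPart a]
  rw [ev_apply, ev_apply, map_add, map_smul, Complex.add_re, smul_eq_mul, Complex.mul_re, him]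
  simp

lemma map_realPart {R S : Type*} [CStarAlgebra R] [CStarAlgebra S] (f : R →⋆ₙₐ[ℂ] S) (a : R) :
    f (realPart a : R) = (realPart (f a) : S) := by
  simp [realPart_apply_coe, ← Complex.coe_smul, map_star]

/-- A path ξ from 1 to x is carried by φ to a path whose logarithmic integral has the same traces as
the image under φ of that of ξ. One h thus serves all φ. -/
lemma exists_detBar_eq {x : UInf A} (hx : x ∈ U0Inf A) : ∃ h : selfAdjoint A,
    detBar x = toH (ev (h : A)) ∧
      ∀ {B : Type v} [CStarAlgebra B] [PartialOrder B] [StarOrderedRing B] (φ : A →⋆ₙₐ[ℂ] B),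
        detBar (UInfMap φ x) = toH (ev (φ (h : A))) := by
  obtain ⟨n, ξ, rfl⟩ := mem_U0Inf_iff.1 hx
  refine ⟨realPart ξ.logDet, by rw [detBar_endpoint, SmoothPath.preDet_eq, ev_realPart], ?_⟩
  intro B _ _ _ φ
  rw [← SmoothPath.endpoint_map_mapₙₐ, detBar_endpoint, SmoothPath.preDet_eq]
  rw [map_realPart, ev_realPart]
  congr 1
  exact ev_congr fun τ => SmoothPath.apply_logDet_map φ ξ (traceL τ)

end Determinant

/-! ### Permutation matrices and block diagonal matrices -/

section Permutations

open selfAdjoint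

variable {A : Type u} [CStarAlgebra A] [PartialOrder A] [StarOrderedRing A]
  {B : Type v} [CStarAlgebra B] [PartialOrder B] [StarOrderedRing B]

/-- The homomorphism `z ↦ z q` defined by a projection `q`. -/
def projHom {M : Type*} [CStarAlgebra M] {q : M} (hq : IsStarProjection q) : ℂ →⋆ₙₐ[ℂ] M where
  toFun z := z • q
  map_smul' c z := by simp [mul_smul]
  map_zero' := zero_smul _ _
  map_add' z w := add_smul z w q
  map_mul' z w := by rw [smul_mul_smul_comm, hq.1.eq]
  map_star' z := by rw [star_smul, hq.2.star_eq]

lemma exp_smul_projection {M : Type*} [CStarAlgebra M] {q : M} (hq : IsStarProjection q) (z : ℂ) :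
    NormedSpace.exp (z • q) = Complex.exp z • q + (1 - q) := by
  have h := map_exp_add (projHom hq) z
  rw [← Complex.exp_eq_exp_ℂ] at h
  simpa [projHom] using h.symm

lemma expUnitary_smul_projection {M : Type*} [CStarAlgebra M] {q : M} (hq : IsStarProjection q)
    (s : ℝ) : (expUnitary (s • ⟨q, hq.2⟩ : selfAdjoint M) : M)
      = Complex.exp (s * Complex.I) • q + (1 - q) := by
  rw [expUnitary_coe, selfAdjoint.val_smul, smul_comm, ← Complex.coe_smul, smul_smul,
    exp_smul_projection hq]

/-- The permutation matrix of `σ`. -/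
def permMat (A : Type u) [CStarAlgebra A] [PartialOrder A] [StarOrderedRing A] {n : ℕ}
    (σ : Equiv.Perm (Fin n)) : Mat A n :=
  CStarMatrix.ofMatrix fun i j => if i = σ j then 1 else 0

lemma permMat_apply {n : ℕ} (σ : Equiv.Perm (Fin n)) (i j : Fin n) :
    permMat A σ i j = if i = σ j then 1 else 0 := rfl

lemma permMat_mul_apply {n : ℕ} (σ : Equiv.Perm (Fin n)) (a : Mat A n) (i j : Fin n) :
    (permMat A σ * a) i j = a (σ.symm i) j := by
  rw [CStarMatrix.mul_apply, Finset.sum_eq_single (σ.symm i)]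
  · simp [permMat_apply]
  · intro k _ hk
    rw [permMat_apply, if_neg (fun h => hk (by rw [h, Equiv.symm_apply_apply])), zero_mul]
  · simp

lemma mul_permMat_apply {n : ℕ} (σ : Equiv.Perm (Fin n)) (a : Mat A n) (i j : Fin n) :
    (a * permMat A σ) i j = a i (σ j) := by
  rw [CStarMatrix.mul_apply, Finset.sum_eq_single (σ j)]
  · simp [permMat_apply]
  · intro k _ hk
    rw [permMat_apply, if_neg hk, mul_zero]
  · simp

lemma star_permMat {n : ℕ} (σ : Equiv.Perm (Fin n)) : star (permMat A σ) = permMat A σ⁻¹ := by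
  ext i j
  rw [CStarMatrix.star_apply, permMat_apply, permMat_apply]
  simp only [Equiv.Perm.eq_inv_iff_eq, eq_comm (a := j)]
  split_ifs <;> simp

lemma permMat_mul {n : ℕ} (σ ρ : Equiv.Perm (Fin n)) :
    permMat A (σ * ρ) = permMat A σ * permMat A ρ := by
  ext i j
  rw [mul_permMat_apply]
  rfl

lemma permMat_one (n : ℕ) : permMat A (1 : Equiv.Perm (Fin n)) = 1 := by
  ext i j
  rw [permMat_apply, CStarMatrix.one_apply]
  rfl

variable (A) in
/-- The permutation matrices as a homomorphism to the unitary group. -/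
def permU (n : ℕ) : Equiv.Perm (Fin n) →* U A n where
  toFun σ := ⟨permMat A σ, by
    rw [Unitary.mem_iff, star_permMat, ← permMat_mul, ← permMat_mul, inv_mul_cancel,
      mul_inv_cancel, permMat_one]
    exact ⟨rfl, rfl⟩⟩
  map_one' := Subtype.ext (permMat_one n)
  map_mul' σ ρ := Subtype.ext (permMat_mul σ ρ)

lemma permU_conj_apply {n : ℕ} (σ : Equiv.Perm (Fin n)) (x : U A n) (i j : Fin n) :
    ((permU A n σ * x * (permU A n σ)⁻¹ : U A n) : Mat A n) i j
      = (x : Mat A n) (σ.symm i) (σ.symm j) := by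
  rw [← map_inv]
  change (permMat A σ * (x : Mat A n) * permMat A σ⁻¹) i j = _
  rw [mul_permMat_apply, permMat_mul_apply]
  rfl

/-- A self-adjoint unitary is 1 - 2q = exp(iπq) for the projection q = (1 - x)/2. -/
lemma exists_expUnitary_eq_of_star_eq {M : Type*} [CStarAlgebra M] {x : unitary M}
    (hx : star (x : M) = x) : ∃ h : selfAdjoint M, expUnitary h = x := by
  have hxx : (x : M) * x = 1 := by
    nth_rw 1 [← hx]; exact (Unitary.mem_iff.1 x.2).1
  have hq : IsStarProjection ((2⁻¹ : ℂ) • (1 - (x : M))) := by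
    constructor
    · rw [IsIdempotentElem, smul_mul_smul_comm, mul_sub, sub_mul, sub_mul, hxx, mul_one, mul_one,
        one_mul, show (1 - (x : M)) - (x - 1) = (2 : ℂ) • (1 - (x : M)) by
          rw [two_smul]; abel, smul_smul]
      norm_num
    · rw [IsSelfAdjoint, star_smul, star_sub, star_one, hx]
      norm_num
  refine ⟨Real.pi • ⟨_, hq.2⟩, ?_⟩
  ext1
  rw [expUnitary_smul_projection hq, Complex.exp_pi_mul_I]
  module

lemma of_expUnitary_mem_U0Inf {n : ℕ} (h : selfAdjoint (Mat A n)) :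
    UInf.of A n (expUnitary h) ∈ U0Inf A := by
  rw [← endpoint_expPath]
  exact SmoothPath.endpoint_mem _

/-- Transpositions generate the symmetric group, and their matrices are self-adjoint unitaries,
hence exponentials. -/
lemma of_permU_mem_U0Inf {n : ℕ} (σ : Equiv.Perm (Fin n)) : UInf.of A n (permU A n σ) ∈ U0Inf A := by
  have h : (⊤ : Subgroup (Equiv.Perm (Fin n)))
      ≤ (U0Inf A).comap ((UInf.of A n).comp (permU A n)) := by
    rw [← Equiv.Perm.closure_isSwap, Subgroup.closure_le]
    rintro _ ⟨i, j, -, rfl⟩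
    obtain ⟨h, hh⟩ := exists_expUnitary_eq_of_star_eq (x := permU A n (Equiv.swap i j)) (by
      change star (permMat A _) = permMat A _
      rw [star_permMat, Equiv.swap_inv])
    change UInf.of A n (permU A n (Equiv.swap i j)) ∈ U0Inf A
    rw [← hh]
    exact of_expUnitary_mem_U0Inf h
  exact h (Subgroup.mem_top σ)

lemma blockDiag_castAdd_castAdd {n m : ℕ} (x : U A n) (y : U A m) (i j : Fin n) :
    (blockDiag x y : Mat A (n + m)) (Fin.castAdd m i) (Fin.castAdd m j) = (x : Mat A n) i j := by
  change Matrix.fromBlocks _ _ _ _ (finSumFinEquiv.symm _) (finSumFinEquiv.symm _) = _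
  simp

lemma blockDiag_castAdd_natAdd {n m : ℕ} (x : U A n) (y : U A m) (i : Fin n) (j : Fin m) :
    (blockDiag x y : Mat A (n + m)) (Fin.castAdd m i) (Fin.natAdd n j) = 0 := by
  change Matrix.fromBlocks _ _ _ _ (finSumFinEquiv.symm _) (finSumFinEquiv.symm _) = _
  simp

lemma blockDiag_natAdd_castAdd {n m : ℕ} (x : U A n) (y : U A m) (i : Fin m) (j : Fin n) :
    (blockDiag x y : Mat A (n + m)) (Fin.natAdd n i) (Fin.castAdd m j) = 0 := by
  change Matrix.fromBlocks _ _ _ _ (finSumFinEquiv.symm _) (finSumFinEquiv.symm _) = _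
  simp

lemma blockDiag_natAdd_natAdd {n m : ℕ} (x : U A n) (y : U A m) (i j : Fin m) :
    (blockDiag x y : Mat A (n + m)) (Fin.natAdd n i) (Fin.natAdd n j) = (y : Mat A m) i j := by
  change Matrix.fromBlocks _ _ _ _ (finSumFinEquiv.symm _) (finSumFinEquiv.symm _) = _
  simp

lemma blockDiag_mul {n m : ℕ} (x x' : U A n) (y y' : U A m) :
    blockDiag (x * x') (y * y') = blockDiag x y * blockDiag x' y' := by
  ext i j
  rw [Submonoid.coe_mul, CStarMatrix.mul_apply, Fin.sum_univ_add]
  induction i using Fin.addCases <;> induction j using Fin.addCases <;>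
    simp [blockDiag_castAdd_castAdd, blockDiag_castAdd_natAdd, blockDiag_natAdd_castAdd,
      blockDiag_natAdd_natAdd, CStarMatrix.mul_apply]

lemma blockDiag_one_right {n : ℕ} (m : ℕ) (x : U A n) :
    blockDiag x (1 : U A m) = pad A n (n + m) (Nat.le_add_right n m) x := by
  ext i j
  induction i using Fin.addCases <;> induction j using Fin.addCases <;>
    simp [blockDiag_castAdd_castAdd, blockDiag_castAdd_natAdd, blockDiag_natAdd_castAdd,
      blockDiag_natAdd_natAdd, pad, coe_unitaryMap, corner_apply, CStarMatrix.one_apply, Fin.ext_iff]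
  all_goals omega

lemma blockDiag_one_left (n : ℕ) {m : ℕ} (y : U A m) : ∃ σ : Equiv.Perm (Fin (n + m)),
    blockDiag (1 : U A n) y
      = permU A _ σ * pad A m (n + m) (Nat.le_add_left m n) y * (permU A _ σ)⁻¹ := by
  -- The permutation that interchanges the two blocks.
  refine ⟨(finAddFlip.trans (finCongr (Nat.add_comm m n))).symm, ?_⟩
  ext i j
  rw [permU_conj_apply]
  induction i using Fin.addCases <;> induction j using Fin.addCases <;>
    simp [blockDiag_castAdd_castAdd, blockDiag_castAdd_natAdd, blockDiag_natAdd_castAdd,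
      blockDiag_natAdd_natAdd, pad, coe_unitaryMap, corner_apply, CStarMatrix.one_apply, Fin.ext_iff]
  all_goals omega

end Permutations

/-! ### The determinant vanishes on the closed commutator subgroup -/

section Commutators

open selfAdjoint

variable {A : Type u} [CStarAlgebra A] [PartialOrder A] [StarOrderedRing A]

variable (A) in
/-- The kernel of the determinant. -/
def detKer : Subgroup (UInf A) where
  carrier := {x | x ∈ U0Inf A ∧ detBar x = 0}
  one_mem' := ⟨one_mem _, detBar_one⟩
  mul_mem' hx hy := ⟨mul_mem hx.1 hy.1, by rw [detBar_mul hx.1 hy.1, hx.2, hy.2, add_zero]⟩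
  inv_mem' hx := ⟨inv_mem hx.1, by rw [detBar_inv hx.1, hx.2, neg_zero]⟩

lemma mem_detKer {x : UInf A} : x ∈ detKer A ↔ x ∈ U0Inf A ∧ detBar x = 0 := Iff.rfl

instance : (detKer A).Normal where
  conj_mem x hx g := ⟨(inferInstance : (U0Inf A).Normal).conj_mem x hx.1 g, by
    rw [detBar_conj hx.1, hx.2]⟩

/-- Written as w · (y w⁻¹ y⁻¹), the commutator is a product of two elements of U_0^∞ with opposite
determinants. -/
lemma conj_mul_inv_mem_detKer {w : UInf A} (hw : w ∈ U0Inf A) (y : UInf A) :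
    w * y * w⁻¹ * y⁻¹ ∈ detKer A := by
  have h1 : y * w⁻¹ * y⁻¹ ∈ U0Inf A :=
    (inferInstance : (U0Inf A).Normal).conj_mem _ (inv_mem hw) y
  have h2 : w * y * w⁻¹ * y⁻¹ = w * (y * w⁻¹ * y⁻¹) := by group
  rw [h2, mem_detKer]
  exact ⟨mul_mem hw h1, by
    rw [detBar_mul hw h1, detBar_conj (inv_mem hw), detBar_inv hw, add_neg_cancel]⟩

/-- Additivity of the determinant is available only on U_0^∞, while x and y are arbitrary. A
permutation matrix w, which does lie in U_0^∞, moves y into a block where it commutes with x. -/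
lemma commutator_le_detKer : commutator (UInf A) ≤ detKer A := by
  rw [commutator_def, Subgroup.commutator_le]
  intro x _ y _
  obtain ⟨n, x, rfl⟩ := UInf.exists_of x
  obtain ⟨m, y, rfl⟩ := UInf.exists_of y
  obtain ⟨σ, hσ⟩ := blockDiag_one_left n y
  set w := UInf.of A _ (permU A (n + m) σ) with hw
  have h1 : w * UInf.of A m y * w⁻¹ = UInf.of A _ (blockDiag (1 : U A n) y) := by
    rw [hσ, map_mul, map_mul, map_inv, UInf.of_pad]
  have h2 : Commute (UInf.of A n x) (w * UInf.of A m y * w⁻¹) := by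
    rw [h1, ← UInf.of_pad A (Nat.le_add_right n m) x, ← blockDiag_one_right]
    exact Commute.map (by rw [commute_iff_eq, ← blockDiag_mul, ← blockDiag_mul]; simp) _
  have h3 := conj_mul_inv_mem_detKer (of_permU_mem_U0Inf σ) (UInf.of A m y)
  rw [← hw] at h3
  set X := UInf.of A n x
  set Y := UInf.of A m y
  have h4 := (inferInstance : (detKer A).Normal).conj_mem _ (inv_mem h3) X
  -- With r = wYw⁻¹Y⁻¹ in the kernel, Y = r⁻¹(wYw⁻¹) and the second factor commutes with X, so [X,
  -- Y] = X r⁻¹ X⁻¹ r.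
  have h5 : X * Y * X⁻¹ * Y⁻¹ = X * (w * Y * w⁻¹ * Y⁻¹)⁻¹ * X⁻¹ * (w * Y * w⁻¹ * Y⁻¹) := by
    have h6 : X⁻¹ * (w * Y * w⁻¹) = (w * Y * w⁻¹) * X⁻¹ := (h2.inv_left).eq
    calc X * Y * X⁻¹ * Y⁻¹
        = X * (Y * (w * Y * w⁻¹)⁻¹) * ((w * Y * w⁻¹) * X⁻¹) * Y⁻¹ := by group
      _ = _ := by rw [← h6]; group
  rw [commutatorElement_def, h5]
  exact mul_mem h4 h3

lemma norm_toH_ev_le (a : A) : ‖toH (ev a)‖ ≤ ‖a‖ := by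
  refine (QuotientAddGroup.norm_mk_le_norm).trans ?_
  exact BoundedContinuousFunction.norm_ofNormedAddCommGroup_le _ (norm_nonneg a)
    fun τ => abs_re_tracialState_le τ a

lemma continuous_toH_ev : Continuous fun a : A => toH (ev a) :=
  AddMonoidHomClass.continuous_of_bound ((toHHom A).comp (evHom A)) 1 fun a => by
    rw [one_mul]; exact norm_toH_ev_le a

/-- Closedness is tested in each U(M_n(A)). If y in the kernel is within distance 2 of x, then xy*
is an exponential and the determinant of x equals [ev] of tr(arg(xy*))/2π. This tends to 0 as y
tends to x, but the determinant of x does not depend on y. -/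
lemma isClosed_detKer : IsClosed (detKer A : Set (UInf A)) := by
  rw [isClosed_iSup_iff]
  intro n
  rw [isClosed_coinduced]
  refine isClosed_of_closure_subset fun x hx => ?_
  rw [mem_closure_iff_frequently] at hx
  let g : U A n → H A := fun y => toH (ev ((2 * Real.pi : ℝ)⁻¹ •
    matTrace (Unitary.argSelfAdjoint (x * star y) : Mat A n)))
  have hball : ∀ᶠ y : U A n in nhds x, ‖((x : Mat A n) - y : Mat A n)‖ < 2 := by
    have : Continuous fun y : U A n => ‖((x : Mat A n) - y : Mat A n)‖ :=
      (continuous_const.sub continuous_subtype_val).norm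
    exact this.continuousAt.eventually_lt continuousAt_const (by simp)
  have key : ∀ y : U A n, UInf.of A n y ∈ detKer A → ‖((x : Mat A n) - y : Mat A n)‖ < 2 →
      UInf.of A n x ∈ U0Inf A ∧ detBar (UInf.of A n x) = g y := fun y hy hxy => by
    have h1 := Unitary.expUnitary_eq_mul_inv x y hxy
    have h2 : UInf.of A n (x * star y) ∈ U0Inf A := by
      rw [← h1]; exact of_expUnitary_mem_U0Inf _
    have h3 : UInf.of A n x = UInf.of A n (x * star y) * UInf.of A n y := by
      rw [← map_mul, mul_assoc, Unitary.star_mul_self, mul_one]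
    refine ⟨h3 ▸ mul_mem h2 hy.1, ?_⟩
    rw [h3, detBar_mul h2 hy.1, hy.2, add_zero, ← h1, detBar_expUnitary]
  have hg : Filter.Tendsto g (nhds x) (nhds 0) := by
    have h1 : Unitary.argSelfAdjoint (1 : U A n) = 0 := by
      rw [← expUnitary_zero]
      exact argSelfAdjoint_expUnitary (by rw [norm_zero]; exact Real.pi_pos)
    have h2 : ContinuousAt (Unitary.argSelfAdjoint : U A n → selfAdjoint (Mat A n)) (x * star x) :=
      Unitary.continuousOn_argSelfAdjoint.continuousAt
        (Metric.isOpen_ball.mem_nhds (by simp))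
    have h3 : ContinuousAt (fun y : U A n => x * star y) x :=
      (continuous_const.mul continuous_star).continuousAt
    have h4 : Continuous fun k : selfAdjoint (Mat A n) =>
        toH (ev ((2 * Real.pi : ℝ)⁻¹ • matTrace (k : Mat A n))) := by
      have : Continuous fun k : selfAdjoint (Mat A n) => matTraceL A n k :=
        (matTraceL A n).continuous.comp continuous_subtype_val
      simp only [matTraceL_apply] at this
      exact continuous_toH_ev.comp (this.const_smul _)
    have h5 : g x = 0 := by
      simp only [g, Unitary.mul_star_self, h1, ZeroMemClass.coe_zero, ← matTraceL_apply, map_zero,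
        smul_zero]
      exact map_zero ((toHHom A).comp (evHom A))
    rw [← h5]
    exact h4.continuousAt.comp (ContinuousAt.comp (f := fun y : U A n => x * star y) h2 h3)
  have hf := hx.and_eventually hball
  obtain ⟨y, hy, hxy⟩ := hf.exists
  refine ⟨(key y hy hxy).1, ?_⟩
  by_contra hne
  have hev : ∀ᶠ y in nhds x, g y ≠ detBar (UInf.of A n x) := hg.eventually_ne (Ne.symm hne)
  obtain ⟨z, ⟨hz, hxz⟩, hz2⟩ := (hf.and_eventually hev).exists
  exact hz2 (key z hz hxz).2.symm

lemma DUbar_le_detKer : DUbar A ≤ detKer A :=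
  fun _ hx => closure_minimal commutator_le_detKer isClosed_detKer hx

end Commutators

/-! ### Homomorphisms to abelian groups and exponentials -/

section Trotter

open selfAdjoint Filter Topology

variable {M : Type*} [CStarAlgebra M]

lemma expUnitary_nsmul (k : ℕ) (a : selfAdjoint M) : expUnitary (k • a) = expUnitary a ^ k := by
  induction k with
  | zero => simp
  | succ k ih =>
    rw [succ_nsmul, pow_succ, ← ih, Commute.expUnitary_add]
    exact ((Commute.refl (a : M)).smul_left k)

lemma norm_pow_sub_pow_unitary_le (x y : unitary M) (k : ℕ) :
    ‖((x ^ k : unitary M) : M) - (y ^ k : unitary M)‖ ≤ k * ‖(x : M) - y‖ := by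
  induction k with
  | zero => simp
  | succ k ih =>
    have h : ((x ^ (k + 1) : unitary M) : M) - (y ^ (k + 1) : unitary M)
        = ((x ^ k : unitary M) : M) * ((x : M) - y)
          + (((x ^ k : unitary M) : M) - (y ^ k : unitary M)) * (y : M) := by
      rw [pow_succ, pow_succ, Submonoid.coe_mul, Submonoid.coe_mul, mul_sub, sub_mul]
      abel
    rw [h]
    refine (norm_add_le _ _).trans ?_
    rw [CStarRing.norm_coe_unitary_mul, CStarRing.norm_mul_coe_unitary]
    push_cast at ih ⊢
    linarith

/-- The Lie-Trotter product formula for unitaries. -/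
lemma tendsto_expUnitary_mul_pow (a b : selfAdjoint M) :
    Tendsto (fun k : ℕ => (expUnitary ((1 / ((k : ℝ) + 1)) • a) *
      expUnitary ((1 / ((k : ℝ) + 1)) • b)) ^ (k + 1)) atTop (𝓝 (expUnitary (a + b))) := by
  -- `E` vanishes at 0 together with its derivative. By the telescoping bound ‖xᵏ - yᵏ‖ ≤ k‖x - y‖,
  -- the error in the product formula is at most the norm of a difference quotient of `E` at 0.
  let E : ℝ → M := fun t => NormedSpace.exp ((t : ℂ) • Complex.I • (a : M)) *
    NormedSpace.exp ((t : ℂ) • Complex.I • (b : M)) -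
      NormedSpace.exp ((t : ℂ) • (Complex.I • ((a + b : selfAdjoint M) : M)))
  have hE : HasDerivAt E 0 0 := by
    have := ((hasDerivAt_exp_smul (Complex.I • (a : M)) 0).mul
      (hasDerivAt_exp_smul (Complex.I • (b : M)) 0)).sub
        (hasDerivAt_exp_smul (Complex.I • ((a + b : selfAdjoint M) : M)) 0)
    convert! this using 1
    simp
  have hlim : Tendsto (fun k : ℕ => 1 / ((k : ℝ) + 1)) atTop (𝓝[≠] 0) :=
    tendsto_nhdsWithin_iff.2 ⟨tendsto_one_div_add_atTop_nhds_zero_nat,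
      Eventually.of_forall fun k => (by positivity : (1 / ((k : ℝ) + 1)) ≠ 0)⟩
  have h0 := (hE.tendsto_slope_zero.comp hlim).norm
  rw [norm_zero] at h0
  have hexp : ∀ (t : ℝ) (c : selfAdjoint M),
      (expUnitary (t • c) : M) = NormedSpace.exp ((t : ℂ) • Complex.I • (c : M)) := fun t c => by
    rw [expUnitary_coe, selfAdjoint.val_smul, smul_comm, ← Complex.coe_smul]
  rw [tendsto_iff_dist_tendsto_zero]
  refine squeeze_zero (fun _ => dist_nonneg) (fun k => ?_) h0
  have hk : (k : ℝ) + 1 ≠ 0 := by positivity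
  have h1 : expUnitary (a + b) = expUnitary ((1 / ((k : ℝ) + 1)) • (a + b)) ^ (k + 1) := by
    rw [← expUnitary_nsmul, ← Nat.cast_smul_eq_nsmul ℝ, smul_smul]
    push_cast
    rw [mul_one_div_cancel hk, one_smul]
  rw [h1, Subtype.dist_eq, dist_eq_norm]
  refine (norm_pow_sub_pow_unitary_le _ _ _).trans (le_of_eq ?_)
  have hE0 : E 0 = 0 := by simp [E]
  rw [Function.comp_apply, hE0, sub_zero, zero_add, norm_smul, one_div, inv_inv, Real.norm_eq_abs,
    abs_of_pos (by positivity), Submonoid.coe_mul, hexp, hexp, hexp, Nat.cast_succ]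

variable {G : Type*} [CommGroup G] {f : unitary M →* G}

/-- As the target is abelian, every Trotter approximant has image f(exp ia) f(exp ib); closedness of
the kernel carries this to the limit, with no topology on the target. -/
lemma map_expUnitary_add (hf : IsClosed {x | f x = 1}) (a b : selfAdjoint M) :
    f (expUnitary (a + b)) = f (expUnitary a) * f (expUnitary b) := by
  have h1 := (tendsto_expUnitary_mul_pow a b).mul_const (expUnitary a * expUnitary b)⁻¹
  have h2 := hf.mem_of_tendsto h1 (Eventually.of_forall fun k => ?_)
  · rw [mem_ofPred_eq, map_mul, map_inv, map_mul, mul_inv_eq_one] at h2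
    exact h2
  · have hk : (k : ℝ) + 1 ≠ 0 := by positivity
    have h3 : ∀ c : selfAdjoint M, expUnitary ((1 / ((k : ℝ) + 1)) • c) ^ (k + 1)
        = expUnitary c := fun c => by
      rw [← expUnitary_nsmul, ← Nat.cast_smul_eq_nsmul ℝ, smul_smul]
      push_cast
      rw [mul_one_div_cancel hk, one_smul]
    rw [mem_ofPred_eq, map_mul, map_pow, map_mul, mul_pow, ← map_pow, ← map_pow, h3, h3, map_inv,
      map_mul, mul_inv_cancel]

/-- The additive map which sends a self-adjoint element `h` to `f (exp(ih))`. -/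
def expHom (hf : IsClosed {x | f x = 1}) : M →+ Additive G :=
  AddMonoidHom.mk' (fun a => Additive.ofMul (f (expUnitary (realPart a)))) fun a b => by
    rw [map_add, ← ofMul_mul, map_expUnitary_add hf]

lemma expHom_coe (hf : IsClosed {x | f x = 1}) (h : selfAdjoint M) :
    expHom hf h = Additive.ofMul (f (expUnitary h)) := by
  have : realPart (h : M) = h := Subtype.ext h.2.coe_realPart
  change Additive.ofMul (f (expUnitary (realPart (h : M)))) = _
  rw [this]

lemma expHom_realPart (hf : IsClosed {x | f x = 1}) (a : M) :
    expHom hf (realPart a : M) = expHom hf a :=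
  expHom_coe hf _

lemma expHom_map {N : Type*} [CStarAlgebra N] {g : unitary N →* G} (hf : IsClosed {x | f x = 1})
    (hg : IsClosed {x | g x = 1}) {φ : N →⋆ₙₐ[ℂ] M} (h : ∀ x, f (unitaryMap φ x) = g x) (a : N) :
    expHom hf (φ a) = expHom hg a := by
  change Additive.ofMul (f (expUnitary (realPart (φ a)))) =
    Additive.ofMul (g (expUnitary (realPart a)))
  rw [← h, unitaryMap_expUnitary]
  congr 3
  exact Subtype.ext (map_realPart φ a).symm

lemma expHom_conj (hf : IsClosed {x | f x = 1}) (w : unitary M) (a : M) :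
    expHom hf (w * a * star (w : M)) = expHom hf a :=
  expHom_map (φ := conjHom w) hf hf (fun x => by
    rw [unitaryMap_conjHom, map_mul, map_mul, map_inv, mul_comm, inv_mul_cancel_left]) a

lemma expHom_eq_zero_of_approx (hf : IsClosed {x | f x = 1}) {a : M}
    (h : ∀ ε > 0, ∃ b : M, expHom hf b = 0 ∧ ‖a - b‖ < ε) : expHom hf a = 0 := by
  have h1 : realPart a ∈ closure {k : selfAdjoint M | f (expUnitary k) = 1} := by
    rw [Metric.mem_closure_iff]
    intro ε hε
    obtain ⟨b, hb, hlt⟩ := h ε hε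
    refine ⟨realPart b, hb, ?_⟩
    rw [dist_eq_norm, ← map_sub]
    exact (realPart.norm_le (a - b)).trans_lt hlt
  exact (hf.preimage continuous_expUnitary).closure_subset h1

lemma expHom_two_pi_smul_projection (hf : IsClosed {x | f x = 1}) {p : M}
    (hp : IsStarProjection p) : expHom hf ((2 * Real.pi : ℂ) • p) = 0 := by
  have h1 : (2 * Real.pi : ℂ) • p = (((2 * Real.pi : ℝ) • ⟨p, hp.2⟩ : selfAdjoint M) : M) := by
    rw [selfAdjoint.val_smul, ← Complex.coe_smul]
    push_cast
    rfl
  have h2 : expUnitary ((2 * Real.pi : ℝ) • ⟨p, hp.2⟩ : selfAdjoint M) = 1 := by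
    ext1
    rw [expUnitary_smul_projection hp]
    push_cast
    rw [Complex.exp_two_pi_mul_I]
    simp
  rw [h1, expHom_coe, h2, map_one, ofMul_one]

lemma map_prod_expUnitary (hf : IsClosed {x | f x = 1}) (l : List (selfAdjoint M)) :
    f (l.map expUnitary).prod = f (expUnitary l.sum) := by
  induction l with
  | nil => simp
  | cons h l ih =>
    rw [List.map_cons, List.prod_cons, List.sum_cons, map_mul, ih, map_expUnitary_add hf]

end Trotter

/-! ### Exponentials in `\overline{K}_1` -/

section ExpClass

open selfAdjoint

variable {A : Type u} [CStarAlgebra A] [PartialOrder A] [StarOrderedRing A]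

lemma isClosed_DUbar : IsClosed (DUbar A : Set (UInf A)) := isClosed_closure

lemma commutator_le_DUbar : commutator (UInf A) ≤ DUbar A := fun _ hx => subset_closure hx

lemma K1bar_mul_comm (x y : K1bar A) : x * y = y * x := by
  have := Subgroup.Normal.quotient_commutative_iff_commutator_le.2 (commutator_le_DUbar (A := A))
  exact this.is_comm.comm x y

instance : CommGroup (K1bar A) :=
  { (inferInstance : Group (K1bar A)) with mul_comm := K1bar_mul_comm }

lemma toK1bar_eq_one {x : UInf A} : toK1bar x = 1 ↔ x ∈ DUbar A := QuotientGroup.eq_one_iff x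

lemma isClosed_ker_toK1bar (n : ℕ) :
    IsClosed {x : U A n | (toK1bar.comp (UInf.of A n)) x = 1} := by
  simp only [MonoidHom.comp_apply, toK1bar_eq_one]
  exact isClosed_DUbar.preimage (UInf.continuous_of A n)

variable (A) in
/-- The homomorphism `M_n(A) → \overline{K}_1(A)` which maps a self-adjoint element `h` to the
class of `exp(ih)`. -/
def expClass (n : ℕ) : Mat A n →+ Additive (K1bar A) := expHom (isClosed_ker_toK1bar n)

lemma expClass_coe {n : ℕ} (h : selfAdjoint (Mat A n)) :
    expClass A n h = Additive.ofMul (toK1bar (UInf.of A n (expUnitary h))) :=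
  expHom_coe _ h

lemma expClass_map {n m : ℕ} {f : Mat A n →⋆ₙₐ[ℂ] Mat A m}
    (hf : ∀ x : U A n, toK1bar (UInf.of A m (unitaryMap f x)) = toK1bar (UInf.of A n x))
    (a : Mat A n) : expClass A m (f a) = expClass A n a :=
  expHom_map _ _ hf a

lemma expClass_corner {n m : ℕ} (h : n ≤ m) (a : Mat A n) :
    expClass A m (corner h a) = expClass A n a :=
  expClass_map (fun x => congrArg toK1bar (UInf.of_pad A h x)) a

lemma expClass_conj {n : ℕ} (w : U A n) (a : Mat A n) :
    expClass A n (w * a * star (w : Mat A n)) = expClass A n a :=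
  expHom_conj _ w a

/-- The embedding of `A` in `M_n(A)` as the `i`-th diagonal entry. -/
def diagHom {n : ℕ} (i : Fin n) : A →⋆ₙₐ[ℂ] Mat A n where
  toFun := singleL i i
  map_smul' c a := map_smul _ c a
  map_zero' := map_zero _
  map_add' a b := map_add _ a b
  map_mul' a b := by
    ext k l
    rw [CStarMatrix.mul_apply, Finset.sum_eq_single i]
    · simp only [singleL_apply]
      by_cases hk : i = k <;> by_cases hl : i = l <;> simp [hk, hl]
    · intro j _ hj
      simp [singleL_apply, hj.symm]
    · simp
  map_star' a := by
    ext k l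
    rw [CStarMatrix.star_apply, singleL_apply, singleL_apply]
    rw [apply_ite star, star_zero]
    exact if_congr and_comm rfl rfl

lemma diagHom_apply {n : ℕ} (i : Fin n) (a : A) : diagHom i a = singleL i i a := rfl

lemma singleL_mul_singleL {n : ℕ} (i j k : Fin n) (a b : A) :
    singleL i j a * singleL j k b = singleL i k (a * b) := by
  ext p q
  rw [CStarMatrix.mul_apply, Finset.sum_eq_single j]
  · simp only [singleL_apply]
    by_cases hk : i = p <;> by_cases hl : k = q <;> simp [hk, hl]
  · intro r _ hr
    simp [singleL_apply, hr.symm]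
  · simp

lemma singleL_mul_singleL_of_ne {n : ℕ} (i : Fin n) {j j' : Fin n} (h : j ≠ j') (k : Fin n)
    (a b : A) : singleL i j a * singleL j' k b = 0 := by
  ext p q
  rw [CStarMatrix.mul_apply]
  refine Finset.sum_eq_zero fun r _ => ?_
  simp only [singleL_apply]
  by_cases h1 : j = r
  · subst h1
    simp [h.symm]
  · simp [h1]

lemma isClosed_ker_toK1bar_diagHom :
    IsClosed {x : unitary A |
      (toK1bar.comp ((UInf.of A 1).comp (unitaryMap (diagHom (0 : Fin 1))))) x = 1} := by
  have h1 : Continuous (diagHom (0 : Fin 1) : A → Mat A 1) := (singleL (0 : Fin 1) 0).continuous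
  simp only [MonoidHom.comp_apply, toK1bar_eq_one]
  exact isClosed_DUbar.preimage ((UInf.continuous_of A 1).comp (continuous_unitaryMap _ h1))

variable (A) in
/-- The homomorphism `A → \overline{K}_1(A)` which maps a self-adjoint element `h` to the class
of `exp(ih)`. -/
def expClassOne : A →+ Additive (K1bar A) := expHom isClosed_ker_toK1bar_diagHom

lemma expClassOne_apply (a : A) : expClassOne A a = expClass A 1 (diagHom 0 a) :=
  (expHom_map (isClosed_ker_toK1bar 1) isClosed_ker_toK1bar_diagHom (fun _ => rfl) a).symm

/-- Conjugation by a transposition moves the i-th diagonal entry to the first corner, and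
conjugation is invisible in an abelian group. -/
lemma expClass_diagHom {n : ℕ} (i : Fin n) (a : A) :
    expClass A n (diagHom i a) = expClassOne A a := by
  have hn : 1 ≤ n := i.pos
  rw [expClassOne_apply, ← expClass_corner hn]
  let i₀ : Fin n := ⟨0, hn⟩
  rw [← expClass_conj (permU A n (Equiv.swap i i₀)) (corner hn _)]
  congr 1
  ext p q
  rw [← Unitary.coe_star, Unitary.star_eq_inv, ← map_inv]
  change _ = (permMat A (Equiv.swap i i₀) * corner hn (diagHom 0 a) *
    permMat A (Equiv.swap i i₀)⁻¹ : Mat A n) p q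
  rw [mul_permMat_apply, permMat_mul_apply, Equiv.swap_inv, Equiv.symm_swap, corner_apply]
  have h1 : ∀ r : Fin n, ((Equiv.swap i i₀ r).1 < 1 ↔ i = r) := fun r => by
    rw [Nat.lt_one_iff]
    constructor
    · intro h
      have : Equiv.swap i i₀ r = i₀ := Fin.ext h
      rw [Equiv.swap_apply_eq_iff, Equiv.swap_apply_right] at this
      exact this.symm
    · rintro rfl
      rw [Equiv.swap_apply_left]
  simp only [h1, diagHom_apply, singleL_apply]
  by_cases hp : i = p ∧ i = q
  · obtain ⟨rfl, rfl⟩ := hp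
    simp [i₀]
  · simp [hp]

/-- Conjugation by 1 - 2e_ii changes the sign of the (i,j) unit, so twice the class of each such
matrix is zero; halving the entry removes the factor 2. -/
lemma expClass_singleL_of_ne {n : ℕ} {i j : Fin n} (h : i ≠ j) (a : A) :
    expClass A n (singleL i j a) = 0 := by
  have h1 : ∀ b : A, expClass A n (singleL i j b) + expClass A n (singleL i j b) = 0 := fun b => by
    let w : U A n := unitaryMap (diagHom i) (-1)
    have hw : (w : Mat A n) = 1 - singleL i i (1 : A) - singleL i i (1 : A) := by
      simp only [w, coe_unitaryMap, diagHom_apply, Unitary.coe_neg, map_neg, OneMemClass.coe_one]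
      abel
    have hs : star (w : Mat A n) = w := by
      rw [hw, star_sub, star_sub, star_one, ← diagHom_apply, ← map_star, star_one]
    have h2 := expClass_conj w (singleL i j b)
    rw [hs, hw] at h2
    simp only [sub_mul, mul_sub, one_mul, mul_one, singleL_mul_singleL,
      singleL_mul_singleL_of_ne _ h.symm, sub_zero, zero_sub, sub_self, neg_mul, neg_zero] at h2
    rw [map_neg] at h2
    nth_rw 1 [← h2]
    exact neg_add_cancel _
  have h3 : a = (2⁻¹ : ℂ) • a + (2⁻¹ : ℂ) • a := by module
  rw [h3, map_add, map_add]
  exact h1 _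

/-- Off-diagonal entries contribute nothing and all diagonal positions are equivalent, so only the
matrix trace survives. -/
lemma expClass_eq {n : ℕ} (a : Mat A n) : expClass A n a = expClassOne A (matTrace a) := by
  conv_lhs => rw [← sum_singleL a]
  rw [matTrace, map_sum, map_sum]
  refine Finset.sum_congr rfl fun i _ => ?_
  rw [map_sum, Finset.sum_eq_single i]
  · exact expClass_diagHom i _
  · exact fun j _ hj => expClass_singleL_of_ne hj.symm _
  · simp

lemma expClassOne_conj (w : unitary A) (a : A) :
    expClassOne A (w * a * star (w : A)) = expClassOne A a :=
  expHom_conj _ w a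

lemma expClassOne_of_mem_commutatorSpan {b : A} (hb : b ∈ commutatorSpan A) :
    expClassOne A b = 0 := by
  -- The span is complex but `expClassOne` is only additive, so an arbitrary scalar is carried
  -- through the induction.
  suffices h : ∀ c : ℂ, expClassOne A (c • b) = 0 by simpa using h 1
  induction hb using Submodule.span_induction with
  | mem x hx =>
    obtain ⟨a, w, rfl⟩ := hx
    intro c
    have : c • (a - w * a * star (w : A)) = c • a - w * (c • a) * star (w : A) := by
      rw [smul_sub, mul_smul_comm, smul_mul_assoc]
    rw [this, map_sub, expClassOne_conj, sub_self]
  | zero => simp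
  | add x y _ _ hx hy => intro c; rw [smul_add, map_add, hx, hy, add_zero]
  | smul r x _ hx => intro c; rw [smul_smul]; exact hx _

lemma expClassOne_projection {n : ℕ} {p : Mat A n} (hp : IsStarProjection p) :
    expClassOne A ((2 * Real.pi) • matTrace p) = 0 := by
  have h1 : (2 * Real.pi) • matTrace p = matTrace ((2 * Real.pi : ℂ) • p) := by
    rw [← matTraceL_apply, ← matTraceL_apply, map_smul, ← Complex.coe_smul]
    push_cast
    rfl
  rw [h1, ← expClass_eq]
  exact expHom_two_pi_smul_projection _ hp

lemma exists_ev_eq_of_mem_K0image {g : AffT A} (hg : g ∈ K0image A) :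
    ∃ a : A, ev a = g ∧ expClassOne A ((2 * Real.pi) • a) = 0 := by
  induction hg using AddSubgroup.closure_induction with
  | mem x hx =>
    obtain ⟨n, p, hp, rfl⟩ := hx
    exact ⟨matTrace p, rfl, expClassOne_projection hp⟩
  | zero => exact ⟨0, map_zero (evHom A), by simp⟩
  | add x y _ _ hx hy =>
    obtain ⟨a, rfl, ha⟩ := hx
    obtain ⟨b, rfl, hb⟩ := hy
    exact ⟨a + b, map_add (evHom A) a b, by rw [smul_add, map_add, ha, hb, add_zero]⟩
  | neg x _ hx =>
    obtain ⟨a, rfl, ha⟩ := hx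
    exact ⟨-a, map_neg (evHom A) a, by rw [smul_neg, map_neg, ha, neg_zero]⟩

/-- Up to small norm, h is a combination of traces of projections, killed because exp(2πip) = 1,
plus an element of the commutator span, killed by conjugation invariance. Closedness of the kernel
absorbs the error. -/
lemma expClassOne_eq_zero {h : A} (hh : IsSelfAdjoint h) (hK : ev h ∈ K0bar A) :
    expClassOne A ((2 * Real.pi) • h) = 0 := by
  refine expHom_eq_zero_of_approx _ fun ε hε => ?_
  have hpi := Real.pi_pos
  -- One `δ` pays for the approximation in K_0, one for the distance to the commutators, and 2π is
  -- the scaling of the exponent.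
  set δ := ε / (2 * Real.pi) / 2 with hδ
  have hδ0 : 0 < δ := by positivity
  obtain ⟨g, hg, hlt⟩ := Metric.mem_closure_iff.1 hK δ hδ0
  obtain ⟨a, rfl, ha⟩ := exists_ev_eq_of_mem_K0image hg
  have h1 : ∀ τ ∈ tracialStates A, |(τ (h - realPart a : A)).re| ≤ δ := fun τ hτ => by
    have h2 : (ev (h - realPart a : A)) = ev h - ev a := by
      rw [← ev_realPart a]
      exact map_sub (evHom A) _ _
    have h3 : ‖(ev h - ev a).1 ⟨τ, hτ⟩‖ ≤ ‖ev h - ev a‖ := (ev h - ev a).1.norm_coe_le_norm _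
    rw [← h2, Real.norm_eq_abs] at h3
    rw [dist_eq_norm] at hlt
    exact (h3.trans (le_of_eq (by rw [h2]))).trans hlt.le
  obtain ⟨b, hb, hnorm⟩ := exists_mem_commutatorSpan_norm_sub_lt (hh.sub (realPart a).2) hδ0.le h1
    hδ0
  refine ⟨(2 * Real.pi) • ((realPart a : A) + b), ?_, ?_⟩
  · have h4 : (2 * Real.pi) • (realPart a : A) = realPart ((2 * Real.pi) • a) := by
      rw [map_smul, selfAdjoint.val_smul]
    change expClassOne A _ = 0
    rw [smul_add, map_add, ← Complex.coe_smul (2 * Real.pi) b,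
      expClassOne_of_mem_commutatorSpan (Submodule.smul_mem _ _ hb), add_zero, ← ha, h4]
    exact expHom_realPart _ _
  · rw [← smul_sub, norm_smul, ← sub_sub, Real.norm_eq_abs, abs_of_pos (by positivity)]
    calc 2 * Real.pi * ‖h - (realPart a : A) - b‖ < 2 * Real.pi * (δ + δ) := by gcongr
      _ = ε := by rw [hδ]; field_simp; ring

lemma exists_toK1bar_eq {x : UInf A} (hx : x ∈ U0Inf A) : ∃ (n : ℕ) (h : selfAdjoint (Mat A n)),
    toK1bar x = toK1bar (UInf.of A n (expUnitary h)) := by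
  obtain ⟨n, l, rfl⟩ := exists_list_of_mem_U0Inf hx
  exact ⟨n, l.sum, map_prod_expUnitary (isClosed_ker_toK1bar n) l⟩

/-- Modulo closed commutators x is one exponential exp(ih), whose class depends only on tr h. Zero
determinant puts ev of tr(h)/2π in the closure of K_0, and `expClassOne_eq_zero` applies. -/
lemma detKer_le_DUbar : detKer A ≤ DUbar A := by
  intro x hx
  obtain ⟨n, h, hxh⟩ := exists_toK1bar_eq hx.1
  have h1 : detBar (UInf.of A n (expUnitary h)) = 0 := by
    have h2 : x⁻¹ * UInf.of A n (expUnitary h) ∈ DUbar A := QuotientGroup.eq.1 hxh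
    have h3 := (mul_mem hx (DUbar_le_detKer h2)).2
    rwa [mul_inv_cancel_left] at h3
  rw [← toK1bar_eq_one, hxh]
  rw [detBar_expUnitary, ← toHHom_apply, toHHom_eq_zero] at h1
  have htr : IsSelfAdjoint (matTrace (h : Mat A n)) := by
    rw [IsSelfAdjoint, matTrace, star_sum]
    refine Finset.sum_congr rfl fun i _ => ?_
    rw [← CStarMatrix.star_apply, selfAdjoint.star_val_eq]
  have h4 := expClassOne_eq_zero (IsSelfAdjoint.smul (.all _) htr) h1
  rw [smul_smul, mul_inv_cancel₀ (by positivity), one_smul, ← expClass_eq, expClass_coe] at h4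
  exact h4

end ExpClass

/-! ### Rotation maps -/

section Rotation

open selfAdjoint

variable {A : Type u} [CStarAlgebra A] [PartialOrder A] [StarOrderedRing A]
  {B : Type v} [CStarAlgebra B] [PartialOrder B] [StarOrderedRing B]

lemma toK1_eq_one {x : UInf A} : toK1 x = 1 ↔ x ∈ U0Inf A := QuotientGroup.eq_one_iff x

lemma mul_inv_mem_U0Inf {x y : UInf A} (h : toK1 x = toK1 y) : x * y⁻¹ ∈ U0Inf A := by
  rw [← toK1_eq_one, map_mul, map_inv, h, mul_inv_cancel]

lemma toK1_UInfMap (φ : A →⋆ₙₐ[ℂ] B) (x : UInf A) : toK1 (UInfMap φ x) = K1Map φ (toK1 x) := rfl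

lemma toK1bar_UInfMap (φ : A →⋆ₙₐ[ℂ] B) (x : UInf A) :
    toK1bar (UInfMap φ x) = K1barMap φ (toK1bar x) := rfl

lemma UInfMap_mem_U0Inf (φ : A →⋆ₙₐ[ℂ] B) {x : UInf A} (hx : x ∈ U0Inf A) :
    UInfMap φ x ∈ U0Inf B := by
  rw [← toK1_eq_one, toK1_UInfMap, toK1_eq_one.2 hx, map_one]

/-- diag(x, y) is the product of x with a conjugate of y, so the representatives chosen in
`UInf.diag` do not matter for the class. -/
lemma toK1bar_diag (x y : UInf A) : toK1bar (UInf.diag x y) = toK1bar x * toK1bar y := by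
  let p : Σ n, U A n := Quotient.out (s := DirectLimit.setoid (pad A)) x
  let q : Σ n, U A n := Quotient.out (s := DirectLimit.setoid (pad A)) y
  have hp : UInf.of A p.1 p.2 = x := Quotient.out_eq (s := DirectLimit.setoid (pad A)) x
  have hq : UInf.of A q.1 q.2 = y := Quotient.out_eq (s := DirectLimit.setoid (pad A)) y
  have h : UInf.diag x y = UInf.of A (p.1 + q.1) (blockDiag p.2 q.2) := rfl
  obtain ⟨σ, hσ⟩ := blockDiag_one_left p.1 q.2
  have h1 : blockDiag p.2 q.2 = blockDiag p.2 1 * blockDiag 1 q.2 := by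
    rw [← blockDiag_mul, mul_one, one_mul]
  have h2 : UInf.of A _ (blockDiag (1 : U A p.1) q.2)
      = UInf.of A _ (permU A _ σ) * y * (UInf.of A _ (permU A _ σ))⁻¹ := by
    rw [hσ, map_mul, map_mul, map_inv, UInf.of_pad, hq]
  rw [h, h1, map_mul, blockDiag_one_right, UInf.of_pad, hp, h2, map_mul, map_mul, map_mul, map_inv,
    mul_comm _ (toK1bar y), mul_inv_cancel_right]

lemma detBar_eq_zero_of_mem_DUbar {x : UInf A} (hx : x ∈ DUbar A) : detBar x = 0 :=
  (DUbar_le_detKer hx).2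

lemma detBar_congr {x y : UInf A} (hy : y ∈ U0Inf A) (h : toK1bar x = toK1bar y) :
    detBar x = detBar y := by
  have h1 : y⁻¹ * x ∈ DUbar A := QuotientGroup.eq.1 h.symm
  have h2 := detBar_mul hy (DUbar_le_detKer h1).1
  rwa [mul_inv_cancel_left, detBar_eq_zero_of_mem_DUbar h1, add_zero] at h2

lemma rotation_eq (C : NTBasis A) (D : NTBasis B) (φ : A →⋆ₙₐ[ℂ] B) (k : K1 A) :
    rotation C D φ k = detBar (UInfMap φ (C.c k) * (D.c (K1Map φ k))⁻¹) := by
  refine detBar_congr (mul_inv_mem_U0Inf ?_) ?_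
  · rw [toK1_UInfMap, C.toK1_c, D.toK1_c]
  · rw [toK1bar_diag, map_mul]

lemma UInfMap_mul_inv_mem_U0Inf {φ ψ : A →⋆ₙₐ[ℂ] B} (h : K1Map φ = K1Map ψ) (x : UInf A) :
    UInfMap φ x * (UInfMap ψ x)⁻¹ ∈ U0Inf B :=
  mul_inv_mem_U0Inf (by rw [toK1_UInfMap, toK1_UInfMap, h])

/-- Both rotation maps use the same d, which cancels by additivity of the determinant. What is left
does not involve `D`. -/
lemma relRotation_eq (C : NTBasis A) (D : NTBasis B) {φ ψ : A →⋆ₙₐ[ℂ] B} (h : K1Map φ = K1Map ψ)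
    (k : K1 A) : relRotation C D φ ψ k = detBar (UInfMap φ (C.c k) * (UInfMap ψ (C.c k))⁻¹) := by
  have h1 : ∀ χ : A →⋆ₙₐ[ℂ] B, UInfMap χ (C.c k) * (D.c (K1Map χ k))⁻¹ ∈ U0Inf B := fun χ =>
    mul_inv_mem_U0Inf (by rw [toK1_UInfMap, C.toK1_c, D.toK1_c])
  rw [relRotation, rotation_eq, rotation_eq, sub_eq_add_neg, ← detBar_inv (h1 ψ),
    ← detBar_mul (h1 φ) (inv_mem (h1 ψ)), h]
  congr 1
  group

/-- The effect on the relative rotation of multiplication by an element of `U_0^∞(A)`. -/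
lemma exists_detBar_mul_inv_eq {w : UInf A} (hw : w ∈ U0Inf A) : ∃ h : selfAdjoint A,
    ∀ {B : Type v} [CStarAlgebra B] [PartialOrder B] [StarOrderedRing B] {φ ψ : A →⋆ₙₐ[ℂ] B},
      K1Map φ = K1Map ψ → ∀ c : UInf A, detBar (UInfMap φ (w * c) * (UInfMap ψ (w * c))⁻¹)
        = detBar (UInfMap φ c * (UInfMap ψ c)⁻¹)
          + (toH (ev (φ (h : A))) - toH (ev (ψ (h : A)))) := by
  obtain ⟨h, -, hh⟩ := exists_detBar_eq.{u, v} hw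
  refine ⟨h, fun {B} _ _ _ φ ψ hφψ c => ?_⟩
  have h1 := UInfMap_mem_U0Inf φ hw
  have h2 := UInfMap_mem_U0Inf ψ hw
  have h3 := UInfMap_mul_inv_mem_U0Inf hφψ c
  -- The middle factor lies in U_0^∞ because the K_1-maps agree, the outer ones because w does; the
  -- determinant is additive on the three.
  have h4 : UInfMap φ (w * c) * (UInfMap ψ (w * c))⁻¹
      = UInfMap φ w * (UInfMap φ c * (UInfMap ψ c)⁻¹) * (UInfMap ψ w)⁻¹ := by
    rw [map_mul, map_mul]
    group
  rw [h4, detBar_mul (mul_mem h1 h3) (inv_mem h2), detBar_mul h1 h3, detBar_inv h2, hh φ, hh ψ]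
  abel

lemma enorm_relRotation_le (C C' : NTBasis A) (D D' : NTBasis B) {φ ψ : A →⋆ₙₐ[ℂ] B}
    (h : K1Map φ = K1Map ψ) (k : K1 A) :
    ‖relRotation C D φ ψ k‖ₑ ≤ distR C' D' φ ψ + distH φ ψ := by
  have hw : C.c k * (C'.c k)⁻¹ ∈ U0Inf A :=
    mul_inv_mem_U0Inf (by rw [C.toK1_c, C'.toK1_c])
  obtain ⟨a, ha⟩ := exists_detBar_mul_inv_eq.{u, v} hw
  have h1 := ha h (C'.c k)
  rw [inv_mul_cancel_right, ← relRotation_eq C D h, ← relRotation_eq C' D' h] at h1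
  rw [h1]
  refine (enorm_add_le _ _).trans (add_le_add ?_ ?_)
  · exact le_iSup (fun k => ‖relRotation C' D' φ ψ k‖ₑ) k
  · rw [← edist_eq_enorm_sub]
    exact le_iSup (fun a : selfAdjoint A => edist (toH (ev (φ (a : A)))) (toH (ev (ψ (a : A))))) a

lemma distTriv_of_ne {φ ψ : A →⋆ₙₐ[ℂ] B} (h : K1Map φ ≠ K1Map ψ) : distTriv φ ψ = ⊤ := if_neg h

lemma distTriv_of_eq {φ ψ : A →⋆ₙₐ[ℂ] B} (h : K1Map φ = K1Map ψ) : distTriv φ ψ = 0 := if_pos h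

/-- The H-term occurs once by itself and once as the cost of changing the basis of `A`. -/
lemma distNT_le_two_mul (C C' : NTBasis A) (D D' : NTBasis B) (φ ψ : A →⋆ₙₐ[ℂ] B) :
    distNT C D φ ψ ≤ 2 * distNT C' D' φ ψ := by
  by_cases h : K1Map φ = K1Map ψ
  · have h1 : distR C D φ ψ ≤ distR C' D' φ ψ + distH φ ψ :=
      iSup_le fun k => enorm_relRotation_le C C' D D' h k
    rw [distNT, distNT, distTriv_of_eq h, add_zero, add_zero]
    calc distH φ ψ + distR C D φ ψ ≤ distH φ ψ + (distR C' D' φ ψ + distH φ ψ) := by gcongr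
      _ ≤ distH φ ψ + (distR C' D' φ ψ + distH φ ψ) + distR C' D' φ ψ := le_self_add
      _ = 2 * (distH φ ψ + distR C' D' φ ψ) := by ring
  · rw [distNT, distNT, distTriv_of_ne h, add_top, add_top, ENNReal.mul_top two_ne_zero]

/-! ### The metrics -/

lemma distNT_comm (C : NTBasis A) (D : NTBasis B) (φ ψ : A →⋆ₙₐ[ℂ] B) :
    distNT C D φ ψ = distNT C D ψ φ := by
  have h1 : distH φ ψ = distH ψ φ := by simp only [distH, edist_comm]
  have h2 : distR C D φ ψ = distR C D ψ φ := by
    simp only [distR, relRotation, ← edist_eq_enorm_sub, edist_comm]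
  have h3 : distTriv φ ψ = distTriv ψ φ := by
    by_cases h : K1Map φ = K1Map ψ
    · rw [distTriv_of_eq h, distTriv_of_eq h.symm]
    · rw [distTriv_of_ne h, distTriv_of_ne (Ne.symm h)]
  rw [distNT, distNT, h1, h2, h3]

lemma distNT_triangle (C : NTBasis A) (D : NTBasis B) (φ ψ χ : A →⋆ₙₐ[ℂ] B) :
    distNT C D φ χ ≤ distNT C D φ ψ + distNT C D ψ χ := by
  have h1 : distH φ χ ≤ distH φ ψ + distH ψ χ := iSup_le fun a =>
    (edist_triangle _ (toH (ev (ψ (a : A)))) _).trans (add_le_add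
      (le_iSup (fun a : selfAdjoint A => edist (toH (ev (φ (a : A)))) (toH (ev (ψ (a : A))))) a)
      (le_iSup (fun a : selfAdjoint A => edist (toH (ev (ψ (a : A)))) (toH (ev (χ (a : A))))) a))
  have h2 : distR C D φ χ ≤ distR C D φ ψ + distR C D ψ χ := iSup_le fun k => by
    have : relRotation C D φ χ k = relRotation C D φ ψ k + relRotation C D ψ χ k := by
      simp only [relRotation]; abel
    rw [this]
    exact (enorm_add_le _ _).trans (add_le_add (le_iSup (fun k => ‖relRotation C D φ ψ k‖ₑ) k)
      (le_iSup (fun k => ‖relRotation C D ψ χ k‖ₑ) k))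
  have h3 : distTriv φ χ ≤ distTriv φ ψ + distTriv ψ χ := by
    by_cases hφψ : K1Map φ = K1Map ψ
    · by_cases hψχ : K1Map ψ = K1Map χ
      · rw [distTriv_of_eq (hφψ.trans hψχ)]; exact zero_le
      · rw [distTriv_of_ne hψχ, add_top]; exact le_top
    · rw [distTriv_of_ne hφψ, top_add]; exact le_top
  calc distNT C D φ χ ≤ distH φ ψ + distH ψ χ + (distR C D φ ψ + distR C D ψ χ)
        + (distTriv φ ψ + distTriv ψ χ) := add_le_add (add_le_add h1 h2) h3
    _ = _ := by rw [distNT, distNT]; ring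

lemma detBar_UInfMap_expUnitary (φ : A →⋆ₙₐ[ℂ] B) (k : selfAdjoint (Mat A 1)) :
    detBar (UInfMap φ (UInf.of A 1 (expUnitary k)))
      = toH (ev ((2 * Real.pi)⁻¹ • φ ((k : Mat A 1) 0 0))) := by
  rw [UInfMap_of, Umap, unitaryMap_expUnitary, detBar_expUnitary]
  simp [matTrace]

lemma distNT_eq_zero_of_K1barMap_eq (C : NTBasis A) (D : NTBasis B) {φ ψ : A →⋆ₙₐ[ℂ] B}
    (h : K1barMap φ = K1barMap ψ) : distNT C D φ ψ = 0 := by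
  have hmem : ∀ x : UInf A, UInfMap φ x * (UInfMap ψ x)⁻¹ ∈ DUbar B := fun x => by
    rw [← toK1bar_eq_one, map_mul, map_inv, toK1bar_UInfMap, toK1bar_UInfMap, h, mul_inv_cancel]
  have hK : K1Map φ = K1Map ψ := by
    ext x
    have := toK1_eq_one.2 (DUbar_le_detKer (hmem x)).1
    rw [map_mul, map_inv, mul_inv_eq_one] at this
    exact this
  have h1 : distR C D φ ψ = 0 := by
    refine le_antisymm (iSup_le fun k => ?_) zero_le
    rw [relRotation_eq C D hK, detBar_eq_zero_of_mem_DUbar (hmem _), enorm_zero]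
  have h2 : distH φ ψ = 0 := by
    refine le_antisymm (iSup_le fun a => ?_) zero_le
    -- The factor 2π offsets the normalisation of the determinant: the image of exp(2πia) under φ
    -- has determinant [ev_{φ(a)}], so \overline{K}_1(φ) determines these classes.
    let k : selfAdjoint (Mat A 1) :=
      ⟨diagHom 0 ((2 * Real.pi) • (a : A)), (IsSelfAdjoint.smul (.all _) a.2).map (diagHom 0)⟩
    have hk : ∀ χ : A →⋆ₙₐ[ℂ] B, detBar (UInfMap χ (UInf.of A 1 (expUnitary k)))
        = toH (ev (χ (a : A))) := fun χ => by
      have hχ : χ ((k : Mat A 1) 0 0) = (2 * Real.pi) • χ (a : A) := by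
        have : (k : Mat A 1) 0 0 = (2 * Real.pi) • (a : A) := by
          simp [k, diagHom_apply, singleL_apply]
        rw [this, ← Complex.coe_smul, map_smul, Complex.coe_smul]
      rw [detBar_UInfMap_expUnitary, hχ, smul_smul, inv_mul_cancel₀ (by positivity), one_smul]
    rw [← hk φ, ← hk ψ, detBar_congr (UInfMap_mem_U0Inf ψ (of_expUnitary_mem_U0Inf k)), edist_self]
    rw [toK1bar_UInfMap, toK1bar_UInfMap, h]
  rw [distNT, h1, h2, distTriv_of_eq hK, add_zero, add_zero]

/-- Any x is wc with c in the basis and w in U_0^∞. Vanishing of the rotation term at c and of the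
H-term gives determinant 0 for φ(x) ψ(x)⁻¹, and `detKer_le_DUbar` applies. -/
lemma K1barMap_eq_of_distNT_eq_zero (C : NTBasis A) (D : NTBasis B) {φ ψ : A →⋆ₙₐ[ℂ] B}
    (h : distNT C D φ ψ = 0) : K1barMap φ = K1barMap ψ := by
  rw [distNT, add_eq_zero, add_eq_zero] at h
  obtain ⟨⟨hH, hR⟩, hT⟩ := h
  have hK : K1Map φ = K1Map ψ := by
    by_contra hne
    rw [distTriv_of_ne hne] at hT
    exact ENNReal.top_ne_zero hT
  ext x
  change toK1bar (UInfMap φ x) = toK1bar (UInfMap ψ x)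
  have hw : x * (C.c (toK1 x))⁻¹ ∈ U0Inf A := mul_inv_mem_U0Inf (by rw [C.toK1_c])
  obtain ⟨a, ha⟩ := exists_detBar_mul_inv_eq.{u, v} hw
  have h1 := ha hK (C.c (toK1 x))
  have h2 : relRotation C D φ ψ (toK1 x) = 0 := by
    rw [distR, ENNReal.iSup_eq_zero] at hR
    exact enorm_eq_zero.1 (hR _)
  have h3 : toH (ev (φ (a : A))) = toH (ev (ψ (a : A))) := by
    rw [distH, ENNReal.iSup_eq_zero] at hH
    exact edist_eq_zero.1 (hH a)
  rw [inv_mul_cancel_right, ← relRotation_eq C D hK, h2, h3, sub_self, add_zero] at h1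
  have h4 : UInfMap φ x * (UInfMap ψ x)⁻¹ ∈ DUbar B :=
    detKer_le_DUbar ⟨UInfMap_mul_inv_mem_U0Inf hK x, h1⟩
  rwa [← toK1bar_eq_one, map_mul, map_inv, mul_inv_eq_one] at h4

lemma toMor_surjective (F : K1barMor A B) : ∃ φ : A →⋆ₙₐ[ℂ] B, toMor φ = F := by
  obtain ⟨φ, hφ⟩ := F.2
  exact ⟨φ, Subtype.ext hφ⟩

/-- A *-homomorphism inducing a given morphism. -/
def repHom (F : K1barMor A B) : A →⋆ₙₐ[ℂ] B := (toMor_surjective F).choose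

lemma toMor_repHom (F : K1barMor A B) : toMor (repHom F) = F := (toMor_surjective F).choose_spec

/-- Homomorphisms inducing the same morphism are at distance zero, so by the triangle inequality the
distance does not depend on the representatives. -/
lemma distNT_congr (C : NTBasis A) (D : NTBasis B) {φ φ' ψ ψ' : A →⋆ₙₐ[ℂ] B}
    (h : toMor φ = toMor φ') (h' : toMor ψ = toMor ψ') :
    distNT C D φ ψ = distNT C D φ' ψ' := by
  have key : ∀ {φ φ' ψ ψ' : A →⋆ₙₐ[ℂ] B}, toMor φ = toMor φ' → toMor ψ = toMor ψ' →
      distNT C D φ ψ ≤ distNT C D φ' ψ' := fun {φ φ' ψ ψ'} h h' => by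
    have h1 := distNT_eq_zero_of_K1barMap_eq C D (congrArg Subtype.val h)
    have h2 := distNT_eq_zero_of_K1barMap_eq C D (congrArg Subtype.val h'.symm)
    calc distNT C D φ ψ ≤ distNT C D φ φ' + (distNT C D φ' ψ' + distNT C D ψ' ψ) :=
          (distNT_triangle C D φ φ' ψ).trans (add_le_add le_rfl (distNT_triangle C D φ' ψ' ψ))
      _ = distNT C D φ' ψ' := by
          rw [show distNT C D φ φ' = 0 from h1, show distNT C D ψ' ψ = 0 from h2, zero_add,
            add_zero]
  exact le_antisymm (key h h') (key h.symm h'.symm)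

/-- The metric on the set of `\overline{K}_1`-morphisms defined by Nielsen-Thomsen bases. -/
@[reducible] def ntMetric (C : NTBasis A) (D : NTBasis B) : EMetricSpace (K1barMor A B) where
  edist F G := distNT C D (repHom F) (repHom G)
  edist_self _ := distNT_eq_zero_of_K1barMap_eq C D rfl
  edist_comm _ _ := distNT_comm C D _ _
  edist_triangle _ _ _ := distNT_triangle C D _ _ _
  eq_of_edist_eq_zero {F G} h := by
    rw [← toMor_repHom F, ← toMor_repHom G]
    exact Subtype.ext (K1barMap_eq_of_distNT_eq_zero C D h)

lemma ntMetric_edist (C : NTBasis A) (D : NTBasis B) (φ ψ : A →⋆ₙₐ[ℂ] B) :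
    (ntMetric C D).edist (toMor φ) (toMor ψ) = distNT C D φ ψ :=
  distNT_congr C D (toMor_repHom _) (toMor_repHom _)

/-- The identity map is 2-Lipschitz from one metric to the other. -/
lemma ntMetric_topology_le (C C' : NTBasis A) (D D' : NTBasis B) :
    (ntMetric C D).toUniformSpace.toTopologicalSpace
      ≤ (ntMetric C' D').toUniformSpace.toTopologicalSpace :=
  continuous_id_iff_le.1 (@LipschitzWith.continuous _ _ (ntMetric C D).toPseudoEMetricSpace
    (ntMetric C' D').toPseudoEMetricSpace 2 id fun _ _ => distNT_le_two_mul C' C D' D _ _)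

end Rotation

end NielsenThomsen

end

theorem mainTheorem5 {A : Type*} [CStarAlgebra A] [PartialOrder A] [StarOrderedRing A]
    {B : Type*} [CStarAlgebra B] [PartialOrder B] [StarOrderedRing B]
    (C C' : NielsenThomsen.NTBasis A) (D D' : NielsenThomsen.NTBasis B) :
    (∀ φ ψ : A →⋆ₙₐ[ℂ] B,
      NielsenThomsen.distNT C D φ ψ ≤ 2 * NielsenThomsen.distNT C' D' φ ψ) ∧
    ∃ m m' : EMetricSpace (NielsenThomsen.K1barMor A B),
      (∀ φ ψ : A →⋆ₙₐ[ℂ] B,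
        m.edist (NielsenThomsen.toMor φ) (NielsenThomsen.toMor ψ) =
          NielsenThomsen.distNT C D φ ψ) ∧
      (∀ φ ψ : A →⋆ₙₐ[ℂ] B,
        m'.edist (NielsenThomsen.toMor φ) (NielsenThomsen.toMor ψ) =
          NielsenThomsen.distNT C' D' φ ψ) ∧
      m.toUniformSpace.toTopologicalSpace = m'.toUniformSpace.toTopologicalSpace := by
  exact ⟨NielsenThomsen.distNT_le_two_mul C C' D D', NielsenThomsen.ntMetric C D,
    NielsenThomsen.ntMetric C' D', NielsenThomsen.ntMetric_edist C D,
    NielsenThomsen.ntMetric_edist C' D',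
    le_antisymm (NielsenThomsen.ntMetric_topology_le C C' D D')
      (NielsenThomsen.ntMetric_topology_le C' C D' D)⟩
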